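/- Let $k,d\ge1$, $\Delta t>0$, $\epsilon\in(0,1]$, $K\in\mathbb R$, $\mathcal I=[t_0,t_0+\Delta t]$, and let $\|\cdot\|$ be the two-norm of matrices. **Hamiltonian.** Let $H(t)=\sum_{\mu=1}^M T_\mu^\dagger H_\mu(t)T_\mu$, where the $T_\mu$ are unitary and the $H_\mu:\mathbb R\to\mathbb C^{2^n\times2^n}$ are Hermitian on $\mathcal I$. Assume: * $\{H_\mu\}$ is $d$-sparse on $\mathcal I$: each row of each $H_\mu$ has at most $d$ entries that are nonzero at some time in $\mathcal I$. * $\{H_\mu\}$ is $\Upsilon$-$2k$-pointwise-smooth on $\mathcal I$: the derivatives $H_\mu^{(p)}$, $p\le 2k$, exist on $\mathcal I$, and $\Upsilon(t)\ge\big(\sum_\mu\|H_\mu^{(p)}(t)\|\big)^{1/(p+1)}$ for all $t\in\mathcal I$ and $0\le p\le 2k$. * $\Upsilon\ge0$ is differentiable on $\mathcal I$ with $|\Upsilon'(t)|\le K^2\Upsilon(t)^2$. * $\|H_\mu(t)\|\le H_{\max}$ and $\|\partial_tH_\mu(t)\|\le D$ for all $t\in\mathcal I$ and all $\mu$. **Oracles.**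 The evolution is to be simulated by a quantum circuit with free unitary operations that do not depend on the Hamiltonian, calls of $T_\mu$ and $T_\mu^\dagger$ (their number is $N_{\rm T}$), and queries (their number is $N$) to two oracles which give one bit per query: * One oracle gives, for each row of each $H_\mu$, the column numbers in a list of $d$ distinct columns containing all columns of entries that are ever nonzero. * The other gives the entries of $H_\mu(t_q)$ at the mesh times $t_q=t_0+(q-\tfrac12)\Delta t/2^{n_t}$, $1\le q\le 2^{n_t}$, in polar form. Of $n_H$ bits, $\lfloor n_H/2\rfloor$ each are used for modulus and phase; the errors are at most $H_{\max}2^{-\lfloor n_H/2\rfloor}$ and $2\pi\,2^{-\lfloor n_H/2\rfloor}$. Assume $$n_t\ge\Big\lceil\log_2\tfrac{D\,(32kMd^2)(5/3)^{k-1}\Delta t^2}{\epsilon}\Big\rceil,\qquad n_H\ge2\Big\lceil\log_2\tfrac{32kMd^2(5/3)^{k-1}H_{\max}\Delta t}{\epsilon}\Big\rceil+6 .$$ **One-sparse cost.** Each $H_\mu$ is decomposed into $6d^2$ one-sparse Hermitian matrices by the colouring of Berry, Ahokas, Cleve and Sanders (position of each index in the list of the other, and a label in $\{0,\dots,5\}$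 found by deterministic coin tossing). Let $C$ be the least number of oracle queries that suffices to perform any one exponential $e^{-i\tilde H_{\mu,j}(t_q)\delta}$, $\delta\in\mathbb R$, of these one-sparse matrices as represented by the oracle. **Time steps.** Put $\bar\Upsilon=\frac1{\Delta t}\int_{\mathcal I}\Upsilon$ and $$r_g=\Big\lceil\frac{[24d^2k(5/3)^{k-1}\bar\Upsilon\Delta t]^{1+1/(2k)}}{\epsilon^{1/(2k)}}+3K^2\bar\Upsilon\Delta t+1\Big\rceil,\qquad Y=\frac{24d^2k(5/3)^{k-1}}{(\epsilon/r_g)^{1/(2k+1)}},$$ $$t_{p+1}=t_p+\frac1{\Upsilon(t_p)\,(Y+K^2)},\quad p=0,1,\dots,$$ where the first step that would reach or pass $t_0+\Delta t$ (in particular, one with $\Upsilon(t_p)=0$) is cut off at $t_0+\Delta t$. **Theorem.** The end is reached after some number $r\le r_g$ of steps, $t_0<t_1<\dots<t_r=t_0+\Delta t$. There is a circuit, depending only on $n,d,M,k,n_t,n_H,t_0,\Delta t,\epsilon,K,H_{\max},D,\Upsilon$ and not on the $H_\mu$, the $T_\mu$ or the oracles, which performs exactly the product $\tilde U=\tilde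 U_k(t_r,t_{r-1})\cdots\tilde U_k(t_1,t_0)$ of Lie–Trotter–Suzuki integrators of order $2k$, made of these one-sparse exponentials, conjugated by the $T_\mu$, with times rounded to the mesh. For all $H_\mu$, $T_\mu$ and oracles as above, $$\|U(t_0+\Delta t,t_0)-\tilde U\|\le\epsilon,$$ where $U(t,t_0)$ solves $\partial_tU=-iH(t)U$ on $\mathcal I$, $U(t_0,t_0)=1$. Moreover $$N\le12CMd^25^{k-1}L,\qquad L=\Big\lceil\frac{[24d^2k(5/3)^{k-1}\bar\Upsilon\Delta t]^{1+1/(2k)}}{(\epsilon/4)^{1/(2k)}}+3K^2\bar\Upsilon\Delta t+1\Big\rceil,$$ and $3Cd^2\,N_{\rm T}\le N$, that is, $N_{\rm T}\le N/(3Cd^2)$ if $C>0$. In any case $3d^2N_{\rm T}\le12Md^25^{k-1}L$. -/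

import Mathlib

open scoped Matrix Matrix.Norms.L2Operator Kronecker
open MeasureTheory

noncomputable section

namespace QSim

/-! ### Smoothness and sparseness -/

/-- A finite family of operators is `P`-smooth on `S` if all its derivatives of order at most `P`
exist on `S` (one-sided derivatives at end points that belong to `S`). -/
def IsSmoothOn {N M : ℕ} (H : Fin M → ℝ → Matrix (Fin N) (Fin N) ℂ) (P : ℕ) (S : Set ℝ) : Prop :=
  ∀ μ, ∀ p < P, DifferentiableOn ℝ (iteratedDerivWithin p (H μ) S) S

/-- `Υ`-`P`-pointwise-smoothness on `S`. The norm of a matrix is its two-norm. -/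
def IsPointwiseSmoothOn {N M : ℕ} (H : Fin M → ℝ → Matrix (Fin N) (Fin N) ℂ) (Υ : ℝ → ℝ) (P : ℕ)
    (S : Set ℝ) : Prop :=
  IsSmoothOn H P S ∧ ∀ t ∈ S, ∀ p ≤ P,
    (∑ μ, ‖iteratedDerivWithin p (H μ) S t‖) ^ (1 / ((p : ℝ) + 1)) ≤ Υ t

/-- `d`-sparseness on `S`: in each row, at most `d` entries are nonzero at some time in `S`. -/
def IsSparseOn {N M : ℕ} (H : Fin M → ℝ → Matrix (Fin N) (Fin N) ℂ) (d : ℕ) (S : Set ℝ) : Prop :=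
  ∀ μ x, {y | ∃ t ∈ S, H μ t x y ≠ 0}.ncard ≤ d

/-- The full Hamiltonian `H(t) = ∑ μ, T_μ† H_μ(t) T_μ`. -/
def totalHamiltonian {N M : ℕ} (H : Fin M → ℝ → Matrix (Fin N) (Fin N) ℂ)
    (T : Fin M → Matrix.unitaryGroup (Fin N) ℂ) (t : ℝ) : Matrix (Fin N) (Fin N) ℂ :=
  ∑ μ, (T μ : Matrix (Fin N) (Fin N) ℂ)ᴴ * H μ t * (T μ : Matrix (Fin N) (Fin N) ℂ)

/-- `t ↦ U t` is the evolution operator `U(t, t₀)` generated by `H` on `[t₀, t₀ + Δt]`, i.e. the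
solution of the Schrödinger equation `∂_t U = -i H(t) U` with `U(t₀) = 1`. -/
def IsEvolution {N : ℕ} (H : ℝ → Matrix (Fin N) (Fin N) ℂ) (t₀ Δt : ℝ)
    (U : ℝ → Matrix (Fin N) (Fin N) ℂ) : Prop :=
  U t₀ = 1 ∧ ∀ t ∈ Set.Icc t₀ (t₀ + Δt),
    HasDerivWithinAt U ((-Complex.I) • (H t * U t)) (Set.Icc t₀ (t₀ + Δt)) t

/-! ### The Hamiltonian oracles -/

/-- The data behind the two Hamiltonian oracles for `M` matrices of size `2 ^ n`:
`col μ x i` is the column number of the `i`-th potentially nonzero element of row `x` of `H_μ`, and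
`val μ q x y p` is the `p`-th bit of the encoding of `[H_μ(t_q)]_{xy}`. -/
structure HamOracle (n d M nt nH : ℕ) where
  col : Fin M → Fin (2 ^ n) → Fin d → Fin (2 ^ n)
  val : Fin M → Fin (2 ^ nt) → Fin (2 ^ n) → Fin (2 ^ n) → Fin nH → Bool

/-- The mesh of times, `t_q = t₀ + (q - 1/2) Δt / 2 ^ nt` for `q = 1, …, 2 ^ nt`
(here `q` is counted from `0`). -/
def meshTime (t₀ Δt : ℝ) (nt : ℕ) (q : Fin (2 ^ nt)) : ℝ :=
  t₀ + ((q : ℝ) + 1 / 2) * Δt / 2 ^ nt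

/-- The index of the mesh point closest to the time `τ ∈ [t₀, t₀ + Δt]`. -/
def meshIndex (t₀ Δt : ℝ) (nt : ℕ) (τ : ℝ) : Fin (2 ^ nt) :=
  ⟨min ⌊(τ - t₀) * 2 ^ nt / Δt⌋₊ (2 ^ nt - 1),
    lt_of_le_of_lt (min_le_right _ _) (Nat.sub_lt (Nat.two_pow_pos nt) Nat.one_pos)⟩

/-- The number in `[0, 1)` with binary digits `b 0, b 1, …` after the point. -/
def binaryFraction {m : ℕ} (b : Fin m → Bool) : ℝ :=
  ∑ p : Fin m, if b p then (1 / 2 : ℝ) ^ ((p : ℕ) + 1) else 0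

/-- The modulus read off from an encoding: the first half of the bits. -/
def modulusOf (Hmax : ℝ) {nH : ℕ} (b : Fin nH → Bool) : ℝ :=
  Hmax * binaryFraction (fun p : Fin (nH / 2) => b ⟨p, by omega⟩)

/-- The phase read off from an encoding: the second half of the bits. -/
def phaseOf {nH : ℕ} (b : Fin nH → Bool) : ℝ :=
  2 * Real.pi * binaryFraction (fun p : Fin (nH / 2) => b ⟨nH / 2 + p, by omega⟩)

/-- The complex number represented by an encoding in polar form. -/
def decode (Hmax : ℝ) {nH : ℕ} (b : Fin nH → Bool) : ℂ :=
  (modulusOf Hmax b : ℂ) * Complex.exp (Complex.I * (phaseOf b : ℂ))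

/-- The bits `b` encode `z` in polar form, modulus and phase being both correct to half of the
available number of bits. -/
def Encodes (Hmax : ℝ) {nH : ℕ} (b : Fin nH → Bool) (z : ℂ) : Prop :=
  ∃ φ : ℝ, z = (‖z‖ : ℂ) * Complex.exp (Complex.I * (φ : ℂ)) ∧
    |modulusOf Hmax b - ‖z‖| ≤ Hmax / 2 ^ (nH / 2) ∧
    |phaseOf b - φ| ≤ 2 * Real.pi / 2 ^ (nH / 2)

/-- The oracle lists `d` different column numbers for every row. -/
def HamOracle.Valid {n d M nt nH : ℕ} (O : HamOracle n d M nt nH) : Prop :=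
  ∀ μ x, Function.Injective (O.col μ x)

/-- `O` is an oracle for the family `H` on `[t₀, t₀ + Δt]`: the lists of columns contain all
elements that are ever nonzero, and the values at the mesh times are encoded correctly. -/
def HamOracle.IsOracleFor {n d M nt nH : ℕ} (O : HamOracle n d M nt nH) (Hmax t₀ Δt : ℝ)
    (H : Fin M → ℝ → Matrix (Fin (2 ^ n)) (Fin (2 ^ n)) ℂ) : Prop :=
  O.Valid ∧
  (∀ μ x y, (∃ t ∈ Set.Icc t₀ (t₀ + Δt), H μ t x y ≠ 0) → ∃ i, O.col μ x i = y) ∧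
  ∀ μ q x y, Encodes Hmax (O.val μ q x y) (H μ (meshTime t₀ Δt nt q) x y)

/-! ### Decomposition into `6 d ^ 2` one-sparse Hamiltonians

The entry at `x ≤ y` goes to the class `(i, j, ν)`, where `y` is the `i`-th column in the list of
`x`, `x` is the `j`-th column in the list of `y`, and `ν < 6` is a label of `x`. For fixed `(i, j)`
the pairs `x < y` form disjoint increasing paths, and `ν` is a proper colouring of these paths
found by deterministic coin tossing. -/

/-- The indices of the one-sparse terms; there are `6 d ^ 2` of them. -/
abbrev TermIndex (d : ℕ) : Type := Fin d × Fin d × Fin 6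

/-- All indices of one-sparse terms, in their standard order. -/
def termList (d : ℕ) : List (TermIndex d) :=
  List.finRange d ×ˢ (List.finRange d ×ˢ List.finRange 6)

/-- The position of the lowest bit in which `a` and `b` differ. -/
def firstDiff (a b : ℕ) : ℕ := sInf {p | a.testBit p ≠ b.testBit p}

open Classical in
/-- One round of deterministic coin tossing along the paths of the class `(i, j)`: the new label of
`x` is the position of the first bit in which its label differs from that of its successor, together
with this bit; at the end of a path, it is the lowest bit of the label. -/
def coinToss {N d : ℕ} (f : Fin N → Fin d → Fin N) (i j : Fin d) (L : Fin N → ℕ) (x : Fin N) : ℕ :=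
  if x < f x i ∧ f (f x i) j = x then
    2 * firstDiff (L x) (L (f x i)) + ((L x).testBit (firstDiff (L x) (L (f x i)))).toNat
  else L x % 2

/-- The labels after `r` rounds; at the start, each vertex is labelled by its own number. -/
def coinLabel {N d : ℕ} (f : Fin N → Fin d → Fin N) (i j : Fin d) : ℕ → Fin N → ℕ
  | 0 => fun x => (x : ℕ)
  | r + 1 => coinToss f i j (coinLabel f i j r)

/-- After `r` rounds the labels of `n`-bit numbers are less than `labelBound n r`. -/
def labelBound (n : ℕ) : ℕ → ℕ
  | 0 => 2 ^ n
  | r + 1 => 2 * Nat.clog 2 (labelBound n r)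

/-- The number of rounds that are needed in order to reduce the number of labels to six. -/
def coinRounds (n : ℕ) : ℕ := sInf {r | labelBound n r ≤ 6}

/-- The pair `x ≤ y` belongs to the class `c` (for the lists of columns `f`). -/
def InClass {n d : ℕ} (f : Fin (2 ^ n) → Fin d → Fin (2 ^ n)) (c : TermIndex d)
    (x y : Fin (2 ^ n)) : Prop :=
  f x c.1 = y ∧ f y c.2.1 = x ∧ coinLabel f c.1 c.2.1 (coinRounds n) x = (c.2.2 : ℕ)

open Classical in
/-- The one-sparse Hermitian matrix `H̃_{μ,c}(t_q)`, as it is represented by the oracle. Only the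
entries with row number at most column number are read. -/
def oneSparseTerm {n d M nt nH : ℕ} (O : HamOracle n d M nt nH) (Hmax : ℝ) (μ : Fin M)
    (c : TermIndex d) (q : Fin (2 ^ nt)) : Matrix (Fin (2 ^ n)) (Fin (2 ^ n)) ℂ :=
  Matrix.of fun x y =>
    if x = y then
      if InClass (O.col μ) c x x then ((decode Hmax (O.val μ q x x)).re : ℂ) else 0
    else if x < y then
      if InClass (O.col μ) c x y then decode Hmax (O.val μ q x y) else 0
    else
      if InClass (O.col μ) c y x then star (decode Hmax (O.val μ q y x)) else 0

/-- The one-sparse exponential `exp(-i H̃_{μ,c}(t_q) δ)`. -/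
def oneSparseExp {n d M nt nH : ℕ} (O : HamOracle n d M nt nH) (Hmax : ℝ) (μ : Fin M)
    (c : TermIndex d) (q : Fin (2 ^ nt)) (δ : ℝ) : Matrix (Fin (2 ^ n)) (Fin (2 ^ n)) ℂ :=
  NormedSpace.exp ((-Complex.I * (δ : ℂ)) • oneSparseTerm O Hmax μ c q)

/-! ### Quantum circuits with oracle queries -/

/-- The computational basis of the quantum computer: the `n` qubits of the simulated system (which
serve as row register of the queries), `n` qubits for column numbers, the target qubit of the
queries, and `a` work qubits. -/
abbrev CompBasis (n a : ℕ) : Type := Fin (2 ^ n) × (Fin (2 ^ n) × Bool × (Fin a → Bool))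

/-- The gates: an arbitrary unitary operation (free of charge), a query to one of the two
Hamiltonian oracles with its classical inputs, and calls of `T_μ` and of `T_μ†`. -/
inductive Gate (n d M nt nH a : ℕ) : Type
  | free (V : Matrix.unitaryGroup (CompBasis n a) ℂ)
  | queryCol (p : Fin n) (i : Fin d) (μ : Fin M)
  | queryVal (p : Fin nH) (μ : Fin M) (q : Fin (2 ^ nt))
  | basisChange (μ : Fin M)
  | basisChangeAdj (μ : Fin M)

/-- The unitary `|x, y, b, w⟩ ↦ |x, y, b ⊕ g x y, w⟩`. -/
def xorMatrix {n a : ℕ} (g : Fin (2 ^ n) → Fin (2 ^ n) → Bool) :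
    Matrix (CompBasis n a) (CompBasis n a) ℂ :=
  Matrix.of fun s s' =>
    if s = (s'.1, s'.2.1, xor s'.2.2.1 (g s'.1 s'.2.1), s'.2.2.2) then 1 else 0

/-- The operation of a gate, given the oracles. -/
def Gate.op {n d M nt nH a : ℕ} (O : HamOracle n d M nt nH)
    (T : Fin M → Matrix.unitaryGroup (Fin (2 ^ n)) ℂ) :
    Gate n d M nt nH a → Matrix (CompBasis n a) (CompBasis n a) ℂ
  | .free V => (V : Matrix (CompBasis n a) (CompBasis n a) ℂ)
  | .queryCol p i μ => xorMatrix fun x _ => ((O.col μ x i : ℕ)).testBit p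
  | .queryVal p μ q => xorMatrix fun x y => O.val μ q x y p
  | .basisChange μ => (T μ : Matrix (Fin (2 ^ n)) (Fin (2 ^ n)) ℂ) ⊗ₖ 1
  | .basisChangeAdj μ => (T μ : Matrix (Fin (2 ^ n)) (Fin (2 ^ n)) ℂ)ᴴ ⊗ₖ 1

/-- The cost of a gate in queries to the two Hamiltonian oracles. -/
def Gate.queryCost {n d M nt nH a : ℕ} : Gate n d M nt nH a → ℕ
  | .queryCol _ _ _ => 1
  | .queryVal _ _ _ => 1
  | _ => 0

/-- The cost of a gate in basis transformations. -/
def Gate.basisCost {n d M nt nH a : ℕ} : Gate n d M nt nH a → ℕ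
  | .basisChange _ => 1
  | .basisChangeAdj _ => 1
  | _ => 0

/-- A circuit is a list of gates; the head of the list is applied first. A circuit does not depend
on the oracles, which enter through its operation only. -/
abbrev Circuit (n d M nt nH a : ℕ) : Type := List (Gate n d M nt nH a)

def Circuit.op {n d M nt nH a : ℕ} (O : HamOracle n d M nt nH)
    (T : Fin M → Matrix.unitaryGroup (Fin (2 ^ n)) ℂ) (g : Circuit n d M nt nH a) :
    Matrix (CompBasis n a) (CompBasis n a) ℂ :=
  (g.map (Gate.op O T)).reverse.prod

def Circuit.queries {n d M nt nH a : ℕ} (g : Circuit n d M nt nH a) : ℕ :=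
  (g.map Gate.queryCost).sum

def Circuit.basisCalls {n d M nt nH a : ℕ} (g : Circuit n d M nt nH a) : ℕ :=
  (g.map Gate.basisCost).sum

/-- The state `|ψ⟩|0⟩|0⟩|0⋯0⟩`. -/
def withAncillas {n : ℕ} (a : ℕ) (ψ : Fin (2 ^ n) → ℂ) : CompBasis n a → ℂ :=
  fun s => if (s.2.1 : ℕ) = 0 ∧ s.2.2.1 = false ∧ s.2.2.2 = (fun _ => false) then ψ s.1 else 0

/-- The circuit performs the operation `V` on the system register, and returns all other qubits to
their initial state. -/
def Circuit.Implements {n d M nt nH a : ℕ} (g : Circuit n d M nt nH a) (O : HamOracle n d M nt nH)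
    (T : Fin M → Matrix.unitaryGroup (Fin (2 ^ n)) ℂ)
    (V : Matrix (Fin (2 ^ n)) (Fin (2 ^ n)) ℂ) : Prop :=
  ∀ ψ : Fin (2 ^ n) → ℂ, Circuit.op O T g *ᵥ withAncillas a ψ = withAncillas a (V *ᵥ ψ)

/-- The number `C` of oracle queries that are needed to simulate a one-sparse exponential: the least
`c` such that (with a suitable number of work qubits) for each one-sparse term, mesh time and
duration there is a circuit with at most `c` queries which performs the exponential, whatever the
oracle. -/
def oneSparseCost (n d M nt nH : ℕ) (Hmax : ℝ) : ℕ :=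
  sInf {C | ∃ a : ℕ, ∀ (μ : Fin M) (c : TermIndex d) (q : Fin (2 ^ nt)) (δ : ℝ),
    ∃ g : Circuit n d M nt nH a, Circuit.queries g ≤ C ∧ Circuit.basisCalls g = 0 ∧
      ∀ (O : HamOracle n d M nt nH) (T : Fin M → Matrix.unitaryGroup (Fin (2 ^ n)) ℂ), O.Valid →
        Circuit.Implements g O T (oneSparseExp O Hmax μ c q δ)}

/-! ### Lie–Trotter–Suzuki integrators -/

/-- Suzuki's recursion. If `U₁ b a` is the symmetric first integrator from time `a` to time `b`,
then `suzuki U₁ m` is the integrator `U_{m+1}`. -/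
def suzuki {R : Type*} [Monoid R] (U₁ : ℝ → ℝ → R) : ℕ → ℝ → ℝ → R
  | 0, b, a => U₁ b a
  | m + 1, b, a =>
    let s : ℝ := 1 / (4 - (4 : ℝ) ^ (1 / (2 * (m : ℝ) + 3)))
    let δ : ℝ := b - a
    suzuki U₁ m b (a + (1 - s) * δ) *
      suzuki U₁ m (a + (1 - s) * δ) (a + (1 - 2 * s) * δ) *
      suzuki U₁ m (a + (1 - 2 * s) * δ) (a + 2 * s * δ) *
      suzuki U₁ m (a + 2 * s * δ) (a + s * δ) *
      suzuki U₁ m (a + s * δ) a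

/-- The integrator `U₁(b, a)` for `∑ μ, T_μ† (∑ c, H_{μ,c}) T_μ`, with the times rounded to the
mesh and the matrix elements as represented by the oracle. -/
def integratorOne {n d M nt nH : ℕ} (O : HamOracle n d M nt nH)
    (T : Fin M → Matrix.unitaryGroup (Fin (2 ^ n)) ℂ) (Hmax t₀ Δt : ℝ) (b a : ℝ) :
    Matrix (Fin (2 ^ n)) (Fin (2 ^ n)) ℂ :=
  let E : Fin M → TermIndex d → Matrix (Fin (2 ^ n)) (Fin (2 ^ n)) ℂ := fun μ c =>
    oneSparseExp O Hmax μ c (meshIndex t₀ Δt nt ((a + b) / 2)) ((b - a) / 2)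
  ((List.finRange M).map fun μ => (T μ : Matrix (Fin (2 ^ n)) (Fin (2 ^ n)) ℂ)ᴴ *
      ((termList d).map (E μ)).prod * (T μ : Matrix (Fin (2 ^ n)) (Fin (2 ^ n)) ℂ)).prod *
    ((List.finRange M).reverse.map fun μ => (T μ : Matrix (Fin (2 ^ n)) (Fin (2 ^ n)) ℂ)ᴴ *
      ((termList d).reverse.map (E μ)).prod * (T μ : Matrix (Fin (2 ^ n)) (Fin (2 ^ n)) ℂ)).prod

/-- The integrator `U_k(b, a)`, for `k ≥ 1`. -/
def integrator {n d M nt nH : ℕ} (O : HamOracle n d M nt nH)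
    (T : Fin M → Matrix.unitaryGroup (Fin (2 ^ n)) ℂ) (Hmax t₀ Δt : ℝ) (k : ℕ) (b a : ℝ) :
    Matrix (Fin (2 ^ n)) (Fin (2 ^ n)) ℂ :=
  suzuki (integratorOne O T Hmax t₀ Δt) (k - 1) b a

/-- `U_k(t_r, t_{r-1}) ⋯ U_k(t_1, t_0)`. -/
def integratorProduct {n d M nt nH : ℕ} (O : HamOracle n d M nt nH)
    (T : Fin M → Matrix.unitaryGroup (Fin (2 ^ n)) ℂ) (Hmax t₀ Δt : ℝ) (k : ℕ) (t : ℕ → ℝ)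
    (r : ℕ) : Matrix (Fin (2 ^ n)) (Fin (2 ^ n)) ℂ :=
  ((List.range r).reverse.map fun p => integrator O T Hmax t₀ Δt k (t (p + 1)) (t p)).prod

/-! ### Adaptive time steps -/

/-- The average of `Υ` over `[a, b]`. -/
def average (Υ : ℝ → ℝ) (b a : ℝ) : ℝ := 1 / (b - a) * ∫ t in a..b, Υ t

/-- `[24 d² k (5/3)^(k-1) Ῡ Δt]^(1+1/2k) / η^(1/2k) + 3 K² Ῡ Δt + 1`, rounded up. -/
def stepBound (d k : ℕ) (K η t₀ Δt : ℝ) (Υ : ℝ → ℝ) : ℕ :=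
  ⌈(24 * d ^ 2 * k * (5 / 3 : ℝ) ^ (k - 1) * average Υ (t₀ + Δt) t₀ * Δt) ^
        (1 + 1 / (2 * (k : ℝ))) / η ^ (1 / (2 * (k : ℝ))) +
      3 * K ^ 2 * average Υ (t₀ + Δt) t₀ * Δt + 1⌉₊

/-- `Y = 24 d² k (5/3)^(k-1) / (ε / r_g)^(1/(2k+1))`. -/
def stepConst (d k : ℕ) (ε : ℝ) (rg : ℕ) : ℝ :=
  24 * d ^ 2 * k * (5 / 3 : ℝ) ^ (k - 1) / (ε / rg) ^ (1 / (2 * (k : ℝ) + 1))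

open Classical in
/-- The times `t_0 = t₀`, `t_{p+1} = t_p + 1 / (Υ(t_p) (Y + K²))`; the last step, which would reach
or pass the end point `t₀ + Δt`, is cut off there. -/
def adaptiveTime (Υ : ℝ → ℝ) (Y K t₀ Δt : ℝ) : ℕ → ℝ
  | 0 => t₀
  | p + 1 =>
    let t := adaptiveTime Υ Y K t₀ Δt p
    if Υ t * (Y + K ^ 2) * (t₀ + Δt - t) ≤ 1 then t₀ + Δt else t + 1 / (Υ t * (Y + K ^ 2))

end QSim

end

/-!
The generator `-i H(t)` is the sum of `6 M d²` terms: the one-sparse parts of the `H_μ`,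
transformed by `T_μ`. Deterministic coin tossing gives a proper colouring of the paths of each
pair of list positions with six colours (`coinLabel_ne`, `coinLabel_lt_six`), so that the parts
are indeed one-sparse and sum to `H_μ` (`sum_classPart`). A one-sparse matrix has its largest
entry as norm (`norm_le_of_pattern`); hence neither a part nor its derivatives exceed those of
`H_μ`, and errors of entries are errors of norms.

The error of one integrator step is split into three parts. First, each term is replaced by its
Taylor polynomial of degree `2 k - 1` about the end of the step; the remainder is estimated for
the sum of all norms at once (`sum_taylor_remainder_le`), so that only `Σ_μ ‖H_μ^(p)‖`, and no
further power of `M`, enters. Secondly, for polynomial generators Suzuki's integrator `s(h)` is an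
entire function of the duration `h`, and its defect `s' - s B` with respect to the differential
equation vanishes at `h = 0` to the order `2 k`. This is an algebraic fact: the operators
`g ↦ s(h) g(t - h)` on smooth functions of time are the integrator for the time-independent
generator `-d/dt + Σ_j B_j`, and Suzuki's choice of parameters together with time reversal
symmetry raises the order of the formal power series by two in each step of the recursion
(`suzukiSeries_strang_agree`, `exists_suzuki_expansion`). The total duration of the factors of the
integrator is at most `Θ = k (5/3)^(k-1)` times `h` (`suzukiWeight_le`), so `s` is bounded by an
absolute constant on a complex disc of radius proportional to `1 / (Θ Λ)`, where `Λ` is the size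
of the generators. Schwarz's lemma then bounds the defect with explicit constants and without
combinatorial factors (`norm_defect_le`, `norm_sub_suzuki_taylor_le`). Thirdly, exponentials of
skew-adjoint elements are nonexpansive, so that the integrator is Lipschitz in the generators with
the constant `Θ h` (`norm_suzuki_sub_le`); this covers Taylor remainders and the rounding of times
and matrix elements (`norm_oneSparseTerm_meshIndex_sub_le`). With `σ^(2k+1) = ε / r_g`, a step
costs at most `(2/3 + 1/64) ε / r_g`, the rounding costs `0.265 ε` in total, and the sum over at
most `r_g` steps is below `ε` (`norm_evolution_sub_integratorProduct_le`).

For the number of steps, let `I` be an antiderivative of `Υ`. The bound on `Υ'` says that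
`exp (K² I) Υ` increases and `exp (-K² I) Υ` decreases. Hence a full step uses up at least
`1 / (Y + 2 K²)` of `∫ Υ`, while `Υ h ≤ 1 / Y` holds throughout a step of length `h`
(`exists_adaptiveTime_eq`). The weighted inequality between the arithmetic and the geometric mean
shows that `(Y + 2 K²) ∫ Υ < r_g` (`integral_mul_lt_stepBound`).

The circuit has to work for all oracles. An exponential can be performed at all since all oracle
bits can be read into work qubits, in superposition over the rows; a gate controlled by this
record performs the exponential, and the reading is undone (`exists_implements_oneSparseExp`). The
minimal cost `C` is therefore attained, and queries between Hadamard gates, which have no effect,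
bring the cost of each exponential to exactly `C` (`exists_realizable_oneSparseExp`). Thus the
ratio of queries to basis transformations is exactly `3 C d²`: the first integrator has `12 M d²`
exponentials and `4 M` basis transformations, and each step of the recursion multiplies both by
five (`realizable_integratorProduct`).
-/

noncomputable section

namespace QSim

/-! ### Suzuki's recursion for formal power series -/

section Formal

variable {E : Type*} [Ring E] [Algebra ℝ E]

/-- The substitution `h ↦ c h` in a formal power series in `h` over a noncommutative algebra. -/
def scaleSeries (c : ℝ) : PowerSeries E →+* PowerSeries E where
  toFun F := PowerSeries.mk fun n => c ^ n • PowerSeries.coeff n F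
  map_zero' := by ext; simp
  map_one' := by
    ext n
    rcases n with _ | n <;> simp [PowerSeries.coeff_one]
  map_add' F G := by ext; simp
  map_mul' F G := by
    ext n
    simp only [PowerSeries.coeff_mk, PowerSeries.coeff_mul, Finset.smul_sum]
    refine Finset.sum_congr rfl fun p hp => ?_
    rw [smul_mul_smul_comm, ← pow_add, Finset.HasAntidiagonal.mem_antidiagonal.1 hp]

@[simp]
theorem coeff_scaleSeries (c : ℝ) (F : PowerSeries E) (n : ℕ) :
    PowerSeries.coeff n (scaleSeries c F) = c ^ n • PowerSeries.coeff n F := by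
  simp [scaleSeries]

@[simp]
theorem constantCoeff_scaleSeries (c : ℝ) (F : PowerSeries E) :
    PowerSeries.constantCoeff (scaleSeries c F) = PowerSeries.constantCoeff F := by
  rw [← PowerSeries.coeff_zero_eq_constantCoeff_apply, coeff_scaleSeries]
  simp

theorem scaleSeries_scaleSeries (c c' : ℝ) (F : PowerSeries E) :
    scaleSeries c (scaleSeries c' F) = scaleSeries (c * c') F := by
  ext n
  simp [smul_smul, mul_pow]

/-- The formal exponential `exp (h Z)`. -/
def expSeries (Z : E) : PowerSeries E := PowerSeries.mk fun n => ((n.factorial : ℝ)⁻¹) • Z ^ n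

@[simp]
theorem coeff_expSeries (Z : E) (n : ℕ) :
    PowerSeries.coeff n (expSeries Z) = ((n.factorial : ℝ)⁻¹) • Z ^ n := by
  simp [expSeries]

@[simp]
theorem constantCoeff_expSeries (Z : E) : PowerSeries.constantCoeff (expSeries Z) = 1 := by
  rw [← PowerSeries.coeff_zero_eq_constantCoeff_apply, coeff_expSeries]
  simp

theorem scaleSeries_expSeries_mul (Z : E) (c c' : ℝ) :
    scaleSeries c (expSeries Z) * scaleSeries c' (expSeries Z) =
      scaleSeries (c + c') (expSeries Z) := by
  ext n
  have key : (c + c') ^ n * (n.factorial : ℝ)⁻¹ = ∑ p ∈ Finset.HasAntidiagonal.antidiagonal n,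
      (c ^ p.1 * (p.1.factorial : ℝ)⁻¹) * (c' ^ p.2 * (p.2.factorial : ℝ)⁻¹) := by
    rw [(Commute.all c c').add_pow', Finset.sum_mul]
    refine Finset.sum_congr rfl fun p hp => ?_
    obtain rfl := Finset.HasAntidiagonal.mem_antidiagonal.1 hp
    have h := Nat.add_choose_mul_factorial_mul_factorial p.1 p.2
    rw [← Nat.choose_symm_add] at h
    have h' : ((p.1 + p.2).choose p.1 : ℝ) * p.1.factorial * p.2.factorial =
      (p.1 + p.2).factorial := by exact_mod_cast h
    have h1 : (p.1.factorial : ℝ) ≠ 0 := by positivity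
    have h2 : (p.2.factorial : ℝ) ≠ 0 := by positivity
    have h3 : ((p.1 + p.2).factorial : ℝ) ≠ 0 := by positivity
    rw [nsmul_eq_mul]
    field_simp
    linear_combination h' * (c ^ p.1 * c' ^ p.2)
  simp only [PowerSeries.coeff_mul, coeff_scaleSeries, coeff_expSeries, smul_smul]
  rw [key, Finset.sum_smul]
  refine Finset.sum_congr rfl fun p hp => ?_
  rw [smul_mul_smul_comm, ← pow_add, Finset.HasAntidiagonal.mem_antidiagonal.1 hp]

theorem scaleSeries_zero_expSeries (Z : E) : scaleSeries 0 (expSeries Z) = 1 := by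
  ext n
  rcases n with _ | n <;> simp [PowerSeries.coeff_one]

/-- `F` and `G` agree below the order `p`. -/
def AgreeBelow (p : ℕ) (F G : PowerSeries E) : Prop :=
  ∀ n < p, PowerSeries.coeff n F = PowerSeries.coeff n G

theorem AgreeBelow.succ {E : Type*} [Ring E] {p : ℕ} {F G : PowerSeries E} (h : AgreeBelow p F G)
    (hp : PowerSeries.coeff p F - PowerSeries.coeff p G = 0) : AgreeBelow (p + 1) F G := by
  intro n hn
  rcases Nat.lt_succ_iff_lt_or_eq.1 hn with h' | rfl
  · exact h n h'
  · exact sub_eq_zero.1 hp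

theorem AgreeBelow.scale {p : ℕ} {F G : PowerSeries E} (h : AgreeBelow p F G) (c : ℝ) :
    AgreeBelow p (scaleSeries c F) (scaleSeries c G) := by
  intro n hn
  simp [h n hn]

/-- If `F` has no terms below the order `p`, then up to this order only the constant term of `G`
contributes to `F G`. -/
theorem coeff_mul_of_agreeBelow_zero {E : Type*} [Ring E] {p : ℕ} {F G : PowerSeries E}
    (h : AgreeBelow p F 0) {n : ℕ} (hn : n ≤ p) :
    PowerSeries.coeff n (F * G) = PowerSeries.coeff n F * PowerSeries.coeff 0 G := by
  rw [PowerSeries.coeff_mul, Finset.sum_eq_single (n, 0)]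
  · intro q hq hne
    have hq' := Finset.HasAntidiagonal.mem_antidiagonal.1 hq
    have : q.1 < p := by
      rcases Nat.eq_zero_or_pos q.2 with h0 | h0
      · exact absurd (Prod.ext (by simp; omega) h0) hne
      · omega
    rw [h _ this]; simp
  · simp

theorem coeff_mul_of_agreeBelow_zero' {E : Type*} [Ring E] {p : ℕ} {F G : PowerSeries E}
    (h : AgreeBelow p F 0) {n : ℕ} (hn : n ≤ p) :
    PowerSeries.coeff n (G * F) = PowerSeries.coeff 0 G * PowerSeries.coeff n F := by
  rw [PowerSeries.coeff_mul, Finset.sum_eq_single (0, n)]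
  · intro q hq hne
    have hq' := Finset.HasAntidiagonal.mem_antidiagonal.1 hq
    have : q.2 < p := by
      rcases Nat.eq_zero_or_pos q.1 with h0 | h0
      · exact absurd (Prod.ext h0 (by simp; omega)) hne
      · omega
    rw [h _ this]; simp
  · simp

theorem AgreeBelow.sub {E : Type*} [Ring E] {p : ℕ} {F G : PowerSeries E} (h : AgreeBelow p F G) :
    AgreeBelow p (F - G) 0 := by
  intro n hn
  simp [h n hn]

/-- The leading errors of two approximations add up in the product, as the constant terms are
`1`. -/
theorem coeff_mul_sub_mul {E : Type*} [Ring E] {p : ℕ} {F F' G G' : PowerSeries E}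
    (hF : AgreeBelow p F F') (hG : AgreeBelow p G G')
    (hF₀ : PowerSeries.coeff 0 F' = 1) (hG₀ : PowerSeries.coeff 0 G = 1)
    {n : ℕ} (hn : n ≤ p) :
    PowerSeries.coeff n (F * G) - PowerSeries.coeff n (F' * G') =
      (PowerSeries.coeff n F - PowerSeries.coeff n F') +
        (PowerSeries.coeff n G - PowerSeries.coeff n G') := by
  have : F * G - F' * G' = (F - F') * G + F' * (G - G') := by noncomm_ring
  rw [← map_sub, this, map_add, coeff_mul_of_agreeBelow_zero hF.sub hn,
    coeff_mul_of_agreeBelow_zero' hG.sub hn, hF₀, hG₀, mul_one, one_mul, map_sub, map_sub]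

theorem AgreeBelow.mul {E : Type*} [Ring E] {p : ℕ} {F F' G G' : PowerSeries E}
    (hF : AgreeBelow p F F') (hG : AgreeBelow p G G') (hF₀ : PowerSeries.coeff 0 F' = 1)
    (hG₀ : PowerSeries.coeff 0 G = 1) : AgreeBelow p (F * G) (F' * G') := by
  intro n hn
  have := coeff_mul_sub_mul hF hG hF₀ hG₀ hn.le
  rw [hF n hn, hG n hn, sub_self, sub_self, add_zero] at this
  exact sub_eq_zero.1 this

/-- The error of a time-symmetric approximation to `exp (h Z)` has odd order. -/
theorem AgreeBelow.succ_of_symmetric {p : ℕ} (hp : Even p) {F : PowerSeries E} {Z : E}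
    (h : AgreeBelow p F (expSeries Z)) (hF₀ : PowerSeries.coeff 0 F = 1)
    (hF : F * scaleSeries (-1) F = 1) : AgreeBelow (p + 1) F (expSeries Z) := by
  refine h.succ ?_
  have h1 := coeff_mul_sub_mul h (h.scale (-1)) (by simp) (by simp [hF₀]) le_rfl
  have h2 : expSeries Z * scaleSeries (-1) (expSeries Z) = 1 := by
    have h3 : scaleSeries 1 (expSeries Z) = expSeries Z := by ext; simp
    nth_rewrite 1 [← h3]
    rw [scaleSeries_expSeries_mul, add_neg_cancel, scaleSeries_zero_expSeries]
  rw [hF, h2, sub_self, coeff_scaleSeries, coeff_scaleSeries, hp.neg_one_pow, one_smul,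
    one_smul, ← two_smul ℝ] at h1
  exact (smul_eq_zero.1 h1.symm).resolve_left two_ne_zero

/-- The parameter `s` of Suzuki's recursion. -/
def suzukiParam (m : ℕ) : ℝ := 1 / (4 - (4 : ℝ) ^ (1 / (2 * (m : ℝ) + 3)))

/-- One step of Suzuki's recursion, for formal power series in the duration. -/
def suzukiStep (s : ℝ) (F : PowerSeries E) : PowerSeries E :=
  scaleSeries s F * scaleSeries s F * scaleSeries (1 - 4 * s) F * scaleSeries s F * scaleSeries s F

/-- Suzuki's recursion for formal power series in the duration. -/
def suzukiSeries (F : PowerSeries E) : ℕ → PowerSeries E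
  | 0 => F
  | m + 1 => suzukiStep (suzukiParam m) (suzukiSeries F m)

theorem four_rpow_bounds (m : ℕ) : 1 ≤ (4 : ℝ) ^ (1 / (2 * (m : ℝ) + 3)) ∧
    (4 : ℝ) ^ (1 / (2 * (m : ℝ) + 3)) ≤ 1 + 3 / (2 * (m : ℝ) + 3) := by
  have h3 : (0 : ℝ) < 2 * m + 3 := by positivity
  refine ⟨Real.one_le_rpow (by norm_num) (by positivity), ?_⟩
  rw [one_div, Real.rpow_inv_le_iff_of_pos (by norm_num) (by positivity) h3]
  have := one_add_mul_self_le_rpow_one_add (s := 3 / (2 * (m : ℝ) + 3)) (p := 2 * m + 3)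
    (le_trans (by norm_num) (by positivity : (0:ℝ) ≤ 3 / (2 * (m : ℝ) + 3)))
    (by linarith [h3, (Nat.cast_nonneg m : (0:ℝ) ≤ m)])
  rw [mul_div_cancel₀ _ h3.ne'] at this
  linarith

theorem suzukiParam_bounds (m : ℕ) : 1 / 3 ≤ suzukiParam m ∧ suzukiParam m ≤ 1 / 2 ∧
    8 * suzukiParam m - 1 ≤ (5 / 3) * ((m + 2) / (m + 1)) := by
  obtain ⟨h1, h2⟩ := four_rpow_bounds m
  have h3 : (0 : ℝ) < 2 * m + 3 := by positivity
  have h4 : 1 + 3 / (2 * (m : ℝ) + 3) ≤ 2 := by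
    have : 3 / (2 * (m : ℝ) + 3) ≤ 1 :=
      (div_le_one h3).2 (by linarith [(Nat.cast_nonneg m : (0:ℝ) ≤ m)])
    linarith
  unfold suzukiParam
  set y := (4 : ℝ) ^ (1 / (2 * (m : ℝ) + 3))
  have hm : (0 : ℝ) ≤ m := Nat.cast_nonneg m
  have h5 : 1 / (4 - y) ≤ (2 * m + 3) / (6 * m + 6) := by
    rw [div_le_div_iff₀ (by linarith) (by linarith)]
    have : y * (2 * m + 3) ≤ (1 + 3 / (2 * (m : ℝ) + 3)) * (2 * m + 3) := by gcongr
    rw [add_mul, div_mul_cancel₀ _ h3.ne'] at this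
    linarith
  refine ⟨?_, ?_, ?_⟩
  · rw [div_le_div_iff₀ (by norm_num) (by linarith)]; linarith
  · rw [div_le_div_iff₀ (by linarith) (by norm_num)]; linarith
  · have : 8 * ((2 * m + 3) / (6 * m + 6)) - 1 ≤ (5 / 3 : ℝ) * ((m + 2) / (m + 1)) := by
      rw [← sub_nonneg]
      have : (5 / 3 : ℝ) * ((m + 2) / (m + 1)) - (8 * ((2 * m + 3) / (6 * m + 6)) - 1)
        = (1 / 3) / (m + 1) := by field_simp; ring
      rw [this]; positivity
    linarith

/-- The choice of `s` cancels the leading error of Suzuki's recursion. -/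
theorem suzukiParam_cancel (m : ℕ) :
    4 * suzukiParam m ^ (2 * m + 3) + (1 - 4 * suzukiParam m) ^ (2 * m + 3) = 0 := by
  obtain ⟨h1, h2⟩ := four_rpow_bounds m
  have h3 : (0 : ℝ) < 2 * m + 3 := by positivity
  have h4 : 3 / (2 * (m : ℝ) + 3) ≤ 1 :=
    (div_le_one h3).2 (by linarith [(Nat.cast_nonneg m : (0:ℝ) ≤ m)])
  have hy : ((4 : ℝ) ^ (1 / (2 * (m : ℝ) + 3))) ^ (2 * m + 3) = 4 := by
    rw [← Real.rpow_natCast, ← Real.rpow_mul (by norm_num)]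
    push_cast
    rw [one_div_mul_cancel h3.ne', Real.rpow_one]
  unfold suzukiParam
  set y := (4 : ℝ) ^ (1 / (2 * (m : ℝ) + 3))
  have h5 : 4 - y ≠ 0 := by linarith
  have h6 : 1 - 4 * (1 / (4 - y)) = -y / (4 - y) := by field_simp; ring
  have hodd : Odd (2 * m + 3) := ⟨m + 1, by ring⟩
  rw [h6, div_pow, div_pow, hodd.neg_pow, hy, one_pow]
  ring

theorem coeff_zero_suzukiSeries {F : PowerSeries E} (hF₀ : PowerSeries.coeff 0 F = 1) (m : ℕ) :
    PowerSeries.coeff 0 (suzukiSeries F m) = 1 := by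
  induction m with
  | zero => exact hF₀
  | succ m ih => simp_all [suzukiSeries, suzukiStep]

theorem suzukiSeries_symmetric {F : PowerSeries E} (hF : F * scaleSeries (-1) F = 1) (m : ℕ) :
    suzukiSeries F m * scaleSeries (-1) (suzukiSeries F m) = 1 := by
  induction m with
  | zero => exact hF
  | succ m ih =>
    have h (c : ℝ) : scaleSeries c (suzukiSeries F m) *
        scaleSeries (-1 * c) (suzukiSeries F m) = 1 := by
      rw [mul_comm (-1), ← scaleSeries_scaleSeries, ← map_mul, ih, map_one]
    have key (a b a' b' : PowerSeries E) (h1 : a * a' = 1) (h2 : b * b' = 1) :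
        a * a * b * a * a * (a' * a' * b' * a' * a') = 1 := by
      calc _ = a * (a * (b * (a * (a * a') * a') * b') * a') * a' := by noncomm_ring
        _ = 1 := by simp only [h1, h2, mul_one]
    simp only [suzukiSeries, suzukiStep, map_mul, scaleSeries_scaleSeries]
    exact key _ _ _ _ (h _) (h _)

/-- Suzuki's recursion raises the order of a symmetric approximation to `exp (h Z)` by two: the
choice of `s` removes the leading error, and symmetry the next one. -/
theorem suzukiSeries_agree {F : PowerSeries E} {Z : E} (hF₀ : PowerSeries.coeff 0 F = 1)
    (hF : F * scaleSeries (-1) F = 1) (hF₁ : AgreeBelow 3 F (expSeries Z)) (m : ℕ) :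
    AgreeBelow (2 * m + 3) (suzukiSeries F m) (expSeries Z) := by
  induction m with
  | zero => exact hF₁
  | succ m ih =>
    set s := suzukiParam m with hs
    set G := suzukiSeries F m with hG
    have hG₀ : PowerSeries.coeff 0 G = 1 := coeff_zero_suzukiSeries hF₀ m
    have c0 (c : ℝ) : PowerSeries.coeff 0 (scaleSeries c G) = 1 := by simp [hG₀]
    have e0 (c : ℝ) : PowerSeries.coeff 0 (scaleSeries c (expSeries Z)) = 1 := by simp
    have hE : expSeries Z = suzukiStep s (expSeries Z) := by
      simp only [suzukiStep, scaleSeries_expSeries_mul]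
      ext; simp [show s + s + (1 - 4 * s) + s + s = 1 by ring]
    have hc (c : ℝ) := ih.scale c
    have a2 := (hc s).mul (hc s) (e0 _) (c0 _)
    have a3 := a2.mul (hc (1 - 4 * s)) (by simp) (c0 _)
    have a4 := a3.mul (hc s) (by simp) (c0 _)
    have a5 := a4.mul (hc s) (by simp) (c0 _)
    have key : AgreeBelow (2 * m + 3 + 1) (suzukiStep s G) (expSeries Z) := by
      rw [hE]
      refine AgreeBelow.succ a5 ?_
      rw [suzukiStep, suzukiStep,
        coeff_mul_sub_mul a4 (hc s) (by simp) (c0 _) le_rfl,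
        coeff_mul_sub_mul a3 (hc s) (by simp) (c0 _) le_rfl,
        coeff_mul_sub_mul a2 (hc _) (by simp) (c0 _) le_rfl,
        coeff_mul_sub_mul (hc s) (hc s) (by simp) (c0 _) le_rfl]
      simp only [coeff_scaleSeries, ← smul_sub]
      rw [← add_smul, ← add_smul, ← add_smul, ← add_smul]
      have := suzukiParam_cancel m
      rw [← hs] at this
      rw [show s ^ (2 * m + 3) + s ^ (2 * m + 3) + (1 - 4 * s) ^ (2 * m + 3) + s ^ (2 * m + 3) +
        s ^ (2 * m + 3) = 0 by linarith, zero_smul]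
    exact key.succ_of_symmetric ⟨m + 2, by ring⟩
      (coeff_zero_suzukiSeries hF₀ (m + 1)) (suzukiSeries_symmetric hF (m + 1))

/-- The symmetric splitting `e^{hY₁/2} ⋯ e^{hYₘ/2} e^{hYₘ/2} ⋯ e^{hY₁/2}`. -/
def strangSeries (L : List E) : PowerSeries E :=
  (L.map fun Y => scaleSeries (1 / 2) (expSeries Y)).prod *
    (L.reverse.map fun Y => scaleSeries (1 / 2) (expSeries Y)).prod

theorem strangSeries_cons (Y : E) (L : List E) : strangSeries (Y :: L) =
    scaleSeries (1 / 2) (expSeries Y) * strangSeries L * scaleSeries (1 / 2) (expSeries Y) := by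
  simp [strangSeries, mul_assoc]

theorem strangSeries_symmetric (L : List E) :
    strangSeries L * scaleSeries (-1) (strangSeries L) = 1 := by
  induction L with
  | nil => simp [strangSeries]
  | cons Y L ih =>
    have h : scaleSeries (1 / 2) (expSeries Y) * scaleSeries (-1 * (1 / 2)) (expSeries Y) = 1 := by
      rw [scaleSeries_expSeries_mul, show (1 / 2 + -1 * (1 / 2) : ℝ) = 0 by norm_num,
        scaleSeries_zero_expSeries]
    rw [strangSeries_cons, map_mul, map_mul, scaleSeries_scaleSeries]
    set e := scaleSeries (1 / 2) (expSeries Y)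
    set e' := scaleSeries (-1 * (1 / 2)) (expSeries Y)
    calc _ = e * (strangSeries L * (e * e') * scaleSeries (-1) (strangSeries L)) * e' := by
          noncomm_ring
      _ = 1 := by rw [h, mul_one, ih, mul_one, h]

theorem coeff_strangSeries (L : List E) : PowerSeries.coeff 0 (strangSeries L) = 1 ∧
    PowerSeries.coeff 1 (strangSeries L) = L.sum := by
  induction L with
  | nil => simp [strangSeries, PowerSeries.coeff_one]
  | cons Y L ih =>
    have h1 : Finset.HasAntidiagonal.antidiagonal 1 = {((0 : ℕ), (1 : ℕ)), (1, 0)} := rfl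
    rw [strangSeries_cons]
    refine ⟨by simpa using ih.1, ?_⟩
    simp only [PowerSeries.coeff_mul, h1,
      Finset.sum_pair (show ((0 : ℕ), (1 : ℕ)) ≠ (1, 0) by simp),
      Finset.HasAntidiagonal.antidiagonal_zero, Finset.sum_singleton, ih.1, ih.2]
    simp only [coeff_scaleSeries, coeff_expSeries]
    simp only [pow_zero, Nat.factorial, Nat.cast_one, inv_one, one_smul, mul_one, one_mul, pow_one,
      List.sum_cons]
    have : Y = (1 / 2 : ℝ) • Y + (1 / 2 : ℝ) • Y := by rw [← add_smul]; norm_num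
    nth_rewrite 3 [this]
    abel

/-- The symmetric splitting has order two, so that `m` steps of Suzuki's recursion give the order
`2 m + 2`. -/
theorem suzukiSeries_strang_agree (L : List E) (m : ℕ) :
    AgreeBelow (2 * m + 3) (suzukiSeries (strangSeries L) m) (expSeries L.sum) := by
  obtain ⟨h0, h1⟩ := coeff_strangSeries L
  refine suzukiSeries_agree h0 (strangSeries_symmetric L) ?_ m
  refine AgreeBelow.succ_of_symmetric (p := 2) even_two ?_ h0 (strangSeries_symmetric L)
  intro n hn
  interval_cases n
  · simp [h0]
  · simp [h1]

end Formal

/-! ### Expansion of the integrators in powers of the duration -/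

section Expansion

set_option linter.unusedSectionVars false

open scoped ContDiff

variable {A : Type*} [NormedRing A] [NormedAlgebra ℝ A]

/-- `ψ t h = O(h ^ N)`, locally uniformly in `t` and `h`. -/
def SmallOfOrder (N : ℕ) (ψ : ℝ → ℝ → A) : Prop :=
  ∀ R : ℝ, ∃ C : ℝ, 0 ≤ C ∧ ∀ t h, |t| ≤ R → |h| ≤ R → ‖ψ t h‖ ≤ C * |h| ^ N

theorem SmallOfOrder.add {N : ℕ} {ψ φ : ℝ → ℝ → A} (hψ : SmallOfOrder N ψ)
    (hφ : SmallOfOrder N φ) : SmallOfOrder N fun t h => ψ t h + φ t h := by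
  intro R
  obtain ⟨C, hC, h1⟩ := hψ R
  obtain ⟨C', hC', h2⟩ := hφ R
  refine ⟨C + C', by positivity, fun t h ht hh => (norm_add_le _ _).trans ?_⟩
  rw [add_mul]
  exact add_le_add (h1 t h ht hh) (h2 t h ht hh)

theorem SmallOfOrder.mul {N N' : ℕ} {ψ φ : ℝ → ℝ → A} (hψ : SmallOfOrder N ψ)
    (hφ : SmallOfOrder N' φ) : SmallOfOrder (N + N') fun t h => ψ t h * φ t h := by
  intro R
  obtain ⟨C, hC, h1⟩ := hψ R
  obtain ⟨C', hC', h2⟩ := hφ R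
  refine ⟨C * C', by positivity, fun t h ht hh => (norm_mul_le _ _).trans ?_⟩
  calc _ ≤ (C * |h| ^ N) * (C' * |h| ^ N') := by
        gcongr
        exacts [h1 t h ht hh, h2 t h ht hh]
    _ = _ := by ring

theorem SmallOfOrder.sum {N : ℕ} {ι : Type*} (s : Finset ι) {ψ : ι → ℝ → ℝ → A}
    (hψ : ∀ i ∈ s, SmallOfOrder N (ψ i)) : SmallOfOrder N fun t h => ∑ i ∈ s, ψ i t h := by
  classical
  induction s using Finset.induction_on with
  | empty => exact fun R => ⟨0, le_rfl, by simp⟩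
  | insert i s hi ih =>
    simp only [Finset.sum_insert hi]
    exact (hψ i (by simp)).add (ih fun j hj => hψ j (by simp [hj]))

theorem SmallOfOrder.pow_smul {N : ℕ} {ψ : ℝ → ℝ → A} (hψ : SmallOfOrder N ψ) (m : ℕ) :
    SmallOfOrder (m + N) fun t h => h ^ m • ψ t h := by
  intro R
  obtain ⟨C, hC, h1⟩ := hψ R
  refine ⟨C, hC, fun t h ht hh => ?_⟩
  rw [norm_smul, norm_pow, Real.norm_eq_abs, pow_add]
  have := mul_le_mul_of_nonneg_left (h1 t h ht hh) (by positivity : 0 ≤ |h| ^ m)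
  linarith

theorem SmallOfOrder.mono {N N' : ℕ} {ψ : ℝ → ℝ → A} (hψ : SmallOfOrder N ψ) (h : N' ≤ N) :
    SmallOfOrder N' ψ := by
  intro R
  obtain ⟨C, hC, h1⟩ := hψ R
  refine ⟨C * |R| ^ (N - N'), by positivity, fun t s ht hs => (h1 t s ht hs).trans ?_⟩
  obtain ⟨m, rfl⟩ := Nat.exists_eq_add_of_le h
  rw [Nat.add_sub_cancel_left, pow_add, mul_assoc, mul_comm (|R| ^ m)]
  have : |s| ≤ |R| := hs.trans (le_abs_self R)
  gcongr

theorem SmallOfOrder.shift {N : ℕ} {ψ : ℝ → ℝ → A} (hψ : SmallOfOrder N ψ) (c : ℝ) :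
    SmallOfOrder N fun t h => ψ (t - c * h) h := by
  intro R
  obtain ⟨C, hC, h1⟩ := hψ (R + |c| * R)
  refine ⟨C, hC, fun t h ht hh => h1 _ _ ?_ ?_⟩
  · refine (abs_sub _ _).trans ?_
    rw [abs_mul]
    gcongr
  · have : 0 ≤ R := (abs_nonneg _).trans hh
    exact hh.trans (le_add_of_nonneg_right (by positivity))

theorem SmallOfOrder.scale {N : ℕ} {ψ : ℝ → ℝ → A} (hψ : SmallOfOrder N ψ) (c : ℝ) :
    SmallOfOrder N fun t h => ψ t (c * h) := by
  intro R
  obtain ⟨C, hC, h1⟩ := hψ (R + |c| * R)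
  refine ⟨C * |c| ^ N, by positivity, fun t h ht hh => ?_⟩
  have hR : 0 ≤ R := (abs_nonneg _).trans hh
  refine (h1 _ _ (ht.trans (le_add_of_nonneg_right (by positivity))) ?_).trans_eq ?_
  · rw [abs_mul]
    have : |c| * |h| ≤ |c| * R := by gcongr
    linarith
  · rw [abs_mul, mul_pow, mul_assoc]

theorem smallOfOrder_zero_of_continuous {ψ : ℝ → ℝ → A}
    (hψ : Continuous fun p : ℝ × ℝ => ψ p.1 p.2) : SmallOfOrder 0 ψ := by
  intro R
  obtain ⟨C, hC⟩ := (isCompact_Icc.prod isCompact_Icc : IsCompact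
    (Set.Icc (-R) R ×ˢ Set.Icc (-R) R)).exists_bound_of_continuousOn hψ.continuousOn
  refine ⟨max C 0, le_max_right _ _, fun t h ht hh => ?_⟩
  rw [pow_zero, mul_one]
  exact (hC (t, h) ⟨abs_le.1 ht, abs_le.1 hh⟩).trans (le_max_left _ _)

variable (A) in
/-- The space of smooth functions of time. -/
def smoothFun : Submodule ℝ (ℝ → A) where
  carrier := {g | ContDiff ℝ ∞ g}
  add_mem' := fun h h' => by
    rw [Set.mem_ofPred_eq] at *
    exact ContDiff.add h h'
  zero_mem' := by
    rw [Set.mem_ofPred_eq]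
    exact contDiff_const
  smul_mem' := fun c _ h => by
    rw [Set.mem_ofPred_eq] at *
    exact ContDiff.const_smul c h

theorem mem_smoothFun {g : ℝ → A} : g ∈ smoothFun A ↔ ContDiff ℝ ∞ g := Iff.rfl

theorem smoothFun_continuous (g : smoothFun A) : Continuous (g : ℝ → A) :=
  (mem_smoothFun.1 g.2).continuous

theorem smoothFun_differentiable (g : smoothFun A) : Differentiable ℝ (g : ℝ → A) :=
  (mem_smoothFun.1 g.2).differentiable (by simp)

variable (A) in
/-- The linear operators on smooth functions of time. -/
def TimeOp : Type _ := Module.End ℝ (smoothFun A)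

instance : Ring (TimeOp A) := inferInstanceAs (Ring (Module.End ℝ (smoothFun A)))

instance : Algebra ℝ (TimeOp A) := inferInstanceAs (Algebra ℝ (Module.End ℝ (smoothFun A)))

instance : Module (TimeOp A) (smoothFun A) :=
  inferInstanceAs (Module (Module.End ℝ (smoothFun A)) (smoothFun A))

instance : IsScalarTower ℝ (TimeOp A) (smoothFun A) :=
  inferInstanceAs (IsScalarTower ℝ (Module.End ℝ (smoothFun A)) (smoothFun A))

variable (A) in
/-- The generator `-d/dt` of the backward shifts of time. -/
def shiftGen : TimeOp A := show Module.End ℝ (smoothFun A) from {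
  toFun g := ⟨fun t => -deriv (g : ℝ → A) t,
    mem_smoothFun.2 ((contDiff_infty_iff_deriv.1 (mem_smoothFun.1 g.2)).2).neg⟩
  map_add' g g' := by
    ext t
    simp [deriv_add (smoothFun_differentiable g t) (smoothFun_differentiable g' t)]
    abel
  map_smul' c g := by
    ext t
    simp [deriv_const_smul _ (smoothFun_differentiable g t)] }

theorem shiftGen_smul (g : smoothFun A) (t : ℝ) :
    (shiftGen A • g : smoothFun A).1 t = -deriv (g : ℝ → A) t := rfl

/-- Multiplication by a smooth function. -/
def mulGen (B : smoothFun A) : TimeOp A := show Module.End ℝ (smoothFun A) from {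
  toFun g := ⟨fun t => (B : ℝ → A) t * (g : ℝ → A) t, 
    mem_smoothFun.2 ((mem_smoothFun.1 B.2).mul (mem_smoothFun.1 g.2))⟩
  map_add' g g' := by
    ext t
    simp [mul_add]
  map_smul' c g := by
    ext t
    simp }

theorem mulGen_smul (B g : smoothFun A) (t : ℝ) :
    (mulGen B • g : smoothFun A).1 t = (B : ℝ → A) t * (g : ℝ → A) t := rfl

/-- The operators `g ↦ M(t, h) g(t - α h)` on smooth functions have the expansion `F` in powers of
`h`, up to terms of the order `N`. -/
def HasExpansion (N : ℕ) (M : ℝ → ℝ → A) (α : ℝ)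
    (F : PowerSeries (TimeOp A)) : Prop :=
  ∀ g : smoothFun A, SmallOfOrder N fun t h => M t h * (g : ℝ → A) (t - α * h) -
    ∑ n ∈ Finset.range N, h ^ n • (PowerSeries.coeff n F • g : smoothFun A).1 t

/-- A one-parameter family of operators with the generator `Y` has the expansion `exp (h Y)`. -/
theorem smallOfOrder_flow {φ : smoothFun A → ℝ → ℝ → A} {Y : TimeOp A}
    (h₀ : ∀ g t, φ g t 0 = (g : ℝ → A) t)
    (hd : ∀ g t h, HasDerivAt (φ g t) (φ (Y • g) t h) h) (hb : ∀ g, SmallOfOrder 0 (φ g)) (N : ℕ) :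
    ∀ g : smoothFun A, SmallOfOrder N fun t h => φ g t h -
      ∑ n ∈ Finset.range N, h ^ n • (PowerSeries.coeff n (expSeries Y) • g : smoothFun A).1 t := by
  induction N with
  | zero => simpa using hb
  | succ N ih =>
    intro g R
    obtain ⟨C, hC, h1⟩ := ih (Y • g) R
    refine ⟨C, hC, fun t h ht hh => ?_⟩
    set ψ : ℝ → A := fun h => φ g t h -
      ∑ n ∈ Finset.range (N + 1),
        h ^ n • (PowerSeries.coeff n (expSeries Y) • g : smoothFun A).1 t with hψ
    set ψ' : ℝ → A := fun h => φ (Y • g) t h -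
      ∑ n ∈ Finset.range N,
        h ^ n • (PowerSeries.coeff n (expSeries Y) • Y • g : smoothFun A).1 t with hψ'
    have hder (s : ℝ) : HasDerivAt ψ (ψ' s) s := by
      refine (hd g t s).sub ?_
      simp_rw [Finset.sum_range_succ' _ N, pow_zero, one_smul]
      refine HasDerivAt.add_const _ ?_
      refine HasDerivAt.fun_sum fun n _ => ?_
      have h2 : (PowerSeries.coeff (n + 1) (expSeries Y) • g : smoothFun A).1 t =
          ((n : ℝ) + 1)⁻¹ • (PowerSeries.coeff n (expSeries Y) • Y • g : smoothFun A).1 t := by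
        rw [coeff_expSeries, coeff_expSeries, smul_assoc, smul_assoc, pow_succ, mul_smul]
        simp only [Submodule.coe_smul, Pi.smul_apply, smul_smul]
        congr 1
        rw [Nat.factorial_succ]
        push_cast
        rw [mul_inv]
      rw [h2]
      generalize (PowerSeries.coeff n (expSeries Y) • Y • g : smoothFun A).1 t = v
      simp only [smul_smul]
      have h3 := ((hasDerivAt_pow (n + 1) s).mul_const (((n : ℝ) + 1)⁻¹)).smul_const v
      have h4 : (n : ℝ) + 1 ≠ 0 := by positivity
      have h5 : ((n + 1 : ℕ) : ℝ) * s ^ (n + 1 - 1) * ((n : ℝ) + 1)⁻¹ = s ^ n := by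
        rw [Nat.add_sub_cancel]
        push_cast
        field_simp
      rwa [h5] at h3
    have h0 : ψ 0 = 0 := by
      simp [hψ, Finset.sum_range_succ', h₀, -PowerSeries.coeff_zero_eq_constantCoeff]
    have := (convex_Icc (-|h|) |h|).norm_image_sub_le_of_norm_hasDerivWithin_le (f := ψ) (f' := ψ')
      (C := C * |h| ^ N) (x := 0) (y := h) (fun s _ => (hder s).hasDerivWithinAt) ?_
      ⟨by simp, by simp⟩ (abs_le.1 le_rfl)
    · rw [h0, sub_zero, sub_zero, Real.norm_eq_abs, mul_assoc, ← pow_succ] at this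
      exact this
    · intro s hs
      have hs' : |s| ≤ |h| := abs_le.2 hs
      exact (h1 t s ht (hs'.trans hh)).trans (by gcongr)

theorem hasExpansion_shift (N : ℕ) :
    HasExpansion N (fun _ _ => (1 : A)) 1 (expSeries (shiftGen A)) := by
  intro g
  have := smallOfOrder_flow (φ := fun g t h => (g : ℝ → A) (t - h)) (Y := shiftGen A)
    (by simp) ?_ ?_ N g
  · simpa using this
  · intro g t h
    have := (smoothFun_differentiable g (t - h)).hasDerivAt.scomp h ((hasDerivAt_id h).const_sub t)
    simpa [Function.comp_def, shiftGen_smul] using this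
  · intro g
    have := smoothFun_continuous g
    exact smallOfOrder_zero_of_continuous (by fun_prop)

theorem continuous_normedSpace_exp [CompleteSpace A] : Continuous (NormedSpace.exp : A → A) := by
  let _ := NormedAlgebra.restrictScalars ℚ ℝ A
  exact NormedSpace.exp_continuous

theorem hasExpansion_mul [CompleteSpace A] (B : smoothFun A) (N : ℕ) :
    HasExpansion N (fun t h => NormedSpace.exp (h • (B : ℝ → A) t)) 0 (expSeries (mulGen B)) := by
  intro g
  have := smallOfOrder_flow
    (φ := fun g t h => NormedSpace.exp (h • (B : ℝ → A) t) * (g : ℝ → A) t) (Y := mulGen B)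
    (by simp) ?_ ?_ N g
  · simpa using this
  · intro g t h
    have := (hasDerivAt_exp_smul_const (𝕂 := ℝ) ((B : ℝ → A) t) h).mul_const ((g : ℝ → A) t)
    simpa [mulGen_smul, mul_assoc] using this
  · intro g
    have := smoothFun_continuous g
    have := smoothFun_continuous B
    refine smallOfOrder_zero_of_continuous (Continuous.mul (continuous_normedSpace_exp.comp ?_) ?_)
      <;> fun_prop

theorem HasExpansion.scale {N : ℕ} {M : ℝ → ℝ → A} {α : ℝ}
    {F : PowerSeries (TimeOp A)} (hM : HasExpansion N M α F) (c : ℝ) :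
    HasExpansion N (fun t h => M t (c * h)) (α * c) (scaleSeries c F) := by
  intro g
  have := (hM g).scale c
  convert this using 4
  · ring_nf
  · refine Finset.sum_congr rfl fun n _ => ?_
    rw [coeff_scaleSeries, smul_assoc, Submodule.coe_smul, Pi.smul_apply, smul_smul, mul_pow,
      mul_comm]

theorem HasExpansion.small_zero {N : ℕ} {M : ℝ → ℝ → A} {α : ℝ}
    {F : PowerSeries (TimeOp A)} (hM : HasExpansion N M α F) :
    SmallOfOrder 0 M := by
  have h1 := (hM ⟨fun _ => 1, mem_smoothFun.2 contDiff_const⟩).mono (Nat.zero_le N)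
  have h2 : SmallOfOrder 0 fun t h => ∑ n ∈ Finset.range N,
      h ^ n • (PowerSeries.coeff n F •
        (⟨fun _ => 1, mem_smoothFun.2 contDiff_const⟩ : smoothFun A)).1 t :=
    SmallOfOrder.sum _ fun n _ => by
      have := smoothFun_continuous (PowerSeries.coeff n F •
        (⟨fun _ => 1, mem_smoothFun.2 contDiff_const⟩ : smoothFun A))
      exact smallOfOrder_zero_of_continuous (by fun_prop)
  simpa using h1.add h2

theorem HasExpansion.mul {N : ℕ} {M M' : ℝ → ℝ → A} {α α' : ℝ}
    {F F' : PowerSeries (TimeOp A)} (hM : HasExpansion N M α F)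
    (hM' : HasExpansion N M' α' F') :
    HasExpansion N (fun t h => M t h * M' (t - α * h) h) (α + α') (F * F') := by
  intro g
  set G : ℕ → smoothFun A := fun m => PowerSeries.coeff m F' • g with hG
  -- the error of the inner factor, and the errors of the outer factor applied to its coefficients
  have h1 := hM.small_zero.mul ((hM' g).shift α)
  have h2 := SmallOfOrder.sum (N := N) (Finset.range N)
    (ψ := fun m t h => h ^ m • (M t h * (G m : ℝ → A) (t - α * h) -
    ∑ n ∈ Finset.range N, h ^ n • (PowerSeries.coeff n F • G m : smoothFun A).1 t))
    fun m _ => ((hM (G m)).pow_smul m).mono (Nat.le_add_left _ _)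
  -- the products of coefficients whose total order is at least `N`
  have h3 := SmallOfOrder.sum (N := N)
    ((Finset.range N ×ˢ Finset.range N).filter fun p => ¬ p.1 + p.2 < N)
    (ψ := fun p t h => h ^ (p.1 + p.2) • (PowerSeries.coeff p.1 F • G p.2 : smoothFun A).1 t)
    fun p hp => by
      have hc := smoothFun_continuous (PowerSeries.coeff p.1 F • G p.2)
      refine ((smallOfOrder_zero_of_continuous ?_).pow_smul (p.1 + p.2)).mono ?_
      · fun_prop
      · have := (Finset.mem_filter.1 hp).2
        omega
  rw [zero_add] at h1
  have h4 := (h1.add h2).add h3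
  convert h4 using 3 with t h
  have e1 : ∑ l ∈ Finset.range N, h ^ l • (PowerSeries.coeff l (F * F') • g : smoothFun A).1 t =
      ∑ p ∈ (Finset.range N ×ˢ Finset.range N).filter (fun p => p.1 + p.2 < N),
        h ^ (p.1 + p.2) • (PowerSeries.coeff p.1 F • G p.2 : smoothFun A).1 t := by
    have : ((Finset.range N ×ˢ Finset.range N).filter (fun p => p.1 + p.2 < N)) =
        (Finset.range N).biUnion fun l => Finset.HasAntidiagonal.antidiagonal l := by
      ext p
      simp only [Finset.mem_filter, Finset.mem_product, Finset.mem_range, Finset.mem_biUnion,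
        Finset.HasAntidiagonal.mem_antidiagonal]
      constructor
      · rintro ⟨_, h⟩
        exact ⟨_, h, rfl⟩
      · rintro ⟨l, h, rfl⟩
        omega
    rw [this, Finset.sum_biUnion]
    · refine Finset.sum_congr rfl fun l _ => ?_
      rw [PowerSeries.coeff_mul, Finset.sum_smul, Submodule.coe_sum, Finset.sum_apply,
        Finset.smul_sum]
      refine Finset.sum_congr rfl fun p hp => ?_
      rw [Finset.HasAntidiagonal.mem_antidiagonal.1 hp, mul_smul]
    · intro a _ b _ hab
      refine Finset.disjoint_left.2 fun p hp hp' => hab ?_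
      rw [← Finset.HasAntidiagonal.mem_antidiagonal.1 hp,
        ← Finset.HasAntidiagonal.mem_antidiagonal.1 hp']
  have e2 : ∑ m ∈ Finset.range N, h ^ m • ∑ n ∈ Finset.range N,
      h ^ n • (PowerSeries.coeff n F • G m : smoothFun A).1 t =
      ∑ p ∈ Finset.range N ×ˢ Finset.range N,
        h ^ (p.1 + p.2) • (PowerSeries.coeff p.1 F • G p.2 : smoothFun A).1 t := by
    rw [Finset.sum_product_right]
    refine Finset.sum_congr rfl fun m _ => ?_
    rw [Finset.smul_sum]
    refine Finset.sum_congr rfl fun n _ => ?_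
    rw [smul_smul, ← pow_add, add_comm]
  rw [← Finset.sum_filter_add_sum_filter_not _ (fun p : ℕ × ℕ => p.1 + p.2 < N), ← e1] at e2
  have e3 : ∑ m ∈ Finset.range N, h ^ m • (M t h * (G m : ℝ → A) (t - α * h)) =
      M t h * ∑ m ∈ Finset.range N, h ^ m • (G m : ℝ → A) (t - α * h) := by
    rw [Finset.mul_sum]
    exact Finset.sum_congr rfl fun m _ => (mul_smul_comm _ _ _).symm
  simp only [smul_sub, Finset.sum_sub_distrib]
  rw [e2, e3, mul_sub, show t - (α + α') * h = t - α * h - α' * h by ring, mul_assoc]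
  abel

theorem HasExpansion.congr {N : ℕ} {M : ℝ → ℝ → A} {α : ℝ}
    {F F' : PowerSeries (TimeOp A)} (hM : HasExpansion N M α F)
    (h : AgreeBelow N F F') : HasExpansion N M α F' := by
  intro g
  have key : ∀ t s : ℝ,
      ∑ n ∈ Finset.range N, s ^ n • (PowerSeries.coeff n F' • g : smoothFun A).1 t =
      ∑ n ∈ Finset.range N, s ^ n • (PowerSeries.coeff n F • g : smoothFun A).1 t :=
    fun t s => Finset.sum_congr rfl fun n hn => by rw [h n (Finset.mem_range.1 hn)]
  simpa only [key] using hM g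

theorem hasExpansion_one (N : ℕ) : HasExpansion N (fun _ _ => (1 : A)) 0 1 := by
  have := (hasExpansion_shift (A := A) N).scale 0
  rwa [scaleSeries_zero_expSeries, mul_zero] at this

end Expansion

/-! ### General facts on Suzuki's recursion -/

section Suzuki

set_option linter.unusedSectionVars false

theorem suzuki_succ {R : Type*} [Monoid R] (U₁ : ℝ → ℝ → R) (m : ℕ) (b a : ℝ) :
    suzuki U₁ (m + 1) b a =
      suzuki U₁ m b (a + (1 - suzukiParam m) * (b - a)) *
      suzuki U₁ m (a + (1 - suzukiParam m) * (b - a)) (a + (1 - 2 * suzukiParam m) * (b - a)) *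
      suzuki U₁ m (a + (1 - 2 * suzukiParam m) * (b - a)) (a + 2 * suzukiParam m * (b - a)) *
      suzuki U₁ m (a + 2 * suzukiParam m * (b - a)) (a + suzukiParam m * (b - a)) *
      suzuki U₁ m (a + suzukiParam m * (b - a)) a := rfl

theorem map_suzuki {R R' : Type*} [Monoid R] [Monoid R'] (f : R →* R') (U₁ : ℝ → ℝ → R) (m : ℕ)
    (b a : ℝ) : f (suzuki U₁ m b a) = suzuki (fun b a => f (U₁ b a)) m b a := by
  induction m generalizing b a with
  | zero => rfl
  | succ m ih => simp only [suzuki_succ, map_mul, ih]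

/-- Suzuki's recursion is equivariant under affine substitutions of the time. -/
theorem suzuki_affine {R : Type*} [Monoid R] (U₁ : ℝ → ℝ → R) (a₀ δ : ℝ) (m : ℕ) (β α : ℝ) :
    suzuki U₁ m (a₀ + β * δ) (a₀ + α * δ) =
      suzuki (fun β α => U₁ (a₀ + β * δ) (a₀ + α * δ)) m β α := by
  induction m generalizing β α with
  | zero => rfl
  | succ m ih =>
    have e (c : ℝ) : a₀ + α * δ + c * (a₀ + β * δ - (a₀ + α * δ)) =
        a₀ + (α + c * (β - α)) * δ := by ring
    simp only [suzuki_succ, e, ih]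

/-- The total duration (with absolute values) of the factors `U₁` in `suzuki U₁ m 1 0`. -/
def suzukiWeight (m : ℕ) : ℝ := ∏ i ∈ Finset.range m, (8 * suzukiParam i - 1)

theorem suzukiWeight_nonneg (m : ℕ) : 0 ≤ suzukiWeight m :=
  Finset.prod_nonneg fun i _ => by linarith [(suzukiParam_bounds i).1]

/-- The weight increases by the factor `8 s - 1` in each step of the recursion, which is at
most `(5 / 3) (m + 2) / (m + 1)`; the product of these bounds telescopes. -/
theorem suzukiWeight_le (m : ℕ) : suzukiWeight m ≤ (m + 1) * (5 / 3) ^ m := by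
  induction m with
  | zero => simp [suzukiWeight]
  | succ m ih =>
    have h := (suzukiParam_bounds m).2.2
    have h' := (suzukiParam_bounds m).1
    rw [suzukiWeight, Finset.prod_range_succ, ← suzukiWeight]
    calc suzukiWeight m * (8 * suzukiParam m - 1)
        ≤ ((m + 1) * (5 / 3) ^ m) * (5 / 3 * (((m : ℝ) + 2) / (m + 1))) := by
          gcongr
          linarith
      _ = _ := by
          have : (m : ℝ) + 1 ≠ 0 := by positivity
          rw [pow_succ]
          push_cast
          field_simp
          ring

/-- A property with an additive weight passes from the first integrator to Suzuki's recursion; all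
intermediate times stay in the interval. -/
theorem suzuki_induction {R : Type*} [Monoid R] {U₁ : ℝ → ℝ → R} {J : Set ℝ} (hJ : Convex ℝ J)
    (Q : ℝ → R → Prop) (hmul : ∀ w w' x y, 0 ≤ w → 0 ≤ w' → Q w x → Q w' y → Q (w + w') (x * y))
    (h₁ : ∀ b ∈ J, ∀ a ∈ J, Q |b - a| (U₁ b a)) (m : ℕ) :
    ∀ b ∈ J, ∀ a ∈ J, Q (suzukiWeight m * |b - a|) (suzuki U₁ m b a) := by
  induction m with
  | zero => simpa [suzukiWeight, suzuki] using h₁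
  | succ m ih =>
    intro b hb a ha
    obtain ⟨hs, hs', _⟩ := suzukiParam_bounds m
    rw [suzuki_succ]
    set s := suzukiParam m with hs_def
    have mem (c : ℝ) (h0 : 0 ≤ c) (h1 : c ≤ 1) : a + c * (b - a) ∈ J := by
      have := hJ ha hb (sub_nonneg.2 h1) h0 (by ring)
      convert this using 1
      simp only [smul_eq_mul]
      ring
    have m1 := mem (1 - s) (by linarith) (by linarith)
    have m2 := mem (1 - 2 * s) (by linarith) (by linarith)
    have m3 := mem (2 * s) (by linarith) (by linarith)
    have m4 := mem s (by linarith) (by linarith)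
    have w := suzukiWeight_nonneg m
    have w' (x : ℝ) : 0 ≤ suzukiWeight m * |x| := mul_nonneg w (abs_nonneg _)
    have key := hmul _ _ _ _
      (add_nonneg (add_nonneg (add_nonneg (w' _) (w' _)) (w' _)) (w' _)) (w' _)
      (hmul _ _ _ _ (add_nonneg (add_nonneg (w' _) (w' _)) (w' _)) (w' _)
        (hmul _ _ _ _ (add_nonneg (w' _) (w' _)) (w' _)
          (hmul _ _ _ _ (w' _) (w' _) (ih _ hb _ m1) (ih _ m1 _ m2)) (ih _ m2 _ m3))
            (ih _ m3 _ m4)) (ih _ m4 _ ha)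
    convert key using 1
    rw [suzukiWeight, Finset.prod_range_succ, ← suzukiWeight, ← hs_def]
    have e1 : |b - (a + (1 - s) * (b - a))| = s * |b - a| := by
      rw [show b - (a + (1 - s) * (b - a)) = s * (b - a) by ring, abs_mul,
        abs_of_nonneg (by linarith : 0 ≤ s)]
    have e2 : |a + (1 - s) * (b - a) - (a + (1 - 2 * s) * (b - a))| = s * |b - a| := by
      rw [show a + (1 - s) * (b - a) - (a + (1 - 2 * s) * (b - a)) = s * (b - a) by ring, abs_mul,
        abs_of_nonneg (by linarith : 0 ≤ s)]
    have e3 : |a + (1 - 2 * s) * (b - a) - (a + 2 * s * (b - a))| = (4 * s - 1) * |b - a| := by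
      rw [show a + (1 - 2 * s) * (b - a) - (a + 2 * s * (b - a)) = -((4 * s - 1) * (b - a)) by ring,
        abs_neg, abs_mul, abs_of_nonneg (by linarith : 0 ≤ 4 * s - 1)]
    have e4 : |a + 2 * s * (b - a) - (a + s * (b - a))| = s * |b - a| := by
      rw [show a + 2 * s * (b - a) - (a + s * (b - a)) = s * (b - a) by ring, abs_mul,
        abs_of_nonneg (by linarith : 0 ≤ s)]
    have e5 : |a + s * (b - a) - a| = s * |b - a| := by
      rw [show a + s * (b - a) - a = s * (b - a) by ring, abs_mul,
        abs_of_nonneg (by linarith : 0 ≤ s)]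
    rw [e1, e2, e3, e4, e5]
    ring

/-- The version of `suzuki_induction` for a relation between two integrators. -/
theorem suzuki_induction₂ {R R' : Type*} [Monoid R] [Monoid R'] {U₁ : ℝ → ℝ → R}
    {U₁' : ℝ → ℝ → R'} {J : Set ℝ} (hJ : Convex ℝ J) (Q : ℝ → R → R' → Prop)
    (hmul : ∀ w w' x y x' y', 0 ≤ w → 0 ≤ w' → Q w x x' → Q w' y y' → Q (w + w') (x * y) (x' * y'))
    (h₁ : ∀ b ∈ J, ∀ a ∈ J, Q |b - a| (U₁ b a) (U₁' b a)) (m : ℕ) :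
    ∀ b ∈ J, ∀ a ∈ J, Q (suzukiWeight m * |b - a|) (suzuki U₁ m b a) (suzuki U₁' m b a) := by
  have key := suzuki_induction (U₁ := fun b a => (U₁ b a, U₁' b a)) hJ (fun w x => Q w x.1 x.2)
    (fun w w' x y hw hw' hx hy => hmul w w' _ _ _ _ hw hw' hx hy) h₁ m
  intro b hb a ha
  have := key b hb a ha
  have e1 := map_suzuki (MonoidHom.fst R R') (fun b a => (U₁ b a, U₁' b a)) m b a
  have e2 := map_suzuki (MonoidHom.snd R R') (fun b a => (U₁ b a, U₁' b a)) m b a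
  simp only [MonoidHom.coe_fst, MonoidHom.coe_snd] at e1 e2
  rwa [e1, e2] at this

variable {A : Type*} [NormedRing A] [NormedAlgebra ℝ A]

theorem HasExpansion.suzuki {N : ℕ} {U₁ : ℝ → ℝ → A} {F : PowerSeries (TimeOp A)}
    (h : HasExpansion N (fun t s => U₁ t (t - s)) 1 F) (m : ℕ) :
    HasExpansion N (fun t s => QSim.suzuki U₁ m t (t - s)) 1 (suzukiSeries F m) := by
  induction m with
  | zero => exact h
  | succ m ih =>
    have key := ((((ih.scale (suzukiParam m)).mul (ih.scale (suzukiParam m))).mul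
      (ih.scale (1 - 4 * suzukiParam m))).mul (ih.scale (suzukiParam m))).mul
      (ih.scale (suzukiParam m))
    have e : 1 * suzukiParam m + 1 * suzukiParam m + 1 * (1 - 4 * suzukiParam m) +
      1 * suzukiParam m + 1 * suzukiParam m = 1 := by ring
    rw [e] at key
    refine Eq.mp (congrArg (fun M => HasExpansion N M 1 _) ?_) key
    symm
    funext t s
    set σ := suzukiParam m
    have e1 (c : ℝ) : t - s + c * (t - (t - s)) = t - (1 - c) * s := by ring
    rw [suzuki_succ, e1, e1, e1, e1]
    rw [show t - 1 * σ * s = t - (1 - (1 - σ)) * s by ring,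
      show t - (1 * σ + 1 * σ) * s = t - (1 - (1 - 2 * σ)) * s by ring,
      show t - (1 * σ + 1 * σ + 1 * (1 - 4 * σ)) * s = t - (1 - 2 * σ) * s by ring,
      show t - (1 * σ + 1 * σ + 1 * (1 - 4 * σ) + 1 * σ) * s = t - (1 - σ) * s by ring,
      show t - (1 - (1 - σ)) * s - σ * s = t - (1 - (1 - 2 * σ)) * s by ring,
      show t - (1 - (1 - 2 * σ)) * s - (1 - 4 * σ) * s = t - (1 - 2 * σ) * s by ring,
      show t - (1 - 2 * σ) * s - σ * s = t - (1 - σ) * s by ring,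
      show t - (1 - σ) * s - σ * s = t - s by ring,
      show t - σ * s = t - (1 - (1 - σ)) * s by ring]

/-- The symmetric first integrator from time `a` to time `b` for the sum of the terms `B j`. -/
def strangBlock {ι : Type*} (l : List ι) (B : ι → ℝ → A) (b a : ℝ) : A :=
  (l.map fun j => NormedSpace.exp (((b - a) / 2) • B j ((a + b) / 2))).prod *
    (l.reverse.map fun j => NormedSpace.exp (((b - a) / 2) • B j ((a + b) / 2))).prod

variable [CompleteSpace A]

theorem hasExpansion_list_prod {ι : Type*} (l : List ι) (B : ι → smoothFun A) (N : ℕ) :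
    HasExpansion N (fun t h => (l.map fun j => NormedSpace.exp ((h / 2) • (B j : ℝ → A) t)).prod) 0
      (l.map fun j => scaleSeries (1 / 2) (expSeries (mulGen (B j)))).prod := by
  induction l with
  | nil => simpa using hasExpansion_one N
  | cons j l ih =>
    have := ((hasExpansion_mul (B j) N).scale (1 / 2)).mul ih
    simp only [zero_mul, zero_add, sub_zero] at this
    simp only [List.map_cons, List.prod_cons]
    convert this using 7
    ring

theorem hasExpansion_strangBlock {ι : Type*} (l : List ι) (B : ι → smoothFun A) (N : ℕ) :
    HasExpansion N (fun t h => strangBlock l (fun j => (B j : ℝ → A)) t (t - h)) 1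
      (strangSeries (shiftGen A :: l.map fun j => mulGen (B j))) := by
  have h1 := (hasExpansion_shift (A := A) N).scale (1 / 2)
  have h2 := (hasExpansion_list_prod l B N).mul (hasExpansion_list_prod l.reverse B N)
  have h3 := (h1.mul h2).mul h1
  rw [strangSeries_cons]
  convert h3 using 1
  · funext t h
    simp only [strangBlock, one_mul, mul_one, zero_mul, sub_zero]
    rw [show (t - (t - h)) / 2 = h / 2 by ring, show (t - h + t) / 2 = t - 1 / 2 * h by ring]
  · norm_num
  · simp [strangSeries, Function.comp_def]

theorem coeff_succ_expSeries_smul (Z : TimeOp A) (g : smoothFun A) (n : ℕ) (t : ℝ) :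
    (PowerSeries.coeff n (expSeries Z) • Z • g : smoothFun A).1 t =
      ((n : ℝ) + 1) • (PowerSeries.coeff (n + 1) (expSeries Z) • g : smoothFun A).1 t := by
  rw [coeff_expSeries, coeff_expSeries, smul_assoc, smul_assoc, pow_succ, mul_smul]
  generalize (Z ^ n • Z • g) = v
  simp only [Submodule.coe_smul, Pi.smul_apply, smul_smul]
  congr 1
  have : (n : ℝ) + 1 ≠ 0 := by positivity
  rw [Nat.factorial_succ]
  push_cast
  rw [mul_inv, mul_inv_cancel_left₀ this]

/-- Suzuki's integrator `s(h)` from time `b - h` to time `b` solves the differential equation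
`s' = s (∑ j, B j (b - h))` up to terms of order `2 m + 2`. -/
theorem exists_suzuki_expansion {ι : Type*} (l : List ι) (B : ι → smoothFun A) (m : ℕ) (b : ℝ) :
    ∃ (c : ℕ → A) (C : ℝ), ∀ h : ℝ, |h| ≤ 1 →
      ‖QSim.suzuki (strangBlock l fun j => (B j : ℝ → A)) m b (b - h) -
        ∑ n ∈ Finset.range (2 * m + 3), h ^ n • c n‖ ≤ C * |h| ^ (2 * m + 3) ∧
      ‖QSim.suzuki (strangBlock l fun j => (B j : ℝ → A)) m b (b - h) *
          (l.map fun j => (B j : ℝ → A) (b - h)).sum -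
        ∑ n ∈ Finset.range (2 * m + 3), h ^ n • ((n : ℝ) + 1) • c (n + 1)‖ ≤
          C * |h| ^ (2 * m + 3) := by
  have key := ((hasExpansion_strangBlock l B (2 * m + 3)).suzuki m).congr
    (suzukiSeries_strang_agree _ m)
  set Z := (shiftGen A :: l.map fun j => mulGen (B j)).sum with hZ
  set one : smoothFun A := ⟨fun _ => 1, mem_smoothFun.2 contDiff_const⟩ with hone
  have hZ1 (t : ℝ) : (Z • one : smoothFun A).1 t = (l.map fun j => (B j : ℝ → A) t).sum := by
    rw [hZ, List.sum_cons, add_smul, Submodule.coe_add, Pi.add_apply, shiftGen_smul]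
    simp only [hone, deriv_const, neg_zero, zero_add]
    clear hZ key Z
    induction l with
    | nil => simp
    | cons j l ih =>
      rw [List.map_cons, List.sum_cons, add_smul, Submodule.coe_add, Pi.add_apply, ih, mulGen_smul]
      simp
  obtain ⟨C, hC, h1⟩ := key one (max |b| 1)
  obtain ⟨C', hC', h2⟩ := key (Z • one) (max |b| 1)
  refine ⟨fun n => (PowerSeries.coeff n (expSeries Z) • one : smoothFun A).1 b, max C C',
    fun h hh => ⟨?_, ?_⟩⟩
  · refine (le_of_eq_of_le ?_ (h1 b h (le_max_left _ _) (hh.trans (le_max_right _ _)))).trans ?_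
    · simp [hone]
    · gcongr
      exact le_max_left _ _
  · refine (le_of_eq_of_le ?_ (h2 b h (le_max_left _ _) (hh.trans (le_max_right _ _)))).trans ?_
    · simp only [← coeff_succ_expSeries_smul, one_mul, hZ1]
    · gcongr
      exact le_max_right _ _

end Suzuki

/-! ### Analytic bound of the defect of the integrator -/

section Defect

set_option linter.unusedSectionVars false

open Filter Topology

/-- Taylor's theorem with a crude remainder, for expansion about the right end point. -/
theorem taylor_remainder_le {E : Type*} [NormedAddCommGroup E] [NormedSpace ℝ E] {a b C : ℝ}
    (P : ℕ) : ∀ F : ℕ → ℝ → E, (∀ p < P, ∀ t ∈ Set.Icc a b,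
      HasDerivWithinAt (F p) (F (p + 1) t) (Set.Icc a b) t) →
      (∀ t ∈ Set.Icc a b, ‖F P t‖ ≤ C) → ∀ t ∈ Set.Icc a b,
      ‖F 0 t - ∑ p ∈ Finset.range P, ((t - b) ^ p / (p.factorial : ℝ)) • F p b‖ ≤
        C * (b - t) ^ P := by
  induction P with
  | zero => simp
  | succ P ih =>
    intro F hF hC t ht
    have hC₀ : 0 ≤ C := (norm_nonneg _).trans (hC t ht)
    have hb : b ∈ Set.Icc a b := ⟨ht.1.trans ht.2, le_rfl⟩
    have key := ih (fun p => F (p + 1)) (fun p hp u hu => hF (p + 1) (by omega) u hu) hC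
    set ψ : ℝ → E := fun u => F 0 u -
      ∑ p ∈ Finset.range (P + 1), ((u - b) ^ p / (p.factorial : ℝ)) • F p b with hψ
    have hder (u : ℝ) (hu : u ∈ Set.Icc a b) : HasDerivWithinAt ψ (F 1 u -
        ∑ p ∈ Finset.range P, ((u - b) ^ p / (p.factorial : ℝ)) • F (p + 1) b) (Set.Icc a b) u := by
      refine (hF 0 (by omega) u hu).sub ?_
      simp_rw [Finset.sum_range_succ' _ P, pow_zero]
      refine HasDerivWithinAt.add_const _ (HasDerivWithinAt.fun_sum fun p _ => ?_)
      refine HasDerivAt.hasDerivWithinAt (HasDerivAt.smul_const ?_ _)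
      have h1 := (((hasDerivAt_id' u).sub_const b).fun_pow (p + 1)).div_const
        ((p + 1).factorial : ℝ)
      have h2 : ((p + 1 : ℕ) : ℝ) * (u - b) ^ (p + 1 - 1) * 1 / ((p + 1).factorial : ℝ) =
          (u - b) ^ p / (p.factorial : ℝ) := by
        rw [Nat.factorial_succ, Nat.add_sub_cancel]
        push_cast
        have : (p : ℝ) + 1 ≠ 0 := by positivity
        have : (p.factorial : ℝ) ≠ 0 := by positivity
        field_simp
      rwa [h2] at h1
    have hsub : Set.Icc t b ⊆ Set.Icc a b := Set.Icc_subset_Icc_left ht.1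
    have := (convex_Icc t b).norm_image_sub_le_of_norm_hasDerivWithin_le (f := ψ)
      (C := C * (b - t) ^ P) (x := b) (y := t)
      (fun u hu => (hder u (hsub hu)).mono hsub) (fun u hu => ?_) ⟨ht.2, le_rfl⟩ ⟨le_rfl, ht.2⟩
    · have h0 : ψ b = 0 := by
        simp [hψ, Finset.sum_range_succ']
      rw [h0, sub_zero, Real.norm_eq_abs, abs_sub_comm, abs_of_nonneg (sub_nonneg.2 ht.2),
        mul_assoc, ← pow_succ] at this
      exact this
    · refine (key u (hsub hu)).trans ?_
      have h1 : 0 ≤ b - u := sub_nonneg.2 hu.2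
      have h2 := hu.1
      gcongr

variable {A : Type*} [NormedRing A] [NormedAlgebra ℂ A]

/-- The polynomial with the derivatives `β p`, `p < P`, at `0`. -/
def taylorPoly (P : ℕ) (β : ℕ → A) (z : ℂ) : A :=
  ∑ p ∈ Finset.range P, (z ^ p / (p.factorial : ℂ)) • β p

theorem taylorPoly_differentiable (P : ℕ) (β : ℕ → A) : Differentiable ℂ (taylorPoly P β) := by
  unfold taylorPoly
  fun_prop

theorem norm_taylorPoly_le (P : ℕ) (β : ℕ → A) (z : ℂ) :
    ‖taylorPoly P β z‖ ≤ ∑ p ∈ Finset.range P, ‖z‖ ^ p / (p.factorial : ℝ) * ‖β p‖ := by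
  refine (norm_sum_le _ _).trans (Finset.sum_le_sum fun p _ => ?_)
  rw [norm_smul, norm_div, norm_pow, Complex.norm_natCast]

/-- If the derivatives of a family of functions at a point have the norms of those of
`Λ e ^ (Λ z)`, then the sum of their Taylor polynomials is bounded accordingly. -/
theorem sum_norm_taylorPoly_le {ι : Type*} [Fintype ι] {P : ℕ} {β : ι → ℕ → A} {Λ : ℝ}
    (hΛ : 0 ≤ Λ) (hβ : ∀ p < P, ∑ j, ‖β j p‖ ≤ Λ ^ (p + 1)) {z : ℂ} {r : ℝ} (hz : ‖z‖ ≤ r) :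
    ∑ j, ‖taylorPoly P (β j) z‖ ≤ Λ * Real.exp (Λ * r) := by
  have hr : 0 ≤ r := (norm_nonneg _).trans hz
  calc ∑ j, ‖taylorPoly P (β j) z‖
      ≤ ∑ j, ∑ p ∈ Finset.range P, r ^ p / (p.factorial : ℝ) * ‖β j p‖ := by
        refine Finset.sum_le_sum fun j _ => (norm_taylorPoly_le _ _ _).trans ?_
        gcongr
    _ = ∑ p ∈ Finset.range P, r ^ p / (p.factorial : ℝ) * ∑ j, ‖β j p‖ := by
        rw [Finset.sum_comm]
        simp only [Finset.mul_sum]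
    _ ≤ ∑ p ∈ Finset.range P, r ^ p / (p.factorial : ℝ) * Λ ^ (p + 1) := by
        refine Finset.sum_le_sum fun p hp => ?_
        have := hβ p (Finset.mem_range.1 hp)
        gcongr
    _ = Λ * ∑ p ∈ Finset.range P, (Λ * r) ^ p / (p.factorial : ℝ) := by
        rw [Finset.mul_sum]
        exact Finset.sum_congr rfl fun p _ => by rw [mul_pow]; ring
    _ ≤ _ := by
        gcongr
        exact Real.sum_le_exp_of_nonneg (by positivity) P

/-- An analytic function which is `O(h ^ N)` on the real axis has a zero of order `N` at `0`. -/
theorem le_analyticOrderAt_of_real {f : ℂ → A} (hf : AnalyticAt ℂ f 0) {N : ℕ} {C : ℝ}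
    (h : ∀ x : ℝ, |x| ≤ 1 → ‖f x‖ ≤ C * |x| ^ N) : (N : ℕ∞) ≤ analyticOrderAt f 0 := by
  by_contra! hlt
  obtain ⟨m, hm⟩ : ∃ m : ℕ, analyticOrderAt f 0 = m := ENat.ne_top_iff_exists.1 hlt.ne_top |>.imp
    fun m h => h.symm
  rw [hm] at hlt
  have hmN : m < N := by exact_mod_cast hlt
  obtain ⟨g, hg, hg0, hfg⟩ := hf.analyticOrderAt_eq_natCast.1 hm
  have hreal : Tendsto (fun x : ℝ => (x : ℂ)) (𝓝[>] 0) (𝓝 0) := by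
    have : Tendsto (fun x : ℝ => (x : ℂ)) (𝓝 0) (𝓝 0) := by
      simpa using Complex.continuous_ofReal.tendsto 0
    exact this.mono_left nhdsWithin_le_nhds
  have h1 : Tendsto (fun x : ℝ => ‖g x‖) (𝓝[>] 0) (𝓝 ‖g 0‖) :=
    (hg.continuousAt.tendsto.comp hreal).norm
  have h2 : Tendsto (fun x : ℝ => C * x ^ (N - m)) (𝓝[>] 0) (𝓝 0) := by
    have : Tendsto (fun x : ℝ => C * x ^ (N - m)) (𝓝 0) (𝓝 (C * 0 ^ (N - m))) :=
      Continuous.tendsto (by fun_prop) 0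
    rw [zero_pow (by omega), mul_zero] at this
    exact this.mono_left nhdsWithin_le_nhds
  have h3 : ‖g 0‖ ≤ 0 := by
    refine le_of_tendsto_of_tendsto h1 h2 ?_
    filter_upwards [hreal.eventually hfg, Ioo_mem_nhdsGT (zero_lt_one' ℝ)] with x hx hx01
    have h4 := h x (by rw [abs_of_pos hx01.1]; exact hx01.2.le)
    rw [hx, sub_zero, norm_smul, norm_pow, Complex.norm_real, Real.norm_eq_abs,
      abs_of_pos hx01.1] at h4
    obtain ⟨j, rfl⟩ := Nat.exists_eq_add_of_lt hmN
    rw [show m + j + 1 - m = j + 1 by omega]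
    rw [show m + j + 1 = m + (j + 1) by ring, pow_add, ← mul_assoc, mul_comm C, mul_assoc] at h4
    exact le_of_mul_le_mul_left h4 (pow_pos hx01.1 m)
  exact hg0 (norm_le_zero_iff.1 h3)

/-- The order of the defect `s' - s B` of an approximate solution of `s' = s B`, from expansions of
`s` and `s B` on the real axis. -/
theorem le_analyticOrderAt_defect [CompleteSpace A] {s B : ℂ → A} (hs : Differentiable ℂ s)
    (hB : Differentiable ℂ B) {N : ℕ} {c : ℕ → A} {C : ℝ}
    (h₁ : ∀ x : ℝ, |x| ≤ 1 → ‖s x - ∑ n ∈ Finset.range (N + 1), (x : ℂ) ^ n • c n‖ ≤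
      C * |x| ^ (N + 1))
    (h₂ : ∀ x : ℝ, |x| ≤ 1 → ‖s x * B x - ∑ n ∈ Finset.range (N + 1),
      (x : ℂ) ^ n • ((n : ℂ) + 1) • c (n + 1)‖ ≤ C * |x| ^ (N + 1)) :
    (N : ℕ∞) ≤ analyticOrderAt (fun z => deriv s z - s z * B z) 0 := by
  set f₁ : ℂ → A := fun z => s z - ∑ n ∈ Finset.range (N + 1), z ^ n • c n with hf₁
  set f₂ : ℂ → A := fun z => s z * B z - ∑ n ∈ Finset.range (N + 1),
    z ^ n • ((n : ℂ) + 1) • c (n + 1) with hf₂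
  have d₁ : Differentiable ℂ f₁ := by fun_prop
  have d₂ : Differentiable ℂ f₂ := by fun_prop
  have o₁ : ((N + 1 : ℕ) : ℕ∞) ≤ analyticOrderAt f₁ 0 :=
    le_analyticOrderAt_of_real (d₁.analyticAt 0) h₁
  have o₂ : ((N + 1 : ℕ) : ℕ∞) ≤ analyticOrderAt f₂ 0 :=
    le_analyticOrderAt_of_real (d₂.analyticAt 0) h₂
  have z₁ : f₁ 0 = 0 := by
    have := h₁ 0 (by simp)
    simp only [abs_zero, zero_pow (Nat.succ_ne_zero N), mul_zero] at this
    simpa [hf₁] using norm_le_zero_iff.1 this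
  have o₁' : (N : ℕ∞) ≤ analyticOrderAt (deriv f₁) 0 :=
    (analyticOrderAt_deriv_ge_iff (d₁.analyticAt 0) z₁).2 (by exact_mod_cast o₁)
  have d₃ : Differentiable ℂ fun z : ℂ => z ^ N • ((N : ℂ) + 1) • c (N + 1) := by fun_prop
  have o₃ : (N : ℕ∞) ≤ analyticOrderAt (fun z : ℂ => z ^ N • ((N : ℂ) + 1) • c (N + 1)) 0 :=
    (natCast_le_analyticOrderAt (d₃.analyticAt 0)).2
      ⟨fun _ => ((N : ℂ) + 1) • c (N + 1), analyticAt_const, by simp⟩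
  have o₂' : (N : ℕ∞) ≤ analyticOrderAt f₂ 0 :=
    le_trans (by exact_mod_cast Nat.le_succ N) o₂
  have e : (fun z => deriv s z - s z * B z) =
      (deriv f₁ - f₂) - fun z : ℂ => z ^ N • ((N : ℂ) + 1) • c (N + 1) := by
    funext z
    have h3 : HasDerivAt (fun z : ℂ => ∑ n ∈ Finset.range (N + 1), z ^ n • c n)
        (∑ n ∈ Finset.range N, z ^ n • ((n : ℂ) + 1) • c (n + 1)) z := by
      simp_rw [Finset.sum_range_succ' _ N, pow_zero]
      refine HasDerivAt.add_const _ (HasDerivAt.fun_sum fun n _ => ?_)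
      rw [smul_smul]
      convert (hasDerivAt_pow (n + 1) z).smul_const (c (n + 1)) using 2
      push_cast
      ring
    have h4 : deriv f₁ z = deriv s z - ∑ n ∈ Finset.range N, z ^ n • ((n : ℂ) + 1) • c (n + 1) :=
      ((hs z).hasDerivAt.sub h3).deriv
    simp only [Pi.sub_apply, h4, hf₂, Finset.sum_range_succ _ N]
    abel
  rw [e]
  exact (le_min (le_min o₁' o₂' |>.trans le_analyticOrderAt_sub) o₃).trans le_analyticOrderAt_sub

/-- The Schwarz lemma for a zero of higher order. -/
theorem norm_le_of_le_analyticOrderAt {f : ℂ → A} (hf : Differentiable ℂ f) {n : ℕ}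
    (hn : ((n + 1 : ℕ) : ℕ∞) ≤ analyticOrderAt f 0) {R K : ℝ}
    (hK : ∀ z, ‖z‖ < R → ‖f z‖ ≤ K) {z : ℂ} (hz : ‖z‖ < R) [CompleteSpace A] :
    ‖f z‖ ≤ K * (‖z‖ / R) ^ (n + 1) := by
  obtain ⟨g, hg, hfg⟩ := (natCast_le_analyticOrderAt (hf.analyticAt 0)).1 hn
  have h0 : f 0 = 0 := by simpa using hfg.self_of_nhds
  have := Complex.dist_le_mul_div_pow_of_mapsTo_ball_of_isLittleO (f := f) (c := 0) (z := z)
    (R₁ := R) (R₂ := K) (n := n) hf.differentiableOn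
    (fun w hw => by
      rw [h0, mem_closedBall_zero_iff]
      exact hK w (mem_ball_zero_iff.1 hw)) ?_ (mem_ball_zero_iff.2 hz)
  · simpa [h0] using this
  · rw [h0]
    simp only [sub_zero]
    have h1 : (fun w : ℂ => f w) =ᶠ[𝓝 0] fun w => w ^ n • (w • g w) := by
      filter_upwards [hfg] with w hw
      rw [hw, sub_zero, pow_succ, mul_smul]
    refine h1.trans_isLittleO ?_
    have h2 : (fun w : ℂ => w • g w) =o[𝓝 0] fun _ => (1 : ℝ) := by
      rw [Asymptotics.isLittleO_one_iff]
      have : Tendsto (fun w : ℂ => w • g w) (𝓝 0) (𝓝 ((0 : ℂ) • g 0)) :=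
        tendsto_id.smul hg.continuousAt.tendsto
      simpa using this
    have h3 : (fun w : ℂ => w ^ n) =O[𝓝 0] fun w : ℂ => ‖w‖ ^ n :=
      Asymptotics.IsBigO.of_norm_eventuallyLE (Eventually.of_forall fun w => by simp)
    simpa using h3.smul_isLittleO h2

end Defect

/-! ### Error of one step of the integrator -/

section Step

set_option linter.unusedSectionVars false

open Filter Topology

theorem suzuki_self {R : Type*} [Monoid R] {U₁ : ℝ → ℝ → R} (h : ∀ b, U₁ b b = 1) (m : ℕ) (b : ℝ) :
    suzuki U₁ m b b = 1 := by
  induction m generalizing b with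
  | zero => exact h b
  | succ m ih => simp [suzuki_succ, ih]

variable {A : Type*} [NormedRing A] [NormedAlgebra ℂ A] [CompleteSpace A]

theorem normedSpace_exp_differentiable : Differentiable ℂ (NormedSpace.exp : A → A) :=
  fun x => (NormedSpace.exp_analytic (𝕂 := ℂ) x).differentiableAt

theorem norm_normedSpace_exp_le [NormOneClass A] (x : A) :
    ‖NormedSpace.exp x‖ ≤ Real.exp ‖x‖ := by
  have h1 := NormedSpace.exp_series_hasSum_exp' (𝕂 := ℂ) x
  have h2 := NormedSpace.exp_series_hasSum_exp' (𝕂 := ℝ) ‖x‖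
  rw [← Real.exp_eq_exp_ℝ] at h2
  rw [← h1.tsum_eq]
  refine tsum_of_norm_bounded h2 fun n => ?_
  rw [norm_smul, norm_inv, Complex.norm_natCast, smul_eq_mul]
  gcongr
  exact norm_pow_le x n

theorem list_prod_differentiable {ι : Type*} (l : List ι) {f : ι → ℂ → A}
    (hf : ∀ j, Differentiable ℂ (f j)) : Differentiable ℂ fun z => (l.map fun j => f j z).prod := by
  induction l with
  | nil => simp
  | cons j l ih =>
    simp only [List.map_cons, List.prod_cons]
    exact (hf j).mul ih

theorem norm_list_prod_exp_le [NormOneClass A] {ι : Type*} (l : List ι) (X : ι → A) :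
    ‖(l.map fun j => NormedSpace.exp (X j)).prod‖ ≤ Real.exp (l.map fun j => ‖X j‖).sum := by
  induction l with
  | nil => simp
  | cons j l ih =>
    rw [List.map_cons, List.prod_cons, List.map_cons, List.sum_cons, Real.exp_add]
    refine (norm_mul_le _ _).trans ?_
    gcongr
    exact norm_normedSpace_exp_le _

theorem list_map_sum_eq {ι M : Type*} [Fintype ι] [AddCommMonoid M] {l : List ι} (hl : l.Nodup)
    (hl' : ∀ i, i ∈ l) (f : ι → M) : (l.map f).sum = ∑ i, f i := by
  classical
  rw [← List.sum_toFinset f hl]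
  congr 1
  ext i
  simp [hl' i]

/-- The first integrator on the interval from `b - (1 - x) z` to `b - (1 - y) z`, for complex
`z` and for the polynomials with the derivatives `β` at `b`. -/
def complexBlock {ι : Type*} (l : List ι) (P : ℕ) (β : ι → ℕ → A) (y x : ℝ) (z : ℂ) : A :=
  (l.map fun j => NormedSpace.exp ((((y - x) / 2 : ℝ) * z) •
    taylorPoly P (β j) ((((x + y) / 2 - 1 : ℝ) : ℂ) * z))).prod *
  (l.reverse.map fun j => NormedSpace.exp ((((y - x) / 2 : ℝ) * z) •
    taylorPoly P (β j) ((((x + y) / 2 - 1 : ℝ) : ℂ) * z))).prod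

/-- Suzuki's integrator as an entire function of the duration. -/
def complexSuzuki {ι : Type*} (l : List ι) (P : ℕ) (β : ι → ℕ → A) (m : ℕ) : ℂ → A :=
  suzuki (complexBlock l P β) m 1 0

theorem complexSuzuki_ofReal {ι : Type*} (l : List ι) (P : ℕ) (β : ι → ℕ → A) (m : ℕ) (b h : ℝ) :
    complexSuzuki l P β m h =
      suzuki (strangBlock l fun j t => taylorPoly P (β j) ((t - b : ℝ) : ℂ)) m b (b - h) := by
  have h1 := suzuki_affine (strangBlock l fun j t => taylorPoly P (β j) ((t - b : ℝ) : ℂ))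
    (b - h) h m 1 0
  rw [one_mul, zero_mul, add_zero, sub_add_cancel] at h1
  rw [h1]
  have h2 := map_suzuki (Pi.evalMonoidHom (fun _ : ℂ => A) (h : ℂ)) (complexBlock l P β) m 1 0
  simp only [Pi.evalMonoidHom_apply] at h2
  rw [complexSuzuki, h2]
  congr 1
  funext y x
  have e1 (X : A) : (((y - x) / 2 : ℝ) * (h : ℂ)) • X =
      ((b - h + y * h - (b - h + x * h)) / 2) • X := by
    rw [← Complex.ofReal_mul, Complex.coe_smul]
    congr 1
    ring
  have e2 : (((x + y) / 2 - 1 : ℝ) : ℂ) * h =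
      (((b - h + x * h + (b - h + y * h)) / 2 - b : ℝ) : ℂ) := by
    rw [← Complex.ofReal_mul]
    congr 1
    ring
  simp only [complexBlock, strangBlock, e1, e2]

theorem complexSuzuki_differentiable {ι : Type*} (l : List ι) (P : ℕ) (β : ι → ℕ → A) (m : ℕ) :
    Differentiable ℂ (complexSuzuki l P β m) := by
  have key := suzuki_induction (U₁ := complexBlock l P β) convex_univ
    (fun _ f => Differentiable ℂ f) (fun _ _ _ _ _ _ hx hy => hx.mul hy) ?_ m 1 trivial 0 trivial
  · exact key
  · intro y _ x _
    have h1 (j : ι) : Differentiable ℂ fun z : ℂ => NormedSpace.exp ((((y - x) / 2 : ℝ) * z) •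
        taylorPoly P (β j) ((((x + y) / 2 - 1 : ℝ) : ℂ) * z)) := by
      have := taylorPoly_differentiable P (β j)
      refine normedSpace_exp_differentiable.comp ?_
      fun_prop
    exact (list_prod_differentiable l h1).mul (list_prod_differentiable l.reverse h1)

variable [NormOneClass A] {ι : Type*} [Fintype ι] {l : List ι} (hl : l.Nodup) (hl' : ∀ i, i ∈ l)

include hl hl' in
theorem norm_complexSuzuki_le {P : ℕ} {β : ι → ℕ → A} {Λ : ℝ} (hΛ : 0 ≤ Λ)
    (hβ : ∀ p < P, ∑ j, ‖β j p‖ ≤ Λ ^ (p + 1)) (m : ℕ) {z : ℂ} {r : ℝ} (hz : ‖z‖ ≤ r) :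
    ‖complexSuzuki l P β m z‖ ≤ Real.exp (suzukiWeight m * (r * (Λ * Real.exp (Λ * r)))) := by
  have hr : 0 ≤ r := (norm_nonneg _).trans hz
  have key := suzuki_induction (U₁ := complexBlock l P β) (convex_Icc (0 : ℝ) 1)
    (fun w f => ‖f z‖ ≤ Real.exp (w * (r * (Λ * Real.exp (Λ * r)))))
    (fun w w' f g _ _ hf hg => ?_) ?_ m 1 ⟨zero_le_one, le_rfl⟩ 0 ⟨le_rfl, zero_le_one⟩
  · rw [sub_zero, abs_one, mul_one] at key
    exact key
  · rw [Pi.mul_apply, add_mul, Real.exp_add]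
    refine (norm_mul_le _ _).trans ?_
    gcongr
  · intro y hy x hx
    set X : ι → A := fun j => (((y - x) / 2 : ℝ) * z) •
        taylorPoly P (β j) ((((x + y) / 2 - 1 : ℝ) : ℂ) * z) with hX
    have hsum : ∑ j, ‖X j‖ ≤ |y - x| / 2 * (r * (Λ * Real.exp (Λ * r))) := by
      have h1 : ‖(((x + y) / 2 - 1 : ℝ) : ℂ) * z‖ ≤ r := by
        rw [norm_mul, Complex.norm_real, Real.norm_eq_abs]
        have : |(x + y) / 2 - 1| ≤ 1 := by
          rw [abs_le]
          constructor <;> linarith [hx.1, hx.2, hy.1, hy.2]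
        calc _ ≤ 1 * r := by gcongr
          _ = r := one_mul r
      have h2 := sum_norm_taylorPoly_le hΛ hβ h1
      simp only [hX, norm_smul]
      rw [← Finset.mul_sum, norm_mul, Complex.norm_real, Real.norm_eq_abs, abs_div,
        abs_of_pos (zero_lt_two' ℝ), mul_assoc]
      gcongr
    have h3 := norm_list_prod_exp_le l X
    have h4 := norm_list_prod_exp_le l.reverse X
    rw [list_map_sum_eq hl hl'] at h3
    rw [list_map_sum_eq (List.nodup_reverse.2 hl) (fun i => List.mem_reverse.2 (hl' i))] at h4
    calc ‖complexBlock l P β y x z‖ ≤ Real.exp (∑ j, ‖X j‖) * Real.exp (∑ j, ‖X j‖) := by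
          refine (norm_mul_le _ _).trans ?_
          gcongr
      _ = Real.exp (∑ j, ‖X j‖ + ∑ j, ‖X j‖) := (Real.exp_add _ _).symm
      _ ≤ _ := by
          gcongr
          linarith

theorem exp_three_quarters_bound : Real.exp (3 / 4 * Real.exp (3 / 4)) ≤ 5 := by
  have h0 := Real.exp_one_lt_d9.le
  have h1 : Real.exp (3 / 4) ≤ 32 / 15 := by
    refine le_of_pow_le_pow_left₀ (n := 4) (by norm_num) (by norm_num) ?_
    rw [← Real.exp_nat_mul, show ((4 : ℕ) : ℝ) * (3 / 4) = (3 : ℕ) * 1 by norm_num,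
      Real.exp_nat_mul]
    calc _ ≤ (2.7182818286 : ℝ) ^ 3 := by gcongr
      _ ≤ _ := by norm_num
  have h2 : Real.exp (8 / 5) ≤ 5 := by
    refine le_of_pow_le_pow_left₀ (n := 5) (by norm_num) (by norm_num) ?_
    rw [← Real.exp_nat_mul, show ((5 : ℕ) : ℝ) * (8 / 5) = (8 : ℕ) * 1 by norm_num,
      Real.exp_nat_mul]
    calc _ ≤ (2.7182818286 : ℝ) ^ 8 := by gcongr
      _ ≤ _ := by norm_num
  refine le_trans ?_ h2
  gcongr
  linarith

include hl hl' in
/-- On the disc of radius `3 / (4 Θ Λ)`, the integrator is bounded by `5`. -/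
theorem norm_complexSuzuki_le_five {P : ℕ} {β : ι → ℕ → A} {Λ Θ : ℝ} (hΛ : 0 < Λ)
    (hβ : ∀ p < P, ∑ j, ‖β j p‖ ≤ Λ ^ (p + 1)) {m : ℕ} (hΘ : suzukiWeight m ≤ Θ) (hΘ₁ : 1 ≤ Θ)
    {z : ℂ} (hz : ‖z‖ ≤ 3 / (4 * (Θ * Λ))) : ‖complexSuzuki l P β m z‖ ≤ 5 := by
  refine (norm_complexSuzuki_le hl hl' hΛ.le hβ m hz).trans (le_trans ?_ exp_three_quarters_bound)
  have hΘ₀ : 0 < Θ := by linarith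
  have e1 : Λ * (3 / (4 * (Θ * Λ))) = 3 / 4 / Θ := by field_simp
  have e2 : 3 / 4 / Θ ≤ 3 / 4 := div_le_self (by norm_num) hΘ₁
  have w := suzukiWeight_nonneg m
  refine Real.exp_le_exp.2 ?_
  calc suzukiWeight m * (3 / (4 * (Θ * Λ)) * (Λ * Real.exp (Λ * (3 / (4 * (Θ * Λ))))))
      ≤ Θ * (3 / (4 * (Θ * Λ)) * (Λ * Real.exp (3 / 4))) := by
        rw [e1]
        gcongr
    _ = 3 / 4 * Real.exp (3 / 4) := by field_simp

include hl hl' in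
/-- The defect of the integrator, by the Schwarz lemma on the disc of radius `1 / (2 Θ Λ)`: it
vanishes at `0` to the order `2 m + 2`. -/
theorem norm_defect_le {m : ℕ} {β : ι → ℕ → A} {Λ Θ : ℝ} (hΛ : 0 < Λ)
    (hβ : ∀ p < 2 * m + 2, ∑ j, ‖β j p‖ ≤ Λ ^ (p + 1)) (hΘ : suzukiWeight m ≤ Θ) (hΘ₁ : 1 ≤ Θ)
    {z : ℂ} (hz : ‖z‖ < 1 / (2 * (Θ * Λ))) :
    ‖deriv (complexSuzuki l (2 * m + 2) β m) z - complexSuzuki l (2 * m + 2) β m z *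
      ∑ j, taylorPoly (2 * m + 2) (β j) (-z)‖ ≤
        30 * (Θ * Λ) * (2 * (Θ * Λ) * ‖z‖) ^ (2 * m + 2) := by
  have hΘ₀ : 0 < Θ := by linarith
  have hΘΛ : 0 < Θ * Λ := mul_pos hΘ₀ hΛ
  set P := 2 * m + 2 with hP
  set s := complexSuzuki l P β m with hs
  set B : ℂ → A := fun z => ∑ j, taylorPoly P (β j) (-z) with hB
  have ds : Differentiable ℂ s := complexSuzuki_differentiable l P β m
  have dB : Differentiable ℂ B := by
    have (j : ι) := taylorPoly_differentiable P (β j)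
    fun_prop
  have dds : Differentiable ℂ (deriv s) := fun z => by
    have : AnalyticOnNhd ℂ s Set.univ := fun w _ => ds.analyticAt w
    exact (this.deriv z trivial).differentiableAt
  have dd : Differentiable ℂ fun z => deriv s z - s z * B z := by fun_prop
  -- the order of the zero, by comparison with the expansion on the real axis
  have hord : ((2 * m + 1 + 1 : ℕ) : ℕ∞) ≤ analyticOrderAt (fun z => deriv s z - s z * B z) 0 := by
    have hsm (j : ι) : (fun t : ℝ => taylorPoly P (β j) ((t - 0 : ℝ) : ℂ)) ∈ smoothFun A := by
      rw [mem_smoothFun]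
      have h1 := (taylorPoly_differentiable P (β j)).contDiff (n := ⊤)
      have h2 := (h1.restrict_scalars ℝ).comp
        (Complex.ofRealCLM.contDiff.comp (contDiff_id.sub (contDiff_const (c := (0 : ℝ)))))
      exact h2.of_le (by simp)
    obtain ⟨c, C, hc⟩ := exists_suzuki_expansion l (fun j => (⟨_, hsm j⟩ : smoothFun A)) m 0
    have hreal (x : ℝ) : s x = suzuki (strangBlock l fun j t =>
        taylorPoly P (β j) ((t - 0 : ℝ) : ℂ)) m 0 (0 - x) := complexSuzuki_ofReal l P β m 0 x
    refine le_analyticOrderAt_defect ds dB (c := c) (C := C) (fun x hx => ?_) fun x hx => ?_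
    · rw [hreal]
      convert (hc x hx).1 using 3
      refine Finset.sum_congr rfl fun n _ => ?_
      rw [← Complex.ofReal_pow, Complex.coe_smul]
    · rw [hreal]
      convert (hc x hx).2 using 3
      · rw [list_map_sum_eq hl hl']
        simp [hB]
      · refine Finset.sum_congr rfl fun n _ => ?_
        rw [← Complex.ofReal_pow, Complex.coe_smul, ← Complex.coe_smul ((n : ℝ) + 1)]
        push_cast
        rfl
  have hbound (w : ℂ) (hw : ‖w‖ < 1 / (2 * (Θ * Λ))) :
      ‖deriv s w - s w * B w‖ ≤ 30 * (Θ * Λ) := by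
    have e1 : 1 / (2 * (Θ * Λ)) + 1 / (4 * (Θ * Λ)) = 3 / (4 * (Θ * Λ)) := by field_simp; norm_num
    have hw' : ‖w‖ ≤ 3 / (4 * (Θ * Λ)) := by
      have : 0 < 1 / (4 * (Θ * Λ)) := by positivity
      linarith
    -- Cauchy's estimate on the circle of radius `1 / (4 Θ Λ)` about `w`
    have h1 : ‖deriv s w‖ ≤ 5 / (1 / (4 * (Θ * Λ))) := by
      refine Complex.norm_deriv_le_of_forall_mem_sphere_norm_le (by positivity) ds.diffContOnCl
        fun v hv => norm_complexSuzuki_le_five hl hl' hΛ hβ hΘ hΘ₁ ?_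
      have h2 : ‖v - w‖ = 1 / (4 * (Θ * Λ)) := mem_sphere_iff_norm.1 hv
      have h3 := norm_add_le (v - w) w
      rw [sub_add_cancel] at h3
      linarith
    have h2 : ‖B w‖ ≤ 2 * Λ := by
      refine (norm_sum_le _ _).trans ((sum_norm_taylorPoly_le hΛ.le hβ
        ((norm_neg w).trans_le hw.le)).trans ?_)
      have e2 : Λ * (1 / (2 * (Θ * Λ))) = 1 / 2 / Θ := by field_simp
      have e3 : 1 / 2 / Θ ≤ 1 / 2 := div_le_self (by norm_num) hΘ₁
      have e4 : Real.exp (1 / 2) ≤ 2 := by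
        refine le_of_pow_le_pow_left₀ (n := 2) (by norm_num) (by norm_num) ?_
        rw [← Real.exp_nat_mul]
        norm_num
        linarith [Real.exp_one_lt_d9]
      rw [e2, mul_comm 2]
      gcongr
      exact (Real.exp_le_exp.2 e3).trans e4
    have h3 := norm_complexSuzuki_le_five hl hl' hΛ hβ hΘ hΘ₁ hw'
    calc _ ≤ ‖deriv s w‖ + ‖s w‖ * ‖B w‖ :=
          (norm_sub_le _ _).trans (by gcongr; exact norm_mul_le _ _)
      _ ≤ 5 / (1 / (4 * (Θ * Λ))) + 5 * (2 * Λ) := by gcongr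
      _ ≤ 30 * (Θ * Λ) := by
        have : 1 * Λ ≤ Θ * Λ := by gcongr
        rw [one_div, div_inv_eq_mul]
        linarith
  have := norm_le_of_le_analyticOrderAt dd hord hbound hz
  rwa [div_div_eq_mul_div, div_one, mul_comm ‖z‖] at this

include hl hl' in
/-- The error of one step, for the Taylor polynomials of the terms at the end of the step. The
function `s h * V (b - h)` of the duration `h`, where `s` is the integrator and `V` the exact
solution, equals `V b` at `h = 0`, and its derivative is given by the defect and by the remainder of
Taylor's formula. -/
theorem norm_sub_suzuki_taylor_le {m : ℕ} {Λ Θ a b : ℝ} (hab : a ≤ b) (hΛ : 0 < Λ)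
    (hΘ : suzukiWeight m ≤ Θ) (hΘ₁ : 1 ≤ Θ) (hstep : 4 * Θ * (Λ * (b - a)) ≤ 1)
    {G : ι → ℕ → ℝ → A}
    (hGΛ : ∀ p ≤ 2 * m + 2, ∀ t ∈ Set.Icc a b, ∑ j, ‖G j p t‖ ≤ Λ ^ (p + 1))
    (hR : ∀ t ∈ Set.Icc a b, ∑ j, ‖G j 0 t -
      taylorPoly (2 * m + 2) (fun p => G j p b) ((t - b : ℝ) : ℂ)‖ ≤
        Λ ^ (2 * m + 3) * (b - t) ^ (2 * m + 2))
    {V : ℝ → A} (hV : ∀ t ∈ Set.Icc a b,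
      HasDerivWithinAt V ((∑ j, G j 0 t) * V t) (Set.Icc a b) t)
    (hV₁ : ∀ t ∈ Set.Icc a b, ‖V t‖ ≤ 1) :
    ‖V b - suzuki (strangBlock l fun j t =>
      taylorPoly (2 * m + 2) (fun p => G j p b) ((t - b : ℝ) : ℂ)) m b a * V a‖ ≤
        2 / 3 * (4 * Θ * (Λ * (b - a))) ^ (2 * m + 3) := by
  have hΘ₀ : 0 < Θ := by linarith
  have hΘΛ : 0 < Θ * Λ := mul_pos hΘ₀ hΛ
  set P := 2 * m + 2 with hP
  set β : ι → ℕ → A := fun j p => G j p b with hβdef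
  have hb : b ∈ Set.Icc a b := ⟨hab, le_rfl⟩
  have hβ : ∀ p < P, ∑ j, ‖β j p‖ ≤ Λ ^ (p + 1) := fun p hp => hGΛ p hp.le b hb
  set s := complexSuzuki l P β m with hs
  have hsreal (h : ℝ) := complexSuzuki_ofReal l P β m b h
  have ds : Differentiable ℂ s := complexSuzuki_differentiable l P β m
  set h₀ := b - a with hh₀
  have hlt : h₀ < 1 / (2 * (Θ * Λ)) := by
    rw [lt_div_iff₀ (by positivity)]
    linarith
  set K := 30 * (Θ * Λ) * (2 * (Θ * Λ)) ^ P + 5 * Λ ^ (P + 1) with hK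
  -- the exact solution at time `b - h`, carried to the time `b` by the integrator
  set φ : ℝ → A := fun h => s h * V (b - h) - V b with hφ
  set φ' : ℝ → A := fun h => deriv s h * V (b - h) +
    s h * -((∑ j, G j 0 (b - h)) * V (b - h)) with hφ'
  have hmem {h : ℝ} (hh : h ∈ Set.Icc 0 h₀) : b - h ∈ Set.Icc a b :=
    ⟨by linarith [hh.2], by linarith [hh.1]⟩
  have hder (h : ℝ) (hh : h ∈ Set.Icc 0 h₀) : HasDerivWithinAt φ (φ' h) (Set.Icc 0 h₀) h := by
    have h1 : HasDerivWithinAt (fun h : ℝ => s h) (deriv s h) (Set.Icc 0 h₀) h :=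
      by simpa [Function.comp_def] using
        ((ds h).hasDerivAt.scomp h (hasDerivAt_id h).ofReal_comp).hasDerivWithinAt
    have h2 := (hV (b - h) (hmem hh)).scomp h
      ((hasDerivAt_id' h).const_sub b).hasDerivWithinAt (fun _ hu => hmem hu)
    rw [neg_one_smul] at h2
    exact (h1.mul h2).sub_const _
  have hbound (h : ℝ) (hh : h ∈ Set.Icc 0 h₀) : ‖φ' h‖ ≤ K * h ^ P := by
    have hnorm : ‖(h : ℂ)‖ = h := by
      rw [Complex.norm_real, Real.norm_eq_abs, abs_of_nonneg hh.1]
    have h1 : ‖(h : ℂ)‖ < 1 / (2 * (Θ * Λ)) := by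
      rw [hnorm]
      exact hh.2.trans_lt hlt
    have h2 := norm_defect_le hl hl' hΛ hβ hΘ hΘ₁ h1
    rw [hnorm] at h2
    have h3 : ‖s h‖ ≤ 5 := by
      refine norm_complexSuzuki_le_five hl hl' hΛ hβ hΘ hΘ₁ (h1.le.trans ?_)
      rw [div_le_div_iff₀ (by positivity) (by positivity)]
      linarith
    have h4 := hR (b - h) (hmem hh)
    rw [sub_sub_cancel] at h4
    have h5 := hV₁ (b - h) (hmem hh)
    set D : A := deriv s h - s h * ∑ j, taylorPoly P (β j) (-(h : ℂ)) with hD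
    set E : A := ∑ j, (G j 0 (b - h) - taylorPoly P (β j) ((b - h - b : ℝ) : ℂ)) with hE
    have e0 : ((b - h - b : ℝ) : ℂ) = -(h : ℂ) := by
      push_cast
      ring
    have e1 : φ' h = D * V (b - h) - s h * E * V (b - h) := by
      simp only [hφ', hD, hE, e0, Finset.sum_sub_distrib]
      noncomm_ring
    have hh0 := hh.1
    rw [e1]
    calc _ ≤ ‖D‖ * ‖V (b - h)‖ + ‖s h‖ * ‖E‖ * ‖V (b - h)‖ := by
          refine (norm_sub_le _ _).trans (add_le_add (norm_mul_le _ _) ?_)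
          refine (norm_mul_le _ _).trans ?_
          gcongr
          exact norm_mul_le _ _
      _ ≤ 30 * (Θ * Λ) * (2 * (Θ * Λ) * h) ^ P * 1 + 5 * (Λ ^ (P + 1) * h ^ P) * 1 := by
          gcongr
          exact (norm_sum_le _ _).trans h4
      _ = K * h ^ P := by
          rw [hK, mul_pow]
          ring
  have hself : suzuki (strangBlock l fun j t => taylorPoly P (β j) ((t - b : ℝ) : ℂ)) m b b = 1 :=
    suzuki_self (by simp [strangBlock]) m b
  have hfin := image_norm_le_of_norm_deriv_right_le_deriv_boundary (f := φ) (f' := φ') (a := 0)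
    (b := h₀) (B := fun h => K * (h ^ (P + 1) / (P + 1))) (B' := fun h => K * h ^ P)
    (fun h hh => (hder h hh).continuousWithinAt)
    (fun h hh => (hder h ⟨hh.1, hh.2.le⟩).mono_of_mem_nhdsWithin
      (Icc_mem_nhdsGE_of_mem hh))
    (by simp only [hφ, hs]; rw [hsreal, sub_zero, hself, one_mul, sub_self, norm_zero]; simp)
    (fun h => by
      have h1 := ((hasDerivAt_pow (P + 1) h).div_const ((P : ℝ) + 1)).const_mul K
      have h2 : K * (((P + 1 : ℕ) : ℝ) * h ^ (P + 1 - 1) / ((P : ℝ) + 1)) = K * h ^ P := by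
        have : (P : ℝ) + 1 ≠ 0 := by positivity
        rw [Nat.add_sub_cancel]
        push_cast
        field_simp
      rwa [h2] at h1)
    (fun h hh => hbound h ⟨hh.1, hh.2.le⟩) (x := h₀) ⟨by linarith, le_rfl⟩
  simp only [hφ] at hfin
  rw [hs, hsreal, show b - h₀ = a by rw [hh₀]; ring, norm_sub_rev] at hfin
  refine hfin.trans ?_
  set x := Λ * h₀ with hx
  have hx0 : 0 ≤ x := by
    have : 0 ≤ h₀ := by linarith
    positivity
  have e1 : K * (h₀ ^ (P + 1) / (P + 1)) =
      (15 * (1 / 2) ^ (P + 1) + 5 * (1 / (4 * Θ)) ^ (P + 1)) / (P + 1) *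
        (4 * Θ * x) ^ (P + 1) := by
    have : (4 * Θ * x) ^ (P + 1) = 4 ^ (P + 1) * Θ ^ (P + 1) * Λ ^ (P + 1) * h₀ ^ (P + 1) := by
      rw [hx]
      simp only [mul_pow]
      ring
    have h2 : (1 / (4 * Θ)) ^ (P + 1) * (4 ^ (P + 1) * Θ ^ (P + 1)) = 1 := by
      rw [← mul_pow, ← mul_pow, one_div_mul_cancel (by positivity), one_pow]
    have h3 : (1 / 2 : ℝ) ^ (P + 1) * 4 ^ (P + 1) = 2 ^ (P + 1) := by
      rw [← mul_pow]
      norm_num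
    have h4 : (2 * (Θ * Λ)) ^ P * (2 * (Θ * Λ)) = 2 ^ (P + 1) * Θ ^ (P + 1) * Λ ^ (P + 1) := by
      ring
    rw [this, hK]
    linear_combination (15 * h₀ ^ (P + 1) / (P + 1)) * h4 - (15 * Θ ^ (P + 1) * Λ ^ (P + 1) *
      h₀ ^ (P + 1) / (P + 1)) * h3 - (5 * Λ ^ (P + 1) * h₀ ^ (P + 1) / (P + 1)) * h2
  rw [e1, show 2 * m + 3 = P + 1 by omega]
  refine mul_le_mul_of_nonneg_right ?_ (by positivity)
  have h1 : (1 / 2 : ℝ) ^ (P + 1) ≤ (1 / 2) ^ 3 :=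
    pow_le_pow_of_le_one (by norm_num) (by norm_num) (by omega)
  have h2 : (1 / (4 * Θ)) ^ (P + 1) ≤ (1 / 4 : ℝ) ^ 3 := by
    have h3 : 1 / (4 * Θ) ≤ 1 / 4 := by
      rw [div_le_div_iff₀ (by positivity) (by norm_num)]
      linarith
    calc _ ≤ (1 / 4 : ℝ) ^ (P + 1) := by gcongr
      _ ≤ _ := pow_le_pow_of_le_one (by norm_num) (by norm_num) (by omega)
  have h3 : (3 : ℝ) ≤ P + 1 := by
    rw [hP]
    push_cast
    have : (0 : ℝ) ≤ m := Nat.cast_nonneg m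
    linarith
  rw [div_le_iff₀ (by linarith)]
  have e2 : ((1 : ℝ) / 2) ^ 3 = 1 / 8 := by norm_num
  have e3 : ((1 : ℝ) / 4) ^ 3 = 1 / 64 := by norm_num
  rw [e2] at h1
  rw [e3] at h2
  linarith

end Step

/-! ### The error of one integrator step with perturbed generators -/

/-- Taylor's formula for the sum of the norms of a finite family, without a factor for the number of
its members: it is applied in the `ℓ¹`-product. -/
theorem sum_taylor_remainder_le {A ι : Type*} [NormedRing A] [NormedAlgebra ℂ A] [Fintype ι]
    {a b C : ℝ} (P : ℕ) (G : ι → ℕ → ℝ → A) (hG : ∀ j, ∀ p < P, ∀ t ∈ Set.Icc a b,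
      HasDerivWithinAt (G j p) (G j (p + 1) t) (Set.Icc a b) t)
    (hC : ∀ t ∈ Set.Icc a b, ∑ j, ‖G j P t‖ ≤ C) (t : ℝ) (ht : t ∈ Set.Icc a b) :
    ∑ j, ‖G j 0 t - taylorPoly P (fun p => G j p b) ((t - b : ℝ) : ℂ)‖ ≤ C * (b - t) ^ P := by
  have key := taylor_remainder_le (E := PiLp 1 (fun _ : ι => A)) (a := a) (b := b) (C := C) P
    (fun p t => WithLp.toLp 1 fun j => G j p t) (fun p hp t ht => by
      have h1 : HasDerivWithinAt (fun t j => G j p t) (fun j => G j (p + 1) t) (Set.Icc a b) t :=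
        hasDerivWithinAt_pi.2 fun j => hG j p hp t ht
      exact (PiLp.continuousLinearEquiv 1 ℝ (fun _ : ι =>
        A)).symm.toContinuousLinearMap.hasFDerivAt.comp_hasDerivWithinAt t h1)
    (fun t ht => by simpa [PiLp.norm_eq_of_L1] using hC t ht) t ht
  refine le_trans (le_of_eq ?_) key
  rw [PiLp.norm_eq_of_L1]
  refine Finset.sum_congr rfl fun j _ => ?_
  congr 1
  simp only [taylorPoly, PiLp.sub_apply, WithLp.ofLp_sum, Finset.sum_apply,
    WithLp.ofLp_smul, Pi.smul_apply]
  congr 1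
  refine Finset.sum_congr rfl fun p _ => ?_
  rw [← algebraMap_smul ℂ (((t - b) ^ p / (p.factorial : ℝ)) : ℝ) (G j p b)]
  congr 1
  simp

section CStar

set_option linter.unusedSectionVars false

variable {A : Type*} [NormedRing A] [NormedAlgebra ℂ A] [CompleteSpace A] [StarRing A]
  [CStarRing A] [StarModule ℂ A] [NormOneClass A] {ι : Type*}

theorem norm_exp_le_one_of_skewAdjoint {X : A} (hX : X ∈ skewAdjoint A) :
    ‖NormedSpace.exp X‖ ≤ 1 := by
  have : Nontrivial A := NormOneClass.nontrivial
  let : NormedAlgebra ℚ A := NormedAlgebra.restrictScalars ℚ ℂ A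
  exact (CStarRing.norm_of_mem_unitary (NormedSpace.exp_mem_unitary_of_mem_skewAdjoint hX)).le

/-- The exponential is nonexpansive on skew-adjoint elements. -/
theorem norm_exp_sub_exp_le {X Y : A} (hX : X ∈ skewAdjoint A) (hY : Y ∈ skewAdjoint A) :
    ‖NormedSpace.exp X - NormedSpace.exp Y‖ ≤ ‖X - Y‖ := by
  have hsk : ∀ (Z : A) (s : ℝ), Z ∈ skewAdjoint A → s • Z ∈ skewAdjoint A := by
    intro Z s hZ
    rw [skewAdjoint.mem_iff] at hZ ⊢
    rw [← algebraMap_smul ℂ s Z, star_smul, hZ]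
    simp
  have hd : ∀ s ∈ Set.Icc (0 : ℝ) 1, HasDerivWithinAt
      (fun s : ℝ => NormedSpace.exp (s • X) * NormedSpace.exp ((1 - s) • Y))
      (NormedSpace.exp (s • X) * (X - Y) * NormedSpace.exp ((1 - s) • Y)) (Set.Icc 0 1) s := by
    intro s _
    have h1 : HasDerivAt (fun s : ℝ => NormedSpace.exp (s • X)) (NormedSpace.exp (s • X) * X) s :=
      hasDerivAt_exp_smul_const X s
    have h2 : HasDerivAt (fun s : ℝ => NormedSpace.exp ((1 - s) • Y))
        (-(Y * NormedSpace.exp ((1 - s) • Y))) s := by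
      have := (hasDerivAt_exp_smul_const' Y (1 - s)).scomp s ((hasDerivAt_id s).const_sub 1)
      simpa [Function.comp_def] using this
    refine (h1.mul h2).hasDerivWithinAt.congr_deriv ?_
    noncomm_ring
  have hb : ∀ s ∈ Set.Ico (0 : ℝ) 1,
      ‖NormedSpace.exp (s • X) * (X - Y) * NormedSpace.exp ((1 - s) • Y)‖ ≤ ‖X - Y‖ := by
    intro s _
    calc _ ≤ ‖NormedSpace.exp (s • X)‖ * ‖X - Y‖ * ‖NormedSpace.exp ((1 - s) • Y)‖ :=
          norm_mul₃_le
      _ ≤ 1 * ‖X - Y‖ * 1 := by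
          gcongr
          · exact norm_exp_le_one_of_skewAdjoint (hsk _ _ hX)
          · exact norm_exp_le_one_of_skewAdjoint (hsk _ _ hY)
      _ = _ := by ring
  have := norm_image_sub_le_of_norm_deriv_le_segment_01' hd hb
  simpa using this

theorem norm_list_prod_le_one (l : List ι) {f : ι → A} (hf : ∀ j, ‖f j‖ ≤ 1) :
    ‖(l.map f).prod‖ ≤ 1 := by
  induction l with
  | nil => simp
  | cons j l ih =>
    rw [List.map_cons, List.prod_cons]
    exact (norm_mul_le _ _).trans (mul_le_one₀ (hf j) (norm_nonneg _) ih)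

theorem norm_mul_sub_mul_le {x y x' y' : A} (hx' : ‖x'‖ ≤ 1) (hy : ‖y‖ ≤ 1) :
    ‖x * y - x' * y'‖ ≤ ‖x - x'‖ + ‖y - y'‖ := by
  have : x * y - x' * y' = (x - x') * y + x' * (y - y') := by noncomm_ring
  rw [this]
  refine (norm_add_le _ _).trans (add_le_add ?_ ?_)
  · exact (norm_mul_le _ _).trans (mul_le_of_le_one_right (norm_nonneg _) hy)
  · exact (norm_mul_le _ _).trans (mul_le_of_le_one_left (norm_nonneg _) hx')

theorem norm_list_prod_sub_le (l : List ι) {f g : ι → A} (hf : ∀ j, ‖f j‖ ≤ 1)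
    (hg : ∀ j, ‖g j‖ ≤ 1) :
    ‖(l.map f).prod - (l.map g).prod‖ ≤ (l.map fun j => ‖f j - g j‖).sum := by
  induction l with
  | nil => simp
  | cons j l ih =>
    simp only [List.map_cons, List.prod_cons, List.sum_cons]
    exact (norm_mul_sub_mul_le (hg j) (norm_list_prod_le_one l hf)).trans (by gcongr)

theorem smul_mem_skewAdjoint_of_real {Z : A} (hZ : Z ∈ skewAdjoint A) (s : ℝ) :
    (s : ℂ) • Z ∈ skewAdjoint A := by
  rw [skewAdjoint.mem_iff] at hZ ⊢
  rw [star_smul, hZ]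
  simp

theorem taylorPoly_mem_skewAdjoint {P : ℕ} {β : ℕ → A} (hβ : ∀ p < P, β p ∈ skewAdjoint A)
    (s : ℝ) : taylorPoly P β (s : ℂ) ∈ skewAdjoint A := by
  refine sum_mem fun p hp => ?_
  have : ((s : ℂ) ^ p / (p.factorial : ℂ)) = ((s ^ p / p.factorial : ℝ) : ℂ) := by push_cast; rfl
  rw [this]
  exact smul_mem_skewAdjoint_of_real (hβ p (Finset.mem_range.1 hp)) _

theorem norm_strangBlock_le_one {l : List ι} {B : ι → ℝ → A} {b a : ℝ}
    (hB : ∀ j, B j ((a + b) / 2) ∈ skewAdjoint A) : ‖strangBlock l B b a‖ ≤ 1 := by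
  have h : ∀ j, ‖NormedSpace.exp (((b - a) / 2) • B j ((a + b) / 2))‖ ≤ 1 := fun j =>
    norm_exp_le_one_of_skewAdjoint (smul_mem_skewAdjoint_of_real (hB j) _)
  exact (norm_mul_le _ _).trans (mul_le_one₀ (norm_list_prod_le_one _ h) (norm_nonneg _)
    (norm_list_prod_le_one _ h))

theorem norm_strangBlock_sub_le {l : List ι} {B B' : ι → ℝ → A} {b a : ℝ}
    (hB : ∀ j, B j ((a + b) / 2) ∈ skewAdjoint A)
    (hB' : ∀ j, B' j ((a + b) / 2) ∈ skewAdjoint A) :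
    ‖strangBlock l B b a - strangBlock l B' b a‖ ≤
      |b - a| * (l.map fun j => ‖B j ((a + b) / 2) - B' j ((a + b) / 2)‖).sum := by
  have h : ∀ j, ‖NormedSpace.exp (((b - a) / 2) • B j ((a + b) / 2))‖ ≤ 1 := fun j =>
    norm_exp_le_one_of_skewAdjoint (smul_mem_skewAdjoint_of_real (hB j) _)
  have h' : ∀ j, ‖NormedSpace.exp (((b - a) / 2) • B' j ((a + b) / 2))‖ ≤ 1 := fun j =>
    norm_exp_le_one_of_skewAdjoint (smul_mem_skewAdjoint_of_real (hB' j) _)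
  have hd : ∀ j, ‖NormedSpace.exp (((b - a) / 2) • B j ((a + b) / 2)) -
      NormedSpace.exp (((b - a) / 2) • B' j ((a + b) / 2))‖ ≤
      |b - a| / 2 * ‖B j ((a + b) / 2) - B' j ((a + b) / 2)‖ := fun j => by
    have e : ‖((b - a) / 2) • B j ((a + b) / 2) - ((b - a) / 2) • B' j ((a + b) / 2)‖ =
        |b - a| / 2 * ‖B j ((a + b) / 2) - B' j ((a + b) / 2)‖ := by
      rw [← smul_sub, norm_smul, Real.norm_eq_abs, abs_div, abs_of_pos (two_pos (α := ℝ))]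
    rw [← e]
    exact norm_exp_sub_exp_le (smul_mem_skewAdjoint_of_real (hB j) _)
      (smul_mem_skewAdjoint_of_real (hB' j) _)
  have hs : ∀ l' : List ι, (l'.map fun j => ‖NormedSpace.exp (((b - a) / 2) • B j ((a + b) / 2)) -
      NormedSpace.exp (((b - a) / 2) • B' j ((a + b) / 2))‖).sum ≤
      |b - a| / 2 * (l'.map fun j => ‖B j ((a + b) / 2) - B' j ((a + b) / 2)‖).sum := by
    intro l'
    rw [← List.sum_map_mul_left]
    exact List.sum_le_sum fun j _ => hd j
  calc _ ≤ _ := norm_mul_sub_mul_le (norm_list_prod_le_one _ h') (norm_list_prod_le_one _ h)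
    _ ≤ _ := add_le_add (norm_list_prod_sub_le _ h h') (norm_list_prod_sub_le _ h h')
    _ ≤ _ := add_le_add (hs _) (hs _)
    _ = _ := by
      rw [List.map_reverse, List.sum_reverse]
      ring

/-- The integrator is Lipschitz with respect to the generators. -/
theorem norm_suzuki_sub_le {l : List ι} {B B' : ι → ℝ → A} {J : Set ℝ} (hJ : Convex ℝ J)
    (hB : ∀ j, ∀ t ∈ J, B j t ∈ skewAdjoint A) (hB' : ∀ j, ∀ t ∈ J, B' j t ∈ skewAdjoint A)
    {η : ℝ} (hη : ∀ t ∈ J, (l.map fun j => ‖B j t - B' j t‖).sum ≤ η) (m : ℕ) {b a : ℝ}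
    (hb : b ∈ J) (ha : a ∈ J) :
    ‖suzuki (strangBlock l B) m b a‖ ≤ 1 ∧ ‖suzuki (strangBlock l B') m b a‖ ≤ 1 ∧
    ‖suzuki (strangBlock l B) m b a - suzuki (strangBlock l B') m b a‖ ≤
      suzukiWeight m * |b - a| * η := by
  refine suzuki_induction₂ hJ (fun w x y => ‖x‖ ≤ 1 ∧ ‖y‖ ≤ 1 ∧ ‖x - y‖ ≤ w * η) ?_ ?_ m b hb a ha
  · rintro w w' x y x' y' _ _ ⟨h1, h2, h3⟩ ⟨h4, h5, h6⟩
    refine ⟨(norm_mul_le _ _).trans (mul_le_one₀ h1 (norm_nonneg _) h4),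
      (norm_mul_le _ _).trans (mul_le_one₀ h2 (norm_nonneg _) h5),
      (norm_mul_sub_mul_le h2 h4).trans ?_⟩
    rw [add_mul]
    exact add_le_add h3 h6
  · intro b hb a ha
    have hmid : (a + b) / 2 ∈ J := by
      have := hJ ha hb (by norm_num : (0 : ℝ) ≤ 1 / 2) (by norm_num : (0 : ℝ) ≤ 1 / 2)
        (by norm_num)
      convert this using 1
      simp only [smul_eq_mul]
      ring
    refine ⟨norm_strangBlock_le_one fun j => hB j _ hmid,
      norm_strangBlock_le_one fun j => hB' j _ hmid,
      (norm_strangBlock_sub_le (fun j => hB j _ hmid) fun j => hB' j _ hmid).trans ?_⟩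
    gcongr
    exact hη _ hmid

/-- The error of one step of the integrator whose generators `S j` approximate the derivatives
`G j 0` in total up to `η`. -/
theorem norm_sub_suzuki_le [Fintype ι] {l : List ι} (hl : l.Nodup) (hl' : ∀ j, j ∈ l) {m : ℕ}
    {Λ Θ a b η : ℝ} (hab : a ≤ b) (hΛ : 0 < Λ) (hΘ : suzukiWeight m ≤ Θ) (hΘ₁ : 1 ≤ Θ)
    (hstep : 4 * Θ * (Λ * (b - a)) ≤ 1) {G : ι → ℕ → ℝ → A}
    (hG : ∀ j, ∀ p < 2 * m + 2, ∀ t ∈ Set.Icc a b,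
      HasDerivWithinAt (G j p) (G j (p + 1) t) (Set.Icc a b) t)
    (hGs : ∀ j, ∀ p < 2 * m + 2, ∀ t ∈ Set.Icc a b, G j p t ∈ skewAdjoint A)
    (hGΛ : ∀ p ≤ 2 * m + 2, ∀ t ∈ Set.Icc a b, ∑ j, ‖G j p t‖ ≤ Λ ^ (p + 1))
    {S : ι → ℝ → A} (hS : ∀ j, ∀ t ∈ Set.Icc a b, S j t ∈ skewAdjoint A)
    (hη : ∀ t ∈ Set.Icc a b, ∑ j, ‖G j 0 t - S j t‖ ≤ η)
    {V : ℝ → A} (hV : ∀ t ∈ Set.Icc a b,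
      HasDerivWithinAt V ((∑ j, G j 0 t) * V t) (Set.Icc a b) t)
    (hV₁ : ∀ t ∈ Set.Icc a b, ‖V t‖ ≤ 1) :
    ‖V b - suzuki (strangBlock l S) m b a * V a‖ ≤
      (2 / 3 + 1 / 64) * (4 * Θ * (Λ * (b - a))) ^ (2 * m + 3) + Θ * (b - a) * η := by
  have hR := sum_taylor_remainder_le (a := a) (b := b) (2 * m + 2) G hG (hGΛ _ le_rfl)
  have ha : a ∈ Set.Icc a b := ⟨le_rfl, hab⟩
  have hb : b ∈ Set.Icc a b := ⟨hab, le_rfl⟩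
  have h1 := norm_sub_suzuki_taylor_le hl hl' hab hΛ hΘ hΘ₁ hstep hGΛ hR hV hV₁
  have hba : 0 ≤ b - a := sub_nonneg.2 hab
  obtain ⟨-, -, h2⟩ := norm_suzuki_sub_le (l := l) (convex_Icc a b)
    (B := fun j t => taylorPoly (2 * m + 2) (fun p => G j p b) ((t - b : ℝ) : ℂ)) (B' := S)
    (fun j t _ => taylorPoly_mem_skewAdjoint (fun p hp => hGs j p hp b hb) _) hS
    (η := Λ ^ (2 * m + 3) * (b - a) ^ (2 * m + 2) + η) (fun t ht => by
      rw [list_map_sum_eq hl hl']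
      calc _ ≤ ∑ j, (‖G j 0 t - taylorPoly (2 * m + 2) (fun p => G j p b) ((t - b : ℝ) : ℂ)‖ +
              ‖G j 0 t - S j t‖) := Finset.sum_le_sum fun j _ => by
            rw [norm_sub_rev (G j 0 t) (taylorPoly _ _ _)]
            exact norm_sub_le_norm_sub_add_norm_sub _ _ _
        _ ≤ _ := by
            rw [Finset.sum_add_distrib]
            refine add_le_add ((hR t ht).trans ?_) (hη t ht)
            have := ht.1
            have : 0 ≤ b - t := sub_nonneg.2 ht.2
            gcongr) m hb ha
  have hη₀ : 0 ≤ η := (Finset.sum_nonneg fun j _ => norm_nonneg _).trans (hη a ha)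
  rw [abs_of_nonneg hba] at h2
  set x := Λ * (b - a) with hx
  have hx0 : 0 ≤ x := by positivity
  have h3 : suzukiWeight m * (b - a) * (Λ ^ (2 * m + 3) * (b - a) ^ (2 * m + 2) + η) ≤
      1 / 64 * (4 * Θ * x) ^ (2 * m + 3) + Θ * (b - a) * η := by
    calc _ ≤ Θ * (b - a) * (Λ ^ (2 * m + 3) * (b - a) ^ (2 * m + 2) + η) := by gcongr
      _ = Θ * x ^ (2 * m + 3) + Θ * (b - a) * η := by
        rw [hx, mul_pow]
        ring
      _ ≤ _ := by
        refine add_le_add ?_ le_rfl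
        rw [mul_pow (4 * Θ) x]
        have h4 : 64 * Θ ≤ (4 * Θ) ^ (2 * m + 3) := by
          calc 64 * Θ ≤ 64 * Θ ^ 3 := by
                have : Θ ^ 1 ≤ Θ ^ 3 := pow_le_pow_right₀ hΘ₁ (by norm_num)
                linarith
            _ = (4 * Θ) ^ 3 := by ring
            _ ≤ _ := pow_le_pow_right₀ (by linarith) (by omega)
        have h5 : 0 ≤ x ^ (2 * m + 3) := by positivity
        nlinarith [mul_le_mul_of_nonneg_right h4 h5]
  have hVa : ‖V a‖ ≤ 1 := hV₁ a ha
  set R := suzuki (strangBlock l fun j t =>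
      taylorPoly (2 * m + 2) (fun p => G j p b) ((t - b : ℝ) : ℂ)) m b a
  set R' := suzuki (strangBlock l S) m b a
  have h6 : ‖(R - R') * V a‖ ≤ ‖R - R'‖ :=
    (norm_mul_le _ _).trans (mul_le_of_le_one_right (norm_nonneg _) hVa)
  have h7 : V b - R' * V a = (V b - R * V a) + (R - R') * V a := by noncomm_ring
  rw [h7]
  refine (norm_add_le _ _).trans ?_
  linarith

end CStar

/-! ### Adaptive time steps -/

section Adaptive

variable {Υ I : ℝ → ℝ} {κ a b : ℝ}

/-- A bound on the logarithmic derivative: both `exp (κ I) Υ` and `- exp (- κ I) Υ` increase, where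
`I` is an antiderivative of `Υ`. -/
theorem exp_mul_monotoneOn (hΥ₁ : DifferentiableOn ℝ Υ (Set.Icc a b))
    (hΥ₂ : ∀ t ∈ Set.Icc a b, |derivWithin Υ (Set.Icc a b) t| ≤ κ * Υ t ^ 2)
    (hI : ∀ t ∈ Set.Icc a b, HasDerivWithinAt I (Υ t) (Set.Icc a b) t) :
    MonotoneOn (fun t => Real.exp (κ * I t) * Υ t) (Set.Icc a b) ∧
      AntitoneOn (fun t => Real.exp (-(κ * I t)) * Υ t) (Set.Icc a b) := by
  have hIc : ContinuousOn I (Set.Icc a b) := fun t ht => (hI t ht).continuousWithinAt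
  have key : ∀ t ∈ interior (Set.Icc a b), HasDerivAt I (Υ t) t ∧
      HasDerivAt Υ (derivWithin Υ (Set.Icc a b) t) t ∧
      |derivWithin Υ (Set.Icc a b) t| ≤ κ * Υ t ^ 2 := by
    intro t ht
    have hn : Set.Icc a b ∈ nhds t := mem_interior_iff_mem_nhds.1 ht
    have ht' := interior_subset ht
    exact ⟨(hI t ht').hasDerivAt hn, (hΥ₁ t ht').hasDerivWithinAt.hasDerivAt hn, hΥ₂ t ht'⟩
  constructor
  · refine monotoneOn_of_deriv_nonneg (convex_Icc a b)
      ((Real.continuous_exp.comp_continuousOn (hIc.const_smul κ)).mul hΥ₁.continuousOn) ?_ ?_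
    · intro t ht
      obtain ⟨h1, h2, -⟩ := key t ht
      exact ((h1.const_mul κ).exp.mul h2).differentiableAt.differentiableWithinAt
    · intro t ht
      obtain ⟨h1, h2, h3⟩ := key t ht
      have hd : deriv (fun t => Real.exp (κ * I t) * Υ t) t = _ :=
        ((h1.const_mul κ).exp.mul h2).deriv
      rw [hd]
      have := (abs_le.1 h3).1
      have h4 : 0 ≤ Real.exp (κ * I t) * (κ * Υ t ^ 2 + derivWithin Υ (Set.Icc a b) t) :=
        mul_nonneg (Real.exp_pos _).le (by linarith)
      linarith
  · refine antitoneOn_of_deriv_nonpos (convex_Icc a b)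
      ((Real.continuous_exp.comp_continuousOn (hIc.const_smul κ).neg).mul hΥ₁.continuousOn) ?_ ?_
    · intro t ht
      obtain ⟨h1, h2, -⟩ := key t ht
      exact ((h1.const_mul κ).neg.exp.mul h2).differentiableAt.differentiableWithinAt
    · intro t ht
      obtain ⟨h1, h2, h3⟩ := key t ht
      have hd : deriv (fun t => Real.exp (-(κ * I t)) * Υ t) t = _ :=
        ((h1.const_mul κ).neg.exp.mul h2).deriv
      rw [hd, Pi.neg_apply]
      have := (abs_le.1 h3).2
      have h4 : 0 ≤ Real.exp (-(κ * I t)) * (κ * Υ t ^ 2 - derivWithin Υ (Set.Icc a b) t) :=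
        mul_nonneg (Real.exp_pos _).le (by linarith)
      linarith

/-- Lower bound for the integral of `Υ` over an interval, and upper bound for its values. -/
theorem step_bounds (hκ : 0 ≤ κ) (hΥ₁ : DifferentiableOn ℝ Υ (Set.Icc a b))
    (hΥ₀ : ∀ t ∈ Set.Icc a b, 0 ≤ Υ t)
    (hΥ₂ : ∀ t ∈ Set.Icc a b, |derivWithin Υ (Set.Icc a b) t| ≤ κ * Υ t ^ 2)
    (hI : ∀ t ∈ Set.Icc a b, HasDerivWithinAt I (Υ t) (Set.Icc a b) t)
    {s t : ℝ} (hs : s ∈ Set.Icc a b) (ht : t ∈ Set.Icc a b) (hst : s ≤ t) :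
    Υ s * (t - s) ≤ (I t - I s) * (1 + κ * (Υ s * (t - s))) ∧
      Υ t * (1 - κ * (Υ s * (t - s))) ≤ Υ s := by
  obtain ⟨hmono, hanti⟩ := exp_mul_monotoneOn hΥ₁ hΥ₂ hI
  have hsub : Set.Icc s t ⊆ Set.Icc a b := Set.Icc_subset_Icc hs.1 ht.2
  have hder : ∀ x ∈ interior (Set.Icc s t), HasDerivAt I (Υ x) x := fun x hx =>
    (hI x (hsub (interior_subset hx))).hasDerivAt
      (Filter.mem_of_superset (mem_interior_iff_mem_nhds.1 hx) hsub)
  have hIc : ContinuousOn I (Set.Icc s t) := fun x hx =>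
    ((hI x (hsub hx)).mono hsub).continuousWithinAt
  have hlow : ∀ x ∈ Set.Icc s t, Υ s ≤ Real.exp (κ * (I x - I s)) * Υ x := by
    intro x hx
    have := hmono hs (hsub hx) hx.1
    simp only at this
    have h2 : Real.exp (κ * (I x - I s)) = Real.exp (κ * I x) / Real.exp (κ * I s) := by
      rw [← Real.exp_sub]
      congr 1
      ring
    rw [h2, div_mul_eq_mul_div, le_div_iff₀ (Real.exp_pos _)]
    linarith
  have hupp : ∀ x ∈ Set.Icc s t, Real.exp (-(κ * (I x - I s))) * Υ x ≤ Υ s := by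
    intro x hx
    have := hanti hs (hsub hx) hx.1
    simp only at this
    have h2 : Real.exp (-(κ * (I x - I s))) = Real.exp (-(κ * I x)) / Real.exp (-(κ * I s)) := by
      rw [← Real.exp_sub]
      congr 1
      ring
    rw [h2, div_mul_eq_mul_div, div_le_iff₀ (Real.exp_pos _)]
    linarith
  have hss : s ∈ Set.Icc s t := ⟨le_rfl, hst⟩
  have htt : t ∈ Set.Icc s t := ⟨hst, le_rfl⟩
  have hE₁ : 1 + κ * (Υ s * (t - s)) ≤ Real.exp (κ * (I t - I s)) := by
    have : MonotoneOn (fun x => Real.exp (κ * (I x - I s)) - κ * (Υ s * (x - s)))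
        (Set.Icc s t) := by
      have hd : ∀ x ∈ interior (Set.Icc s t),
          HasDerivAt (fun x => Real.exp (κ * (I x - I s)) - κ * (Υ s * (x - s)))
            (Real.exp (κ * (I x - I s)) * (κ * Υ x) - κ * (Υ s * 1)) x := fun x hx =>
        ((((hder x hx).sub_const _).const_mul κ).exp).sub
          ((((hasDerivAt_id x).sub_const s).const_mul _).const_mul κ)
      refine monotoneOn_of_deriv_nonneg (convex_Icc s t) ?_ (fun x hx =>
        (hd x hx).differentiableAt.differentiableWithinAt) ?_
      · fun_prop
      · intro x hx
        rw [(hd x hx).deriv]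
        have := mul_le_mul_of_nonneg_left (hlow x (interior_subset hx)) hκ
        linarith
    have := this hss htt hst
    simp only [sub_self, mul_zero, Real.exp_zero, sub_zero] at this
    linarith
  have hE₂ : 1 - κ * (Υ s * (t - s)) ≤ Real.exp (-(κ * (I t - I s))) := by
    have : MonotoneOn (fun x => Real.exp (-(κ * (I x - I s))) + κ * (Υ s * (x - s)))
        (Set.Icc s t) := by
      have hd : ∀ x ∈ interior (Set.Icc s t),
          HasDerivAt (fun x => Real.exp (-(κ * (I x - I s))) + κ * (Υ s * (x - s)))
            (Real.exp (-(κ * (I x - I s))) * (-(κ * Υ x)) + κ * (Υ s * 1)) x := fun x hx =>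
        ((((hder x hx).sub_const _).const_mul κ).neg.exp).add
          ((((hasDerivAt_id x).sub_const s).const_mul _).const_mul κ)
      refine monotoneOn_of_deriv_nonneg (convex_Icc s t) ?_ (fun x hx =>
        (hd x hx).differentiableAt.differentiableWithinAt) ?_
      · fun_prop
      · intro x hx
        rw [(hd x hx).deriv]
        have := mul_le_mul_of_nonneg_left (hupp x (interior_subset hx)) hκ
        linarith
    have := this hss htt hst
    simp only [sub_self, mul_zero, neg_zero, Real.exp_zero, add_zero] at this
    linarith
  have hz : 0 ≤ Υ s * (t - s) := mul_nonneg (hΥ₀ s hs) (sub_nonneg.2 hst)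
  constructor
  · rcases hκ.eq_or_lt with rfl | hκ'
    · have : MonotoneOn (fun x => I x - Υ s * x) (Set.Icc s t) := by
        have hd : ∀ x ∈ interior (Set.Icc s t),
            HasDerivAt (fun x => I x - Υ s * x) (Υ x - Υ s * 1) x := fun x hx =>
          (hder x hx).sub ((hasDerivAt_id x).const_mul _)
        refine monotoneOn_of_deriv_nonneg (convex_Icc s t) ?_ (fun x hx =>
          (hd x hx).differentiableAt.differentiableWithinAt) ?_
        · fun_prop
        · intro x hx
          rw [(hd x hx).deriv]
          have := hlow x (interior_subset hx)
          simp only [zero_mul, Real.exp_zero, one_mul] at this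
          linarith
      have := this hss htt hst
      simp only at this
      linarith
    · -- `1 - κ u ≤ exp (- κ u) ≤ 1 / (1 + κ z)`
      have h1 : 1 - κ * (I t - I s) ≤ Real.exp (-(κ * (I t - I s))) := by
        have := Real.add_one_le_exp (-(κ * (I t - I s)))
        linarith
      have h2 : Real.exp (-(κ * (I t - I s))) * (1 + κ * (Υ s * (t - s))) ≤ 1 := by
        calc _ ≤ Real.exp (-(κ * (I t - I s))) * Real.exp (κ * (I t - I s)) := by gcongr
          _ = 1 := by rw [← Real.exp_add]; simp
      have h3 : (1 - κ * (I t - I s)) * (1 + κ * (Υ s * (t - s))) ≤ 1 :=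
        (mul_le_mul_of_nonneg_right h1 (by positivity)).trans h2
      refine le_of_mul_le_mul_left ?_ hκ'
      linarith
  · calc Υ t * (1 - κ * (Υ s * (t - s))) ≤ Υ t * Real.exp (-(κ * (I t - I s))) := by
          gcongr
          exact hΥ₀ t ht
      _ ≤ Υ s := by linarith [hupp t htt]

end Adaptive

theorem adaptiveTime_succ_of_le {Υ : ℝ → ℝ} {Y K t₀ Δt : ℝ} {p : ℕ}
    (h : Υ (adaptiveTime Υ Y K t₀ Δt p) * (Y + K ^ 2) *
      (t₀ + Δt - adaptiveTime Υ Y K t₀ Δt p) ≤ 1) :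
    adaptiveTime Υ Y K t₀ Δt (p + 1) = t₀ + Δt := by
  rw [adaptiveTime]
  exact if_pos h

theorem adaptiveTime_succ_of_lt {Υ : ℝ → ℝ} {Y K t₀ Δt : ℝ} {p : ℕ}
    (h : 1 < Υ (adaptiveTime Υ Y K t₀ Δt p) * (Y + K ^ 2) *
      (t₀ + Δt - adaptiveTime Υ Y K t₀ Δt p)) :
    adaptiveTime Υ Y K t₀ Δt (p + 1) = adaptiveTime Υ Y K t₀ Δt p +
      1 / (Υ (adaptiveTime Υ Y K t₀ Δt p) * (Y + K ^ 2)) := by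
  rw [adaptiveTime]
  exact if_neg (not_le.2 h)

/-- If `N > (Y + 2 K²) ∫ Υ`, then the adaptive times reach the end after at most `N` steps, since
each full step takes at least the amount `1 / (Y + 2 K²)` of the integral; and `Υ` is at most
`1 / (Y h)` on each step of length `h`. -/
theorem exists_adaptiveTime_eq {Υ : ℝ → ℝ} {Y K t₀ Δt : ℝ} (hΔt : 0 < Δt) (hY : 0 < Y)
    (hΥ₀ : ∀ t ∈ Set.Icc t₀ (t₀ + Δt), 0 ≤ Υ t)
    (hΥ₁ : DifferentiableOn ℝ Υ (Set.Icc t₀ (t₀ + Δt)))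
    (hΥ₂ : ∀ t ∈ Set.Icc t₀ (t₀ + Δt),
      |derivWithin Υ (Set.Icc t₀ (t₀ + Δt)) t| ≤ K ^ 2 * Υ t ^ 2) {N : ℕ}
    (hN : (∫ t in t₀..(t₀ + Δt), Υ t) * (Y + 2 * K ^ 2) < N) :
    ∃ r, 1 ≤ r ∧ r ≤ N ∧
      (∀ p < r, adaptiveTime Υ Y K t₀ Δt p < adaptiveTime Υ Y K t₀ Δt (p + 1)) ∧
      adaptiveTime Υ Y K t₀ Δt r = t₀ + Δt ∧
      (∀ p ≤ r, adaptiveTime Υ Y K t₀ Δt p ∈ Set.Icc t₀ (t₀ + Δt)) ∧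
      ∀ p < r, ∀ s ∈ Set.Icc (adaptiveTime Υ Y K t₀ Δt p) (adaptiveTime Υ Y K t₀ Δt (p + 1)),
        Υ s * (adaptiveTime Υ Y K t₀ Δt (p + 1) - adaptiveTime Υ Y K t₀ Δt p) * Y ≤ 1 := by
  have hle : t₀ ≤ t₀ + Δt := by linarith
  have hκ : 0 ≤ K ^ 2 := sq_nonneg K
  obtain ⟨I, hI, hI₀, hI₁⟩ : ∃ I : ℝ → ℝ,
      (∀ t ∈ Set.Icc t₀ (t₀ + Δt), HasDerivWithinAt I (Υ t) (Set.Icc t₀ (t₀ + Δt)) t) ∧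
      I t₀ = 0 ∧ I (t₀ + Δt) = ∫ t in t₀..(t₀ + Δt), Υ t := by
    have hc : Continuous (Set.IccExtend hle ((Set.Icc t₀ (t₀ + Δt)).domRestrict Υ)) :=
      (continuousOn_iff_continuous_domRestrict.1 hΥ₁.continuousOn).Icc_extend'
    have he : ∀ t ∈ Set.Icc t₀ (t₀ + Δt),
        Set.IccExtend hle ((Set.Icc t₀ (t₀ + Δt)).domRestrict Υ) t = Υ t := fun t ht =>
      Set.IccExtend_of_mem hle _ ht
    refine ⟨fun t => ∫ x in t₀..t, Set.IccExtend hle ((Set.Icc t₀ (t₀ + Δt)).domRestrict Υ) x,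
      fun t ht => ?_, intervalIntegral.integral_same, ?_⟩
    · rw [← he t ht]
      exact (hc.integral_hasStrictDerivAt t₀ t).hasDerivAt.hasDerivWithinAt
    · refine intervalIntegral.integral_congr fun t ht => he t ?_
      rwa [Set.uIcc_of_le hle] at ht
  set τ := adaptiveTime Υ Y K t₀ Δt with hτ
  have hτ₀ : τ 0 = t₀ := rfl
  have hYκ : 0 < Y + K ^ 2 := by linarith
  have hImono : MonotoneOn I (Set.Icc t₀ (t₀ + Δt)) := by
    refine monotoneOn_of_deriv_nonneg (convex_Icc _ _)
      (fun t ht => (hI t ht).continuousWithinAt) ?_ ?_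
    · intro t ht
      exact (hI t (interior_subset ht)).differentiableWithinAt.mono interior_subset
    · intro t ht
      rw [((hI t (interior_subset ht)).hasDerivAt (mem_interior_iff_mem_nhds.1 ht)).deriv]
      exact hΥ₀ t (interior_subset ht)
  -- the steps before the first cut one
  have hsteps : ∀ p, τ p ∈ Set.Icc t₀ (t₀ + Δt) →
      1 < Υ (τ p) * (Y + K ^ 2) * (t₀ + Δt - τ p) →
      τ p < τ (p + 1) ∧ τ (p + 1) < t₀ + Δt ∧ Υ (τ p) * (Y + K ^ 2) * (τ (p + 1) - τ p) = 1 := by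
    intro p hp hlt
    have h1 : τ (p + 1) = τ p + 1 / (Υ (τ p) * (Y + K ^ 2)) := adaptiveTime_succ_of_lt hlt
    have h2 : 0 < Υ (τ p) := by
      refine lt_of_le_of_ne (hΥ₀ _ hp) fun h => ?_
      rw [← h] at hlt
      simp only [zero_mul] at hlt
      linarith
    have h3 : 0 < Υ (τ p) * (Y + K ^ 2) := by positivity
    have h4 : 1 / (Υ (τ p) * (Y + K ^ 2)) < t₀ + Δt - τ p := by
      rw [div_lt_iff₀ h3]
      linarith
    have h5 : 0 < 1 / (Υ (τ p) * (Y + K ^ 2)) := by positivity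
    refine ⟨by linarith, by linarith, ?_⟩
    rw [h1, add_sub_cancel_left, mul_one_div_cancel h3.ne']
  -- before the first cut step, each step uses up at least `1 / (Y + 2 K²)` of the integral
  have huncut : ∀ N, (∀ p < N, 1 < Υ (τ p) * (Y + K ^ 2) * (t₀ + Δt - τ p)) →
      τ N ∈ Set.Ico t₀ (t₀ + Δt) ∧ (N : ℝ) ≤ I (τ N) * (Y + 2 * K ^ 2) := by
    intro N
    induction N with
    | zero =>
      intro _
      refine ⟨⟨le_rfl, by rw [hτ₀]; linarith⟩, ?_⟩
      rw [hτ₀, hI₀]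
      simp
    | succ N ih =>
      intro h
      obtain ⟨h1, h2⟩ := ih fun p hp => h p (by omega)
      obtain ⟨h3, h4, h5⟩ := hsteps N ⟨h1.1, h1.2.le⟩ (h N (by omega))
      refine ⟨⟨h1.1.trans h3.le, h4⟩, ?_⟩
      have h6 := (step_bounds hκ hΥ₁ hΥ₀ hΥ₂ hI (s := τ N) (t := τ (N + 1)) ⟨h1.1, h1.2.le⟩
        ⟨h1.1.trans h3.le, h4.le⟩ h3.le).1
      have h7 := mul_le_mul_of_nonneg_right h6 hYκ.le
      have h8 : Υ (τ N) * (τ (N + 1) - τ N) * (Y + K ^ 2) = 1 := by rw [← h5]; ring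
      have h9 : (I (τ (N + 1)) - I (τ N)) * (1 + K ^ 2 * (Υ (τ N) * (τ (N + 1) - τ N))) *
          (Y + K ^ 2) = (I (τ (N + 1)) - I (τ N)) * (Y + 2 * K ^ 2) := by
        linear_combination (I (τ (N + 1)) - I (τ N)) * K ^ 2 * h8
      push_cast
      linarith
  have hex : ∃ p, ¬ 1 < Υ (τ p) * (Y + K ^ 2) * (t₀ + Δt - τ p) := by
    by_contra! hcon
    obtain ⟨h1, h2⟩ := huncut N fun p _ => hcon p
    have h3 := hImono ⟨h1.1, h1.2.le⟩ ⟨hle, le_rfl⟩ h1.2.le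
    have : I (τ N) * (Y + 2 * K ^ 2) ≤ I (t₀ + Δt) * (Y + 2 * K ^ 2) := by gcongr
    rw [hI₁] at this
    linarith
  classical
  obtain ⟨p₀, hp₀, hmin⟩ : ∃ p₀, ¬ 1 < Υ (τ p₀) * (Y + K ^ 2) * (t₀ + Δt - τ p₀) ∧
      ∀ p < p₀, 1 < Υ (τ p) * (Y + K ^ 2) * (t₀ + Δt - τ p) :=
    ⟨Nat.find hex, Nat.find_spec hex, fun p hp => not_not.1 (Nat.find_min hex hp)⟩
  have hin : ∀ p ≤ p₀, τ p ∈ Set.Ico t₀ (t₀ + Δt) := fun p hp =>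
    (huncut p fun q hq => hmin q (by omega)).1
  have hlast : τ (p₀ + 1) = t₀ + Δt := adaptiveTime_succ_of_le (not_lt.1 hp₀)
  have hstep' : ∀ p < p₀ + 1, τ p < τ (p + 1) ∧ τ (p + 1) ≤ t₀ + Δt ∧
      Υ (τ p) * (Y + K ^ 2) * (τ (p + 1) - τ p) ≤ 1 := by
    intro p hp
    rcases (Nat.lt_succ_iff.1 hp).eq_or_lt with rfl | hp'
    · rw [hlast]
      exact ⟨(hin p le_rfl).2, le_rfl, not_lt.1 hp₀⟩
    · have h1 := hin p hp'.le
      obtain ⟨h3, h4, h5⟩ := hsteps p ⟨h1.1, h1.2.le⟩ (hmin p hp')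
      exact ⟨h3, h4.le, h5.le⟩
  refine ⟨p₀ + 1, by omega, ?_, fun p hp => (hstep' p hp).1, hlast, ?_, ?_⟩
  · by_contra! hlt
    obtain ⟨h1, h2⟩ := huncut N fun p hp => hmin p (by omega)
    have h3 := hImono ⟨h1.1, h1.2.le⟩ ⟨hle, le_rfl⟩ h1.2.le
    have : I (τ N) * (Y + 2 * K ^ 2) ≤ I (t₀ + Δt) * (Y + 2 * K ^ 2) := by gcongr
    rw [hI₁] at this
    linarith
  · intro p hp
    rcases hp.eq_or_lt with rfl | hp'
    · rw [hlast]
      exact ⟨hle, le_rfl⟩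
    · exact Set.Ico_subset_Icc_self (hin p (by omega))
  · intro p hp s hs
    obtain ⟨h3, h4, h5⟩ := hstep' p hp
    have h1 := hin p (by omega)
    set h := τ (p + 1) - τ p with hh
    have hh0 : 0 < h := by linarith
    have hsm : s ∈ Set.Icc t₀ (t₀ + Δt) := ⟨h1.1.trans hs.1, hs.2.trans h4⟩
    have h6 := (step_bounds hκ hΥ₁ hΥ₀ hΥ₂ hI (s := τ p) (t := s) ⟨h1.1, h1.2.le⟩ hsm hs.1).2
    have hΥp := hΥ₀ _ ⟨h1.1, h1.2.le⟩
    have hΥs := hΥ₀ _ hsm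
    have h7 : Υ s * (1 - K ^ 2 * (Υ (τ p) * h)) ≤ Υ (τ p) := by
      refine le_trans ?_ h6
      have : s - τ p ≤ h := by linarith [hs.2]
      gcongr
    -- with `z = Υ (τ p) h` one has `Υ s h ≤ z / (1 - K² z)` and `z (Y + K²) ≤ 1`
    have h8 : Υ s * h * (1 - K ^ 2 * (Υ (τ p) * h)) ≤ Υ (τ p) * h := by
      have := mul_le_mul_of_nonneg_right h7 hh0.le
      linarith
    have h9 : Υ (τ p) * h * Y ≤ 1 - K ^ 2 * (Υ (τ p) * h) := by linarith
    have hz0 : 0 ≤ Υ (τ p) * h := by positivity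
    have hpos : 0 < 1 - K ^ 2 * (Υ (τ p) * h) := by
      have h10 : Y * (K ^ 2 * (Υ (τ p) * h)) ≤ K ^ 2 * (1 - K ^ 2 * (Υ (τ p) * h)) := by
        have := mul_le_mul_of_nonneg_left h9 hκ
        linarith
      by_contra! hneg
      have : K ^ 2 * (1 - K ^ 2 * (Υ (τ p) * h)) ≤ 0 :=
        mul_nonpos_of_nonneg_of_nonpos hκ hneg
      have : 0 < Y * (K ^ 2 * (Υ (τ p) * h)) := mul_pos hY (by linarith)
      linarith
    refine le_of_mul_le_mul_right ?_ hpos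
    calc Υ s * h * Y * (1 - K ^ 2 * (Υ (τ p) * h)) =
        Υ s * h * (1 - K ^ 2 * (Υ (τ p) * h)) * Y := by ring
      _ ≤ Υ (τ p) * h * Y := by gcongr
      _ ≤ _ := by linarith

/-- `r_g` in terms of the integral of `Υ` instead of its average. -/
theorem stepBound_eq {d k : ℕ} {K η t₀ Δt : ℝ} (hΔt : 0 < Δt) (Υ : ℝ → ℝ) :
    stepBound d k K η t₀ Δt Υ =
      ⌈(24 * d ^ 2 * (k * (5 / 3 : ℝ) ^ (k - 1)) * ∫ t in t₀..(t₀ + Δt), Υ t) ^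
          (1 + 1 / (2 * (k : ℝ))) / η ^ (1 / (2 * (k : ℝ))) +
        3 * K ^ 2 * (∫ t in t₀..(t₀ + Δt), Υ t) + 1⌉₊ := by
  have : average Υ (t₀ + Δt) t₀ * Δt = ∫ t in t₀..(t₀ + Δt), Υ t := by
    rw [average, add_sub_cancel_left]
    field_simp
  have h1 : 24 * d ^ 2 * k * (5 / 3 : ℝ) ^ (k - 1) * average Υ (t₀ + Δt) t₀ * Δt =
      24 * d ^ 2 * (k * (5 / 3 : ℝ) ^ (k - 1)) * ∫ t in t₀..(t₀ + Δt), Υ t := by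
    rw [← this]
    ring
  rw [stepBound, h1, mul_assoc (3 * K ^ 2), this]

theorem integral_nonneg_of_Icc {t₀ Δt : ℝ} {Υ : ℝ → ℝ} (hΔt : 0 < Δt)
    (hΥ₀ : ∀ t ∈ Set.Icc t₀ (t₀ + Δt), 0 ≤ Υ t) : 0 ≤ ∫ t in t₀..(t₀ + Δt), Υ t :=
  intervalIntegral.integral_nonneg (by linarith) hΥ₀

theorem stepBound_anti {d k : ℕ} {K ε η t₀ Δt : ℝ} {Υ : ℝ → ℝ} (hΔt : 0 < Δt) (hη : 0 < η)
    (hηε : η ≤ ε) (hΥ₀ : ∀ t ∈ Set.Icc t₀ (t₀ + Δt), 0 ≤ Υ t) :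
    stepBound d k K ε t₀ Δt Υ ≤ stepBound d k K η t₀ Δt Υ := by
  have hJ := integral_nonneg_of_Icc hΔt hΥ₀
  rw [stepBound_eq hΔt, stepBound_eq hΔt]
  gcongr

theorem one_le_stepBound {d k : ℕ} {K ε t₀ Δt : ℝ} {Υ : ℝ → ℝ} (hΔt : 0 < Δt) (hε : 0 < ε)
    (hΥ₀ : ∀ t ∈ Set.Icc t₀ (t₀ + Δt), 0 ≤ Υ t) :
    1 ≤ stepBound d k K ε t₀ Δt Υ := by
  have hJ := integral_nonneg_of_Icc hΔt hΥ₀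
  rw [stepBound_eq hΔt, Nat.one_le_ceil_iff]
  positivity

/-- The number `r_g` of steps suffices; by the inequality of the weighted arithmetic and geometric
means applied to `Y ∫ Υ`. -/
theorem integral_mul_lt_stepBound {d k : ℕ} {K ε t₀ Δt : ℝ} {Υ : ℝ → ℝ} (hk : 1 ≤ k)
    (hΔt : 0 < Δt) (hε : 0 < ε) (hΥ₀ : ∀ t ∈ Set.Icc t₀ (t₀ + Δt), 0 ≤ Υ t) :
    (∫ t in t₀..(t₀ + Δt), Υ t) *
      (stepConst d k ε (stepBound d k K ε t₀ Δt Υ) + 2 * K ^ 2) <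
      ((stepBound d k K ε t₀ Δt Υ : ℕ) : ℝ) := by
  have hJ := integral_nonneg_of_Icc hΔt hΥ₀
  have h1 : (1 : ℝ) ≤ ((stepBound d k K ε t₀ Δt Υ : ℕ) : ℝ) := by
    exact_mod_cast one_le_stepBound hΔt hε hΥ₀
  have hceil := Nat.le_ceil ((24 * d ^ 2 * (k * (5 / 3 : ℝ) ^ (k - 1)) *
    ∫ t in t₀..(t₀ + Δt), Υ t) ^ (1 + 1 / (2 * (k : ℝ))) / ε ^ (1 / (2 * (k : ℝ))) +
        3 * K ^ 2 * (∫ t in t₀..(t₀ + Δt), Υ t) + 1)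
  rw [← stepBound_eq hΔt] at hceil
  set rg : ℝ := ((stepBound d k K ε t₀ Δt Υ : ℕ) : ℝ) with hrg
  set J := ∫ t in t₀..(t₀ + Δt), Υ t
  set Z := 24 * (d : ℝ) ^ 2 * (k * (5 / 3 : ℝ) ^ (k - 1)) * J with hZ
  have hZ0 : 0 ≤ Z := by positivity
  set X := Z ^ (1 + 1 / (2 * (k : ℝ))) / ε ^ (1 / (2 * (k : ℝ))) with hX
  have hX0 : 0 ≤ X := by positivity
  have hk' : (1 : ℝ) ≤ k := by exact_mod_cast hk
  have hXY : X ^ (2 * (k : ℝ) / (2 * k + 1)) * rg ^ (1 / (2 * (k : ℝ) + 1)) =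
      J * stepConst d k ε (stepBound d k K ε t₀ Δt Υ) := by
    have e1 : X ^ (2 * (k : ℝ) / (2 * k + 1)) = Z / ε ^ (1 / (2 * (k : ℝ) + 1)) := by
      rw [hX, Real.div_rpow (by positivity) (by positivity), ← Real.rpow_mul hZ0,
        ← Real.rpow_mul hε.le]
      congr 1
      · rw [show (1 + 1 / (2 * (k : ℝ))) * (2 * k / (2 * k + 1)) = 1 by field_simp, Real.rpow_one]
      · congr 1
        field_simp
    rw [e1, stepConst, ← hrg, Real.div_rpow hε.le (by positivity)]
    have : 0 < ε ^ (1 / (2 * (k : ℝ) + 1)) := by positivity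
    have : 0 < rg ^ (1 / (2 * (k : ℝ) + 1)) := by positivity
    field_simp
    rw [hZ]
    ring
  have hamgm := Real.geom_mean_le_arith_mean2_weighted
    (w₁ := 2 * (k : ℝ) / (2 * k + 1)) (w₂ := 1 / (2 * (k : ℝ) + 1)) (p₁ := X) (p₂ := rg)
    (by positivity) (by positivity) hX0 (by positivity) (by field_simp)
  rw [hXY] at hamgm
  have e2 : 2 * (k : ℝ) / (2 * k + 1) * X + 1 / (2 * (k : ℝ) + 1) * rg =
      rg - 2 * (k : ℝ) / (2 * k + 1) * (rg - X) := by
    field_simp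
    ring
  -- the weight of `X` is at least `2 / 3`, which is why `r_g` contains the term `3 K² ∫ Υ`
  have e3 : (2 : ℝ) / 3 ≤ 2 * (k : ℝ) / (2 * k + 1) := by
    rw [div_le_div_iff₀ (by norm_num) (by positivity)]
    linarith
  have h3 : 0 ≤ K ^ 2 * J := by positivity
  have e4 : 2 / 3 * (3 * (K ^ 2 * J) + 1) ≤ 2 * (k : ℝ) / (2 * k + 1) * (rg - X) := by
    apply mul_le_mul e3 (by linarith) (by positivity) (by positivity)
  rw [mul_add]
  linarith

/-! ### One-sparse terms -/

section CoinTossing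

variable {N d : ℕ} {f : Fin N → Fin d → Fin N} {i j : Fin d}

theorem testBit_firstDiff_ne {a b : ℕ} (h : a ≠ b) :
    a.testBit (firstDiff a b) ≠ b.testBit (firstDiff a b) := by
  have : {p | a.testBit p ≠ b.testBit p}.Nonempty := by
    by_contra hcon
    refine h (Nat.eq_of_testBit_eq fun p => ?_)
    by_contra hp
    exact hcon ⟨p, hp⟩
  exact Nat.sInf_mem this

theorem firstDiff_lt {a b c : ℕ} (h : a ≠ b) (ha : a < 2 ^ c) (hb : b < 2 ^ c) :
    firstDiff a b < c := by
  by_contra! hc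
  have hpow : 2 ^ c ≤ 2 ^ firstDiff a b := Nat.pow_le_pow_right (by norm_num) hc
  apply testBit_firstDiff_ne h
  rw [Nat.testBit_lt_two_pow (ha.trans_le hpow), Nat.testBit_lt_two_pow (hb.trans_le hpow)]

/-- Deterministic coin tossing keeps the colouring of the paths proper: if two consecutive vertices
got the same label, then their old labels would agree in the first bit in which they differ. -/
theorem coinLabel_ne (r : ℕ) (x : Fin N) (hx : x < f x i) (hx' : f (f x i) j = x) :
    coinLabel f i j r x ≠ coinLabel f i j r (f x i) := by
  induction r generalizing x with
  | zero => exact fun h => hx.ne (Fin.ext h)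
  | succ r ih =>
    have h1 := ih x hx hx'
    simp only [coinLabel]
    set L := coinLabel f i j r
    rw [coinToss, if_pos ⟨hx, hx'⟩, coinToss]
    have hd := testBit_firstDiff_ne h1
    set p := firstDiff (L x) (L (f x i))
    split_ifs with hy
    · set q := firstDiff (L (f x i)) (L (f (f x i) i))
      intro h
      have h3 := Bool.toNat_le ((L x).testBit p)
      have h4 := Bool.toNat_le ((L (f x i)).testBit q)
      have hpq : p = q := by omega
      rw [← hpq] at h
      have h5 : ((L x).testBit p).toNat = ((L (f x i)).testBit p).toNat := by omega
      apply hd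
      revert h5
      cases (L x).testBit p <;> cases (L (f x i)).testBit p <;> simp
    · intro h
      have h4 := Nat.mod_lt (L (f x i)) (by norm_num : 0 < 2)
      have hp : p = 0 := by omega
      rw [hp] at h hd
      apply hd
      rw [Nat.testBit_zero (L (f x i)), ← h]
      cases (L x).testBit 0 <;> simp

theorem coinLabel_lt {n : ℕ} {f : Fin (2 ^ n) → Fin d → Fin (2 ^ n)} (r : ℕ)
    (hr : ∀ s < r, 6 < labelBound n s) (x : Fin (2 ^ n)) :
    coinLabel f i j r x < labelBound n r := by
  induction r generalizing x with
  | zero => exact x.2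
  | succ r ih =>
    have h6 := hr r (by omega)
    have ih' := ih fun s hs => hr s (by omega)
    have hpow := Nat.le_pow_clog (by norm_num : 1 < 2) (labelBound n r)
    have hclog : 1 ≤ Nat.clog 2 (labelBound n r) := Nat.clog_pos (by norm_num) (by omega)
    simp only [coinLabel, labelBound]
    rw [coinToss]
    split_ifs with h
    · have h1 := firstDiff_lt (coinLabel_ne r x h.1 h.2) ((ih' x).trans_le hpow)
        ((ih' (f x i)).trans_le hpow)
      have := Bool.toNat_le ((coinLabel f i j r x).testBit
        (firstDiff (coinLabel f i j r x) (coinLabel f i j r (f x i))))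
      omega
    · have := Nat.mod_lt (coinLabel f i j r x) (by norm_num : 0 < 2)
      omega

theorem two_mul_clog_lt {B : ℕ} (hB : 6 < B) : 2 * Nat.clog 2 B < B := by
  have h1 : ∀ c, 3 ≤ c → 2 * c + 2 ≤ 2 ^ c := by
    intro c hc
    induction c, hc using Nat.le_induction with
    | base => norm_num
    | succ c hc ih =>
      rw [pow_succ]
      omega
  have h2 : Nat.clog 2 B ≤ (B - 1) / 2 := by
    apply Nat.clog_le_of_le_pow
    have := h1 ((B - 1) / 2) (by omega)
    omega
  omega

/-- The bound on the labels decreases as long as it exceeds `6`. -/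
theorem exists_labelBound_le (n : ℕ) : ∃ r, labelBound n r ≤ 6 := by
  by_contra! h
  have : ∀ r, labelBound n r + r ≤ labelBound n 0 := by
    intro r
    induction r with
    | zero => simp
    | succ r ih =>
      have := two_mul_clog_lt (h r)
      simp only [labelBound] at ih ⊢
      omega
  have h1 := this (labelBound n 0)
  have h2 := h (labelBound n 0)
  omega

theorem coinLabel_lt_six {n : ℕ} (f : Fin (2 ^ n) → Fin d → Fin (2 ^ n)) (x : Fin (2 ^ n)) :
    coinLabel f i j (coinRounds n) x < 6 :=
  (coinLabel_lt (coinRounds n) (fun s hs => by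
    by_contra! h
    exact absurd (Nat.sInf_le (show s ∈ {r | labelBound n r ≤ 6} from h)) (not_le.2 hs)) x).trans_le
    (Nat.sInf_mem (exists_labelBound_le n))

end CoinTossing

section Pattern

variable {n d : ℕ} {f : Fin (2 ^ n) → Fin d → Fin (2 ^ n)}

open Classical in
/-- The pair of positions `(x, y)` and `(y, x)` belongs to the class `c`. -/
def InPattern (f : Fin (2 ^ n) → Fin d → Fin (2 ^ n)) (c : TermIndex d) (x y : Fin (2 ^ n)) :
    Prop :=
  if x ≤ y then InClass f c x y else InClass f c y x

theorem inPattern_comm {c : TermIndex d} {x y : Fin (2 ^ n)} :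
    InPattern f c x y ↔ InPattern f c y x := by
  unfold InPattern
  rcases lt_trichotomy x y with h | rfl | h
  · rw [if_pos h.le, if_neg (not_le.2 h)]
  · rfl
  · rw [if_neg (not_le.2 h), if_pos h.le]

theorem inPattern_of_le {c : TermIndex d} {x y : Fin (2 ^ n)} (h : x ≤ y) :
    InPattern f c x y ↔ InClass f c x y := by
  rw [InPattern, if_pos h]

theorem inPattern_of_lt {c : TermIndex d} {x y : Fin (2 ^ n)} (h : y < x) :
    InPattern f c x y ↔ InClass f c y x := by
  rw [InPattern, if_neg (not_le.2 h)]

/-- The classes are one-sparse. -/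
theorem InPattern.eq {c : TermIndex d} {x y z : Fin (2 ^ n)} (hy : InPattern f c x y)
    (hz : InPattern f c x z) : y = z := by
  unfold InPattern at hy hz
  have key : ∀ y z, y < x → InClass f c y x → InClass f c x z → False := by
    intro y z hyx h1 h2
    have := coinLabel_ne (f := f) (i := c.1) (j := c.2.1) (coinRounds n) y (by rwa [h1.1])
      (by rw [h1.1]; exact h1.2.1)
    rw [h1.1, h1.2.2, h2.2.2] at this
    exact this rfl
  split_ifs at hy hz with h1 h2 h2
  · exact hy.1.symm.trans hz.1
  · exact (key z y (not_le.1 h2) hz hy).elim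
  · exact (key y z (not_le.1 h1) hy hz).elim
  · exact hy.2.1.symm.trans hz.2.1

/-- Each pair whose members occur in each other's lists belongs to exactly one class. -/
theorem existsUnique_inPattern (hf : ∀ x, Function.Injective (f x)) {x y : Fin (2 ^ n)}
    (hxy : ∃ i, f x i = y) (hyx : ∃ i, f y i = x) : ∃! c, InPattern f c x y := by
  wlog h : x ≤ y generalizing x y
  · have := this hyx hxy (le_of_not_ge h)
    simpa only [inPattern_comm (x := x)] using this
  obtain ⟨i, hi⟩ := hxy
  obtain ⟨j, hj⟩ := hyx
  refine ⟨(i, j, ⟨_, coinLabel_lt_six (i := i) (j := j) f x⟩), ?_, ?_⟩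
  · simp only [InPattern, if_pos h]
    exact ⟨hi, hj, rfl⟩
  · rintro ⟨i', j', ν⟩ hc
    simp only [InPattern, if_pos h] at hc
    obtain ⟨h1, h2, h3⟩ := hc
    have e1 : i' = i := hf x (h1.trans hi.symm)
    have e2 : j' = j := hf y (h2.trans hj.symm)
    subst e1 e2
    simp only [Prod.mk.injEq, true_and]
    exact Fin.ext h3.symm

end Pattern

section Norm

variable {N : ℕ}

theorem norm_entry_le (A : Matrix (Fin N) (Fin N) ℂ) (x y : Fin N) : ‖A x y‖ ≤ ‖A‖ := by
  have h := Matrix.l2_opNorm_mulVec A (EuclideanSpace.single y (1 : ℂ))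
  rw [PiLp.norm_single, norm_one, mul_one] at h
  refine le_trans ?_ h
  have := PiLp.norm_apply_le (WithLp.toLp 2 (A *ᵥ (EuclideanSpace.single y (1 : ℂ)).ofLp)) x
  simpa using this

/-- The norm of a matrix with at most one nonzero entry in each row and each column is at most the
largest modulus of an entry. -/
theorem norm_le_of_pattern {A : Matrix (Fin N) (Fin N) ℂ} {R : Fin N → Fin N → Prop} {B : ℝ}
    (hB : 0 ≤ B) (hrow : ∀ x y z, R x y → R x z → y = z) (hcol : ∀ x y z, R x z → R y z → x = y)
    (hA : ∀ x y, ¬ R x y → A x y = 0) (hAB : ∀ x y, ‖A x y‖ ≤ B) : ‖A‖ ≤ B := by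
  rw [Matrix.l2_opNorm_def]
  refine ContinuousLinearMap.opNorm_le_bound _ hB fun v => ?_
  refine le_of_sq_le_sq ?_ (by positivity)
  rw [mul_pow, EuclideanSpace.norm_sq_eq, EuclideanSpace.norm_sq_eq]
  have h1 : ∀ x, ‖∑ y, A x y * v y‖ ^ 2 = ∑ y, ‖A x y‖ ^ 2 * ‖v y‖ ^ 2 := by
    intro x
    by_cases hx : ∃ y, R x y
    · obtain ⟨y, hy⟩ := hx
      have h0 : ∀ z, z ≠ y → A x z = 0 := fun z hz => hA x z fun h => hz (hrow x z y h hy)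
      rw [Finset.sum_eq_single y (fun z _ hz => by rw [h0 z hz, zero_mul]) (by simp),
        Finset.sum_eq_single y (fun z _ hz => by rw [h0 z hz]; simp) (by simp), norm_mul, mul_pow]
    · push Not at hx
      simp [hA x _ (hx _)]
  have h2 : ∀ y, ∑ x, ‖A x y‖ ^ 2 ≤ B ^ 2 := by
    intro y
    by_cases hy : ∃ x, R x y
    · obtain ⟨x, hx⟩ := hy
      rw [Finset.sum_eq_single x (fun z _ hz => by
        rw [hA z y fun h => hz (hcol z x y h hx)]; simp) (by simp)]
      gcongr
      exact hAB x y
    · push Not at hy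
      simp only [hA _ y (hy _)]
      simp
      positivity
  calc _ = ∑ x, ‖∑ y, A x y * v y‖ ^ 2 := by
        refine Finset.sum_congr rfl fun x _ => ?_
        congr 2
    _ = ∑ x, ∑ y, ‖A x y‖ ^ 2 * ‖v y‖ ^ 2 := Finset.sum_congr rfl fun x _ => h1 x
    _ = ∑ y, (∑ x, ‖A x y‖ ^ 2) * ‖v y‖ ^ 2 := by
        rw [Finset.sum_comm]
        simp only [Finset.sum_mul]
    _ ≤ ∑ y, B ^ 2 * ‖v y‖ ^ 2 := by
        gcongr with y
        exact h2 y
    _ = _ := by rw [← Finset.mul_sum]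

end Norm

section Terms

variable {n d : ℕ} {f : Fin (2 ^ n) → Fin d → Fin (2 ^ n)}

open Classical in
/-- The part of a matrix which consists of the entries of the class `c`. -/
def classPart (f : Fin (2 ^ n) → Fin d → Fin (2 ^ n)) (c : TermIndex d) :
    Matrix (Fin (2 ^ n)) (Fin (2 ^ n)) ℂ →ₗ[ℝ] Matrix (Fin (2 ^ n)) (Fin (2 ^ n)) ℂ where
  toFun A := Matrix.of fun x y => if InPattern f c x y then A x y else 0
  map_add' A B := by
    ext x y
    simp only [Matrix.of_apply, Matrix.add_apply]
    split_ifs <;> simp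
  map_smul' s A := by
    ext x y
    simp only [Matrix.of_apply, Matrix.smul_apply, RingHom.id_apply]
    split_ifs <;> simp

open Classical in
theorem classPart_apply (c : TermIndex d) (A : Matrix (Fin (2 ^ n)) (Fin (2 ^ n)) ℂ)
    (x y : Fin (2 ^ n)) : classPart f c A x y = if InPattern f c x y then A x y else 0 := rfl

theorem norm_classPart_le (c : TermIndex d) (A : Matrix (Fin (2 ^ n)) (Fin (2 ^ n)) ℂ) :
    ‖classPart f c A‖ ≤ ‖A‖ := by
  refine norm_le_of_pattern (R := InPattern f c) (norm_nonneg _) (fun x y z => InPattern.eq)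
    (fun x y z h1 h2 => (inPattern_comm.1 h1).eq (inPattern_comm.1 h2)) (fun x y h => ?_)
    fun x y => ?_
  · simp only [classPart, LinearMap.coe_mk, AddHom.coe_mk, Matrix.of_apply, if_neg h]
  · simp only [classPart, LinearMap.coe_mk, AddHom.coe_mk, Matrix.of_apply]
    split_ifs
    · exact norm_entry_le A x y
    · simp

theorem isHermitian_classPart (c : TermIndex d) {A : Matrix (Fin (2 ^ n)) (Fin (2 ^ n)) ℂ}
    (hA : A.IsHermitian) : (classPart f c A).IsHermitian := by
  ext x y
  simp only [classPart, LinearMap.coe_mk, AddHom.coe_mk, Matrix.of_apply,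
    Matrix.conjTranspose_apply]
  rw [inPattern_comm (x := y)]
  split_ifs
  · exact hA.apply x y
  · simp

/-- A Hermitian matrix is the sum of its one-sparse parts, if the lists contain the columns of all
nonzero entries. -/
theorem sum_classPart (hf : ∀ x, Function.Injective (f x))
    {A : Matrix (Fin (2 ^ n)) (Fin (2 ^ n)) ℂ} (hA : A.IsHermitian)
    (hfA : ∀ x y, A x y ≠ 0 → ∃ i, f x i = y) : ∑ c, classPart f c A = A := by
  classical
  ext x y
  simp only [Matrix.sum_apply, classPart, LinearMap.coe_mk, AddHom.coe_mk, Matrix.of_apply]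
  by_cases h : A x y = 0
  · simp [h]
  · have h' : A y x ≠ 0 := by
      rw [← hA.apply y x]
      simpa using h
    obtain ⟨c, hc, hu⟩ := existsUnique_inPattern hf (hfA x y h) (hfA y x h')
    rw [Finset.sum_eq_single c (fun c' _ hc' => if_neg fun h => hc' (hu c' h)) (by simp), if_pos hc]

variable {M nt nH : ℕ} {O : HamOracle n d M nt nH} {Hmax : ℝ} {μ : Fin M} {q : Fin (2 ^ nt)}

theorem isHermitian_oneSparseTerm (c : TermIndex d) : (oneSparseTerm O Hmax μ c q).IsHermitian := by
  ext x y
  simp only [oneSparseTerm, Matrix.conjTranspose_apply, Matrix.of_apply]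
  rcases lt_trichotomy x y with h | rfl | h
  · simp only [if_neg h.ne', if_neg (not_lt.2 h.le), if_neg h.ne, if_pos h]
    split_ifs <;> simp
  · simp only [if_true]
    split_ifs <;> simp
  · simp only [if_neg h.ne', if_neg (not_lt.2 h.le), if_neg h.ne, if_pos h]
    split_ifs <;> simp

/-- The error of a one-sparse term is at most the largest error of an entry. The diagonal entries
are replaced by their real parts, which does not increase their errors. -/
theorem norm_oneSparseTerm_sub_le (c : TermIndex d) {A : Matrix (Fin (2 ^ n)) (Fin (2 ^ n)) ℂ}
    (hA : A.IsHermitian) {η : ℝ} (hη₀ : 0 ≤ η)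
    (hη : ∀ x y, ‖decode Hmax (O.val μ q x y) - A x y‖ ≤ η) :
    ‖oneSparseTerm O Hmax μ c q - classPart (O.col μ) c A‖ ≤ η := by
  have hzero : ∀ x y, ¬ InPattern (O.col μ) c x y →
      (oneSparseTerm O Hmax μ c q - classPart (O.col μ) c A) x y = 0 := by
    intro x y h
    rw [Matrix.sub_apply, classPart_apply, if_neg h, sub_zero, oneSparseTerm, Matrix.of_apply]
    rcases lt_trichotomy x y with hxy | rfl | hxy
    · rw [inPattern_of_le hxy.le] at h
      simp [hxy.ne, hxy, h]
    · rw [inPattern_of_le le_rfl] at h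
      simp [h]
    · rw [inPattern_of_lt hxy] at h
      simp [hxy.ne', not_lt.2 hxy.le, h]
  refine norm_le_of_pattern (R := InPattern (O.col μ) c) hη₀ (fun x y z => InPattern.eq)
    (fun x y z h1 h2 => (inPattern_comm.1 h1).eq (inPattern_comm.1 h2)) hzero fun x y => ?_
  by_cases h : InPattern (O.col μ) c x y
  · rw [Matrix.sub_apply, classPart_apply, oneSparseTerm, Matrix.of_apply, if_pos h]
    rcases lt_trichotomy x y with hxy | rfl | hxy
    · rw [inPattern_of_le hxy.le] at h
      rw [if_neg hxy.ne, if_pos hxy, if_pos h]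
      exact hη x y
    · rw [inPattern_of_le le_rfl] at h
      rw [if_pos rfl, if_pos h]
      have h1 : A x x = ((A x x).re : ℂ) := (Complex.conj_eq_iff_re.1 (hA.apply x x)).symm
      have h2 := Complex.abs_re_le_norm (decode Hmax (O.val μ q x x) - A x x)
      rw [h1, ← Complex.ofReal_sub, Complex.norm_real, Real.norm_eq_abs]
      rw [Complex.sub_re] at h2
      exact h2.trans (hη x x)
    · rw [inPattern_of_lt hxy] at h
      rw [if_neg hxy.ne', if_neg (not_lt.2 hxy.le), if_pos h, ← hA.apply x y, ← star_sub, norm_star]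
      exact hη y x
  · rw [hzero x y h, norm_zero]
    exact hη₀

end Terms

/-! ### Rounding of times and matrix elements -/

/-- The error of a matrix element is the sum of those of its modulus and its phase. -/
theorem norm_decode_sub_le {Hmax : ℝ} {nH : ℕ} {b : Fin nH → Bool} {z : ℂ}
    (h : Encodes Hmax b z) (hz : ‖z‖ ≤ Hmax) :
    ‖decode Hmax b - z‖ ≤ (1 + 2 * Real.pi) * (Hmax / 2 ^ (nH / 2)) := by
  obtain ⟨φ, hφ, h1, h2⟩ := h
  have hexp : ∀ x : ℝ, ‖Complex.exp (Complex.I * (x : ℂ))‖ = 1 := fun x => by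
    rw [mul_comm]
    exact Complex.norm_exp_ofReal_mul_I x
  have e1 : decode Hmax b - z =
      ((modulusOf Hmax b - ‖z‖ : ℝ) : ℂ) * Complex.exp (Complex.I * (phaseOf b : ℂ)) +
        (‖z‖ : ℂ) * (Complex.exp (Complex.I * (φ : ℂ)) *
          (Complex.exp (Complex.I * ((phaseOf b - φ : ℝ) : ℂ)) - 1)) := by
    have e2 : Complex.exp (Complex.I * (φ : ℂ)) *
        Complex.exp (Complex.I * ((phaseOf b - φ : ℝ) : ℂ)) =
        Complex.exp (Complex.I * (phaseOf b : ℂ)) := by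
      rw [← Complex.exp_add]
      congr 1
      push_cast
      ring
    rw [mul_sub, e2, mul_one, mul_sub, ← hφ, decode]
    push_cast
    ring
  rw [e1]
  have h3 : ‖Complex.exp (Complex.I * ((phaseOf b - φ : ℝ) : ℂ)) - 1‖ ≤
      2 * Real.pi / 2 ^ (nH / 2) :=
    (Real.norm_exp_I_mul_ofReal_sub_one_le).trans h2
  calc _ ≤ |modulusOf Hmax b - ‖z‖| * 1 + ‖z‖ * (1 * (2 * Real.pi / 2 ^ (nH / 2))) := by
        refine (norm_add_le _ _).trans (add_le_add ?_ ?_)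
        · rw [norm_mul, hexp, Complex.norm_real, Real.norm_eq_abs]
        · rw [norm_mul, norm_mul, hexp, Complex.norm_real, norm_norm]
          gcongr
    _ ≤ Hmax / 2 ^ (nH / 2) * 1 + Hmax * (1 * (2 * Real.pi / 2 ^ (nH / 2))) := by gcongr
    _ = _ := by ring

/-- The points of the mesh are the centres of the intervals of length `Δt / 2 ^ nt`, so that the
rounding of a time changes it by at most half of this length. -/
theorem meshTime_meshIndex {t₀ Δt : ℝ} (hΔt : 0 < Δt) (nt : ℕ) {τ : ℝ}
    (hτ : τ ∈ Set.Icc t₀ (t₀ + Δt)) :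
    meshTime t₀ Δt nt (meshIndex t₀ Δt nt τ) ∈ Set.Icc t₀ (t₀ + Δt) ∧
      |meshTime t₀ Δt nt (meshIndex t₀ Δt nt τ) - τ| ≤ Δt / (2 * 2 ^ nt) := by
  have hN : (0 : ℝ) < 2 ^ nt := by positivity
  set u := (τ - t₀) * 2 ^ nt / Δt with hu
  have hu0 : 0 ≤ u := by
    have := sub_nonneg.2 hτ.1
    positivity
  have huN : u ≤ 2 ^ nt := by
    rw [hu, div_le_iff₀ hΔt]
    nlinarith [hτ.2]
  have hτu : τ = t₀ + u * Δt / 2 ^ nt := by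
    rw [hu]
    field_simp
    ring
  set q : ℕ := min ⌊u⌋₊ (2 ^ nt - 1) with hq
  have hval : ((meshIndex t₀ Δt nt τ : ℕ) : ℝ) = q := rfl
  have hqN : (q : ℝ) + 1 ≤ 2 ^ nt := by
    have h1 : q ≤ 2 ^ nt - 1 := min_le_right _ _
    have h2 := Nat.two_pow_pos nt
    have h3 : q + 1 ≤ 2 ^ nt := by omega
    exact_mod_cast h3
  have hqu : (q : ℝ) ≤ u := (Nat.cast_le.2 (min_le_left _ _)).trans (Nat.floor_le hu0)
  have huq : u ≤ q + 1 := by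
    rcases min_choice ⌊u⌋₊ (2 ^ nt - 1) with h | h
    · rw [hq, h]
      exact (Nat.lt_floor_add_one u).le
    · have h2 := Nat.two_pow_pos nt
      have h3 : q + 1 = 2 ^ nt := by omega
      have : (q : ℝ) + 1 = 2 ^ nt := by exact_mod_cast h3
      rwa [this]
  have hq0 : (0 : ℝ) ≤ q := Nat.cast_nonneg q
  rw [meshTime, hval]
  refine ⟨⟨?_, ?_⟩, ?_⟩
  · have : 0 ≤ ((q : ℝ) + 1 / 2) * Δt / 2 ^ nt := by positivity
    linarith
  · have : ((q : ℝ) + 1 / 2) * Δt / 2 ^ nt ≤ Δt := by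
      rw [div_le_iff₀ hN]
      nlinarith
    linarith
  · rw [hτu, show t₀ + ((q : ℝ) + 1 / 2) * Δt / 2 ^ nt - (t₀ + u * Δt / 2 ^ nt) =
      ((q : ℝ) + 1 / 2 - u) * (Δt / 2 ^ nt) by ring, abs_mul,
      abs_of_pos (show 0 < Δt / 2 ^ nt by positivity),
      show Δt / (2 * 2 ^ nt) = 1 / 2 * (Δt / 2 ^ nt) by ring]
    refine mul_le_mul_of_nonneg_right ?_ (by positivity)
    rw [abs_le]
    constructor <;> linarith

theorem le_two_pow_of_ceil_logb_le {x : ℝ} (hx : 0 ≤ x) {m : ℕ} (h : ⌈Real.logb 2 x⌉ ≤ (m : ℤ)) :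
    x ≤ 2 ^ m := by
  rcases hx.eq_or_lt with rfl | hx
  · positivity
  · have h1 : Real.logb 2 x ≤ m := (Int.le_ceil _).trans (by exact_mod_cast h)
    rw [Real.logb_le_iff_le_rpow (by norm_num) hx] at h1
    simpa using h1

theorem eight_mul_le_two_pow_of_ceil_logb_le {x : ℝ} (hx : 0 ≤ x) {m : ℕ}
    (h : 2 * ⌈Real.logb 2 x⌉ + 6 ≤ (m : ℤ)) : 8 * x ≤ 2 ^ (m / 2) := by
  rcases hx.eq_or_lt with rfl | hx
  · simp
  · apply le_two_pow_of_ceil_logb_le (by positivity)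
    have h1 : Real.logb 2 (8 * x) = 3 + Real.logb 2 x := by
      rw [Real.logb_mul (by norm_num) hx.ne']
      congr 1
      rw [show (8 : ℝ) = 2 ^ (3 : ℝ) by norm_num, Real.logb_rpow (by norm_num) (by norm_num)]
    rw [h1, add_comm, show (3 : ℝ) = ((3 : ℤ) : ℝ) by norm_num, Int.ceil_add_intCast]
    push_cast
    omega

/-- The total error by the rounding of times and matrix elements in one of the `6 M d²` terms. -/
theorem norm_oneSparseTerm_meshIndex_sub_le {n d M nt nH : ℕ} {t₀ Δt ε Hmax Dmax Θ : ℝ}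
    (hd : 1 ≤ d) (hΔt : 0 < Δt) (hε : 0 < ε) (hΘ : 0 < Θ)
    (hnt : ⌈Real.logb 2 (Dmax * (32 * Θ * M * d ^ 2) * Δt ^ 2 / ε)⌉ ≤ (nt : ℤ))
    (hnH : 2 * ⌈Real.logb 2 (32 * Θ * M * d ^ 2 * Hmax * Δt / ε)⌉ + 6 ≤ (nH : ℤ))
    {H : Fin M → ℝ → Matrix (Fin (2 ^ n)) (Fin (2 ^ n)) ℂ} {O : HamOracle n d M nt nH}
    (hH : ∀ μ, ∀ s ∈ Set.Icc t₀ (t₀ + Δt), (H μ s).IsHermitian)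
    (hdiff : ∀ μ, DifferentiableOn ℝ (H μ) (Set.Icc t₀ (t₀ + Δt)))
    (hHmax : ∀ μ, ∀ s ∈ Set.Icc t₀ (t₀ + Δt), ‖H μ s‖ ≤ Hmax)
    (hDmax : ∀ μ, ∀ s ∈ Set.Icc t₀ (t₀ + Δt),
      ‖derivWithin (H μ) (Set.Icc t₀ (t₀ + Δt)) s‖ ≤ Dmax)
    (hO : O.IsOracleFor Hmax t₀ Δt H) (μ : Fin M) (c : TermIndex d) {τ : ℝ}
    (hτ : τ ∈ Set.Icc t₀ (t₀ + Δt)) :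
    ‖oneSparseTerm O Hmax μ c (meshIndex t₀ Δt nt τ) - classPart (O.col μ) c (H μ τ)‖ ≤
      ε / (Θ * Δt) * (0.265 / (6 * M * d ^ 2)) := by
  obtain ⟨hmem, hdist⟩ := meshTime_meshIndex hΔt nt hτ
  set q := meshIndex t₀ Δt nt τ
  have hD0 : 0 ≤ Dmax := (norm_nonneg _).trans (hDmax μ τ hτ)
  have hH0 : 0 ≤ Hmax := (norm_nonneg _).trans (hHmax μ τ hτ)
  have hM : (0 : ℝ) < M := by exact_mod_cast μ.pos
  have hd' : (0 : ℝ) < d := by exact_mod_cast hd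
  have hπ := Real.pi_lt_d2
  have hπ0 := Real.pi_pos
  have h1 : ‖oneSparseTerm O Hmax μ c q - classPart (O.col μ) c (H μ (meshTime t₀ Δt nt q))‖ ≤
      (1 + 2 * Real.pi) * (Hmax / 2 ^ (nH / 2)) :=
    norm_oneSparseTerm_sub_le c (hH μ _ hmem) (by positivity) fun x y =>
      norm_decode_sub_le (hO.2.2 μ q x y) ((norm_entry_le _ x y).trans (hHmax μ _ hmem))
  have h2 : ‖classPart (O.col μ) c (H μ (meshTime t₀ Δt nt q)) -
      classPart (O.col μ) c (H μ τ)‖ ≤ Dmax * (Δt / (2 * 2 ^ nt)) := by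
    rw [← map_sub]
    refine (norm_classPart_le c _).trans ?_
    refine ((convex_Icc t₀ (t₀ + Δt)).norm_image_sub_le_of_norm_derivWithin_le (hdiff μ) (hDmax μ)
      hτ hmem).trans ?_
    rw [Real.norm_eq_abs]
    gcongr
  have h3 : Hmax / 2 ^ (nH / 2) ≤ ε / (256 * Θ * M * d ^ 2 * Δt) := by
    have := eight_mul_le_two_pow_of_ceil_logb_le (by positivity) hnH
    rw [div_le_div_iff₀ (by positivity) (by positivity)]
    have h4 : 8 * (32 * Θ * M * d ^ 2 * Hmax * Δt / ε) * ε ≤ 2 ^ (nH / 2) * ε := by gcongr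
    have h5 : 8 * (32 * Θ * M * d ^ 2 * Hmax * Δt / ε) * ε =
        Hmax * (256 * Θ * M * d ^ 2 * Δt) := by
      field_simp
      ring
    linarith
  have h4 : Dmax * (Δt / (2 * 2 ^ nt)) ≤ ε / (64 * Θ * M * d ^ 2 * Δt) := by
    have := le_two_pow_of_ceil_logb_le (by positivity) hnt
    rw [mul_div_assoc', div_le_div_iff₀ (by positivity) (by positivity)]
    have h4 : Dmax * (32 * Θ * M * d ^ 2) * Δt ^ 2 / ε * ε ≤ 2 ^ nt * ε := by gcongr
    rw [div_mul_cancel₀ _ hε.ne'] at h4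
    linarith
  -- `1 + 2 π ≤ 7.3`, and `6 (7.3 / 256 + 1 / 64) ≤ 0.265`
  have h5 : (1 + 2 * Real.pi) * (Hmax / 2 ^ (nH / 2)) ≤
      7.3 * (ε / (256 * Θ * M * d ^ 2 * Δt)) := by
    gcongr
    linarith
  have h6 : 7.3 * (ε / (256 * Θ * M * d ^ 2 * Δt)) + ε / (64 * Θ * M * d ^ 2 * Δt) ≤
      ε / (Θ * Δt) * (0.265 / (6 * M * d ^ 2)) := by
    have e1 : 7.3 * (ε / (256 * Θ * M * d ^ 2 * Δt)) + ε / (64 * Θ * M * d ^ 2 * Δt) =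
        (7.3 / 256 + 1 / 64) * (ε / (Θ * Δt * (M * d ^ 2))) := by
      field_simp
    have e2 : ε / (Θ * Δt) * (0.265 / (6 * M * d ^ 2)) =
        (0.265 / 6) * (ε / (Θ * Δt * (M * d ^ 2))) := by
      field_simp
    rw [e1, e2]
    gcongr
    norm_num
  have := norm_sub_le_norm_sub_add_norm_sub (oneSparseTerm O Hmax μ c q)
    (classPart (O.col μ) c (H μ (meshTime t₀ Δt nt q))) (classPart (O.col μ) c (H μ τ))
  linarith

/-! ### Comparison of the product of integrators with the evolution -/

section ListProduct

variable {α β R : Type*} [Monoid R]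

theorem prod_map_product (l : List α) (l' : List β) (f : α × β → R) :
    ((l ×ˢ l').map f).prod = (l.map fun a => (l'.map fun b => f (a, b)).prod).prod := by
  induction l with
  | nil => simp
  | cons a l ih =>
    rw [List.product_cons, List.map_append, List.prod_append, ih, List.map_cons, List.prod_cons,
      List.map_map]
    rfl

theorem prod_map_reverse_product (l : List α) (l' : List β) (f : α × β → R) :
    ((l ×ˢ l').reverse.map f).prod =
      (l.reverse.map fun a => (l'.reverse.map fun b => f (a, b)).prod).prod := by
  induction l with
  | nil => simp
  | cons a l ih =>
    rw [List.product_cons, List.reverse_append, List.map_append, List.prod_append, ih,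
      List.reverse_cons, List.map_append, List.prod_append, ← List.map_reverse, List.map_map]
    simp [Function.comp_def]

end ListProduct

section Evolution

variable {N : ℕ}

instance [NeZero N] : NormOneClass (Matrix (Fin N) (Fin N) ℂ) := ⟨CStarRing.norm_one⟩

/-- The evolution is unitary: `U† U` is constant. -/
theorem IsEvolution.norm_le_one [NeZero N] {H U : ℝ → Matrix (Fin N) (Fin N) ℂ}
    {t₀ Δt : ℝ} (hΔt : 0 < Δt) (hH : ∀ t ∈ Set.Icc t₀ (t₀ + Δt), (H t).IsHermitian)
    (hU : IsEvolution H t₀ Δt U) :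
    ∀ t ∈ Set.Icc t₀ (t₀ + Δt), ‖U t‖ ≤ 1 := by
  have hd : ∀ t ∈ Set.Icc t₀ (t₀ + Δt),
      HasDerivWithinAt (fun t => star (U t) * U t) 0 (Set.Icc t₀ (t₀ + Δt)) t := by
    intro t ht
    have h1 := hU.2 t ht
    have h2 := h1.star.mul h1
    refine h2.congr_deriv ?_
    have h3 : star (H t) = H t := hH t ht
    simp only [star_smul, star_mul, h3]
    simp [mul_assoc]
  have hconst : ∀ t ∈ Set.Icc t₀ (t₀ + Δt), star (U t) * U t = star (U t₀) * U t₀ := by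
    intro t ht
    refine (convex_Icc t₀ (t₀ + Δt)).is_const_of_fderivWithin_eq_zero (𝕜 := ℝ)
      (f := fun t => star (U t) * U t) (fun s hs => (hd s hs).differentiableWithinAt)
      (fun s hs => ?_) ht ⟨le_rfl, by linarith⟩
    have := (hd s hs).hasFDerivWithinAt.fderivWithin
      (uniqueDiffOn_Icc (by linarith : t₀ < t₀ + Δt) s hs)
    rw [this]
    ext
    simp
  intro t ht
  have h1 := hconst t ht
  rw [hU.1, star_one, one_mul] at h1
  have h2 := CStarRing.norm_star_mul_self (x := U t)
  rw [h1, norm_one] at h2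
  nlinarith [norm_nonneg (U t)]

theorem isHermitian_iteratedDerivWithin {H : ℝ → Matrix (Fin N) (Fin N) ℂ} {a b : ℝ}
    (hH : ∀ t ∈ Set.Icc a b, (H t).IsHermitian) (p : ℕ) :
    ∀ t ∈ Set.Icc a b, (iteratedDerivWithin p H (Set.Icc a b) t).IsHermitian := by
  induction p with
  | zero => simpa using hH
  | succ p ih =>
    intro t ht
    rw [iteratedDerivWithin_succ]
    have h1 : derivWithin (fun s => star (iteratedDerivWithin p H (Set.Icc a b) s)) (Set.Icc a b) t
        = derivWithin (iteratedDerivWithin p H (Set.Icc a b)) (Set.Icc a b) t :=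
      derivWithin_congr (fun s hs => ih s hs) (ih t ht)
    rw [derivWithin.star] at h1
    exact h1

end Evolution

section Generators

variable {n d M nt nH : ℕ}

/-- The contribution to the generator `-i H` of a class `c` of entries of a matrix: this part of the
matrix, transformed to the original basis, times `-i`. -/
def termGen (T : Matrix.unitaryGroup (Fin (2 ^ n)) ℂ) (f : Fin (2 ^ n) → Fin d → Fin (2 ^ n))
    (c : TermIndex d) :
    Matrix (Fin (2 ^ n)) (Fin (2 ^ n)) ℂ →ₗ[ℝ] Matrix (Fin (2 ^ n)) (Fin (2 ^ n)) ℂ where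
  toFun A := (-Complex.I) • ((T : Matrix (Fin (2 ^ n)) (Fin (2 ^ n)) ℂ)ᴴ * classPart f c A *
    (T : Matrix (Fin (2 ^ n)) (Fin (2 ^ n)) ℂ))
  map_add' A B := by
    rw [map_add, mul_add, add_mul, smul_add]
  map_smul' s A := by
    rw [map_smul, mul_smul_comm, smul_mul_assoc, RingHom.id_apply, smul_comm]

variable {T : Matrix.unitaryGroup (Fin (2 ^ n)) ℂ} {f : Fin (2 ^ n) → Fin d → Fin (2 ^ n)}
  {c : TermIndex d}

theorem norm_conj_le (A : Matrix (Fin (2 ^ n)) (Fin (2 ^ n)) ℂ) :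
    ‖(-Complex.I) • ((T : Matrix (Fin (2 ^ n)) (Fin (2 ^ n)) ℂ)ᴴ * A *
      (T : Matrix (Fin (2 ^ n)) (Fin (2 ^ n)) ℂ))‖ ≤ ‖A‖ := by
  have h1 : ‖(T : Matrix (Fin (2 ^ n)) (Fin (2 ^ n)) ℂ)‖ = 1 := CStarRing.norm_coe_unitary T
  rw [norm_smul, norm_neg, Complex.norm_I, one_mul]
  refine norm_mul₃_le.trans ?_
  rw [Matrix.l2_opNorm_conjTranspose, h1]
  simp

theorem conj_mem_skewAdjoint {A : Matrix (Fin (2 ^ n)) (Fin (2 ^ n)) ℂ} (hA : A.IsHermitian) :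
    (-Complex.I) • ((T : Matrix (Fin (2 ^ n)) (Fin (2 ^ n)) ℂ)ᴴ * A *
      (T : Matrix (Fin (2 ^ n)) (Fin (2 ^ n)) ℂ)) ∈
      skewAdjoint (Matrix (Fin (2 ^ n)) (Fin (2 ^ n)) ℂ) := by
  rw [skewAdjoint.mem_iff, star_smul]
  have : star ((T : Matrix (Fin (2 ^ n)) (Fin (2 ^ n)) ℂ)ᴴ * A *
      (T : Matrix (Fin (2 ^ n)) (Fin (2 ^ n)) ℂ)) =
      (T : Matrix (Fin (2 ^ n)) (Fin (2 ^ n)) ℂ)ᴴ * A *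
      (T : Matrix (Fin (2 ^ n)) (Fin (2 ^ n)) ℂ) :=
    Matrix.isHermitian_conjTranspose_mul_mul _ hA
  rw [this]
  simp

theorem norm_termGen_le (A : Matrix (Fin (2 ^ n)) (Fin (2 ^ n)) ℂ) : ‖termGen T f c A‖ ≤ ‖A‖ :=
  (norm_conj_le _).trans (norm_classPart_le c A)

theorem exp_conj_unitary (s : ℝ) (A : Matrix (Fin (2 ^ n)) (Fin (2 ^ n)) ℂ) :
    NormedSpace.exp (s • ((-Complex.I) • ((T : Matrix (Fin (2 ^ n)) (Fin (2 ^ n)) ℂ)ᴴ * A *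
      (T : Matrix (Fin (2 ^ n)) (Fin (2 ^ n)) ℂ)))) =
    (T : Matrix (Fin (2 ^ n)) (Fin (2 ^ n)) ℂ)ᴴ *
      NormedSpace.exp ((-Complex.I * (s : ℂ)) • A) *
      (T : Matrix (Fin (2 ^ n)) (Fin (2 ^ n)) ℂ) := by
  have h1 : (T : Matrix (Fin (2 ^ n)) (Fin (2 ^ n)) ℂ)⁻¹ =
      (T : Matrix (Fin (2 ^ n)) (Fin (2 ^ n)) ℂ)ᴴ :=
    Matrix.inv_eq_left_inv (Unitary.coe_star_mul_self T)
  have h2 : IsUnit (T : Matrix (Fin (2 ^ n)) (Fin (2 ^ n)) ℂ) :=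
    ⟨Unitary.toUnits T, rfl⟩
  rw [← h1, ← Matrix.exp_conj' _ _ h2, h1]
  congr 1
  rw [mul_smul_comm, smul_mul_assoc, ← Complex.coe_smul, smul_smul, mul_comm]

/-- The first integrator as a symmetric product over all pairs of a matrix `H_μ` and a class. -/
theorem integratorOne_eq_strangBlock (O : HamOracle n d M nt nH)
    (T : Fin M → Matrix.unitaryGroup (Fin (2 ^ n)) ℂ) (Hmax t₀ Δt b a : ℝ) :
    integratorOne O T Hmax t₀ Δt b a =
      strangBlock (List.finRange M ×ˢ termList d) (fun j t =>
        (-Complex.I) • ((T j.1 : Matrix (Fin (2 ^ n)) (Fin (2 ^ n)) ℂ)ᴴ *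
          oneSparseTerm O Hmax j.1 j.2 (meshIndex t₀ Δt nt t) *
          (T j.1 : Matrix (Fin (2 ^ n)) (Fin (2 ^ n)) ℂ))) b a := by
  have key : ∀ (μ : Fin M) (l : List (TermIndex d)) (E : TermIndex d → _),
      (l.map fun c => (T μ : Matrix (Fin (2 ^ n)) (Fin (2 ^ n)) ℂ)ᴴ * E c *
        (T μ : Matrix (Fin (2 ^ n)) (Fin (2 ^ n)) ℂ)).prod =
      (T μ : Matrix (Fin (2 ^ n)) (Fin (2 ^ n)) ℂ)ᴴ * (l.map E).prod *
        (T μ : Matrix (Fin (2 ^ n)) (Fin (2 ^ n)) ℂ) := by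
    intro μ l E
    have h1 : (T μ : Matrix (Fin (2 ^ n)) (Fin (2 ^ n)) ℂ)ᴴ *
        (T μ : Matrix (Fin (2 ^ n)) (Fin (2 ^ n)) ℂ) = 1 := Unitary.coe_star_mul_self (T μ)
    have h2 : (T μ : Matrix (Fin (2 ^ n)) (Fin (2 ^ n)) ℂ) *
        (T μ : Matrix (Fin (2 ^ n)) (Fin (2 ^ n)) ℂ)ᴴ = 1 := Unitary.coe_mul_star_self (T μ)
    induction l with
    | nil => simp [h1]
    | cons c l ih =>
      rw [List.map_cons, List.prod_cons, ih, List.map_cons, List.prod_cons]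
      simp only [mul_assoc]
      rw [← mul_assoc (T μ : Matrix (Fin (2 ^ n)) (Fin (2 ^ n)) ℂ)
        (T μ : Matrix (Fin (2 ^ n)) (Fin (2 ^ n)) ℂ)ᴴ, h2, one_mul]
  rw [strangBlock, prod_map_product, prod_map_reverse_product, integratorOne]
  simp only [exp_conj_unitary, key, oneSparseExp]

theorem nodup_termList (d : ℕ) : (termList d).Nodup :=
  (List.nodup_finRange d).product ((List.nodup_finRange d).product (List.nodup_finRange 6))

theorem mem_termList (c : TermIndex d) : c ∈ termList d := by
  obtain ⟨i, j, ν⟩ := c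
  simp [termList]

theorem integratorProduct_succ (O : HamOracle n d M nt nH)
    (T : Fin M → Matrix.unitaryGroup (Fin (2 ^ n)) ℂ) (Hmax t₀ Δt : ℝ) (k : ℕ) (t : ℕ → ℝ) (r : ℕ) :
    integratorProduct O T Hmax t₀ Δt k t (r + 1) =
      integrator O T Hmax t₀ Δt k (t (r + 1)) (t r) *
        integratorProduct O T Hmax t₀ Δt k t r := by
  simp [integratorProduct, List.range_succ]

end Generators

section Error

variable {n d M nt nH : ℕ}

theorem isHermitian_totalHamiltonian {N : ℕ} {H : Fin M → ℝ → Matrix (Fin N) (Fin N) ℂ}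
    {T : Fin M → Matrix.unitaryGroup (Fin N) ℂ} {t : ℝ} (hH : ∀ μ, (H μ t).IsHermitian) :
    (totalHamiltonian H T t).IsHermitian := by
  rw [Matrix.IsHermitian, totalHamiltonian, Matrix.conjTranspose_sum]
  exact Finset.sum_congr rfl fun μ _ => Matrix.isHermitian_conjTranspose_mul_mul _ (hH μ)

/-- The error of one integrator on a step `[a, b]` of length `h`. Here `σ` is such that
`Υ h ≤ σ / (24 d² Θ)` on the step, so that the rescaled generators have size at most
`σ / (4 Θ h)`, and `η` bounds the total rounding error. -/
theorem norm_sub_integrator_le {m : ℕ} {t₀ Δt Hmax σ Θ η : ℝ} {Υ : ℝ → ℝ} (hd : 1 ≤ d)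
    (hΔt : 0 < Δt) (hΘ : suzukiWeight m ≤ Θ) (hΘ₁ : 1 ≤ Θ) (hσ₀ : 0 < σ) (hσ₁ : σ ≤ 1)
    (hΥ₀ : ∀ t ∈ Set.Icc t₀ (t₀ + Δt), 0 ≤ Υ t)
    {H : Fin M → ℝ → Matrix (Fin (2 ^ n)) (Fin (2 ^ n)) ℂ}
    {T : Fin M → Matrix.unitaryGroup (Fin (2 ^ n)) ℂ} {O : HamOracle n d M nt nH}
    (hH : ∀ μ, ∀ s ∈ Set.Icc t₀ (t₀ + Δt), (H μ s).IsHermitian)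
    (hsm : IsPointwiseSmoothOn H Υ (2 * m + 2) (Set.Icc t₀ (t₀ + Δt)))
    (hO : O.IsOracleFor Hmax t₀ Δt H)
    (hη : ∀ s ∈ Set.Icc t₀ (t₀ + Δt), ∑ j : Fin M × TermIndex d,
      ‖oneSparseTerm O Hmax j.1 j.2 (meshIndex t₀ Δt nt s) -
        classPart (O.col j.1) j.2 (H j.1 s)‖ ≤ η)
    {U : ℝ → Matrix (Fin (2 ^ n)) (Fin (2 ^ n)) ℂ}
    (hU : IsEvolution (totalHamiltonian H T) t₀ Δt U) {a b : ℝ} (hab : a < b)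
    (ha : t₀ ≤ a) (hb : b ≤ t₀ + Δt)
    (hΥσ : ∀ s ∈ Set.Icc a b, Υ s * (b - a) * (24 * d ^ 2 * Θ / σ) ≤ 1) :
    ‖integrator O T Hmax t₀ Δt (m + 1) b a‖ ≤ 1 ∧
    ‖U b - integrator O T Hmax t₀ Δt (m + 1) b a * U a‖ ≤
      (2 / 3 + 1 / 64) * σ ^ (2 * m + 3) + Θ * (b - a) * η := by
  set S := Set.Icc t₀ (t₀ + Δt) with hS
  have hsub : Set.Icc a b ⊆ S := Set.Icc_subset_Icc ha hb
  have hd' : (1 : ℝ) ≤ d := by exact_mod_cast hd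
  have hh : 0 < b - a := sub_pos.2 hab
  set l := List.finRange M ×ˢ termList d with hl
  have hnd : l.Nodup := (List.nodup_finRange M).product (nodup_termList d)
  have hmem : ∀ j, j ∈ l := fun j => by
    obtain ⟨μ, c⟩ := j
    exact List.mem_product.2 ⟨List.mem_finRange μ, mem_termList c⟩
  set Λ := σ / (4 * Θ * (b - a)) with hΛ
  have hΛ0 : 0 < Λ := by positivity
  have hΛh : 4 * Θ * (Λ * (b - a)) = σ := by
    rw [hΛ]
    field_simp
  set G : Fin M × TermIndex d → ℕ → ℝ → Matrix (Fin (2 ^ n)) (Fin (2 ^ n)) ℂ := fun j p t =>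
    termGen (T j.1) (O.col j.1) j.2 (iteratedDerivWithin p (H j.1) S t) with hG
  set B : Fin M × TermIndex d → ℝ → Matrix (Fin (2 ^ n)) (Fin (2 ^ n)) ℂ := fun j t =>
    (-Complex.I) • ((T j.1 : Matrix (Fin (2 ^ n)) (Fin (2 ^ n)) ℂ)ᴴ *
          oneSparseTerm O Hmax j.1 j.2 (meshIndex t₀ Δt nt t) *
          (T j.1 : Matrix (Fin (2 ^ n)) (Fin (2 ^ n)) ℂ)) with hB
  have hBskew : ∀ j t, B j t ∈ skewAdjoint (Matrix (Fin (2 ^ n)) (Fin (2 ^ n)) ℂ) := fun j t =>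
    conj_mem_skewAdjoint (isHermitian_oneSparseTerm j.2)
  have hint : integrator O T Hmax t₀ Δt (m + 1) b a = suzuki (strangBlock l B) m b a := by
    have : integratorOne O T Hmax t₀ Δt = strangBlock l B := by
      funext b a
      exact integratorOne_eq_strangBlock O T Hmax t₀ Δt b a
    rw [integrator, this, Nat.add_sub_cancel]
  rw [hint]
  have haI : a ∈ Set.Icc a b := ⟨le_rfl, hab.le⟩
  have hbI : b ∈ Set.Icc a b := ⟨hab.le, le_rfl⟩
  refine ⟨(norm_suzuki_sub_le (l := l) (B := B) (B' := B) (convex_Icc a b)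
    (fun j t _ => hBskew j t) (fun j t _ => hBskew j t) (η := 0)
    (fun t _ => by simp) m hbI haI).1, ?_⟩
  -- the total size of the generators and their derivatives
  have hGΛ : ∀ p ≤ 2 * m + 2, ∀ t ∈ Set.Icc a b, ∑ j, ‖G j p t‖ ≤ Λ ^ (p + 1) := by
    intro p hp t ht
    have hsum : ∑ μ, ‖iteratedDerivWithin p (H μ) S t‖ ≤ Υ t ^ (p + 1) := by
      have h1 := hsm.2 t (hsub ht) p hp
      have h0 : 0 ≤ ∑ μ, ‖iteratedDerivWithin p (H μ) S t‖ :=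
        Finset.sum_nonneg fun _ _ => norm_nonneg _
      have hp0 : (p : ℝ) + 1 ≠ 0 := by positivity
      have h2 : ((∑ μ, ‖iteratedDerivWithin p (H μ) S t‖) ^ (1 / ((p : ℝ) + 1))) ^ (p + 1) =
          ∑ μ, ‖iteratedDerivWithin p (H μ) S t‖ := by
        rw [← Real.rpow_natCast, ← Real.rpow_mul h0]
        push_cast
        rw [one_div_mul_cancel hp0, Real.rpow_one]
      rw [← h2]
      exact pow_le_pow_left₀ (by positivity) h1 _
    have hΥt := hΥ₀ t (hsub ht)
    have h6 : (1 : ℝ) ≤ 6 * d ^ 2 := by nlinarith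
    have hle : 6 * d ^ 2 * Υ t ≤ Λ := by
      rw [hΛ, le_div_iff₀ (by positivity)]
      have h1 := hΥσ t ht
      rw [mul_div_assoc', div_le_one hσ₀] at h1
      linarith
    calc ∑ j, ‖G j p t‖ ≤ ∑ j : Fin M × TermIndex d, ‖iteratedDerivWithin p (H j.1) S t‖ :=
          Finset.sum_le_sum fun j _ => norm_termGen_le _
      _ = 6 * d ^ 2 * ∑ μ, ‖iteratedDerivWithin p (H μ) S t‖ := by
          rw [Fintype.sum_prod_type]
          simp only [Finset.sum_const, Finset.card_univ, Fintype.card_prod, Fintype.card_fin,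
            nsmul_eq_mul, ← Finset.mul_sum]
          push_cast
          ring
      _ ≤ 6 * d ^ 2 * Υ t ^ (p + 1) := by gcongr
      _ ≤ (6 * d ^ 2) ^ (p + 1) * Υ t ^ (p + 1) := by
          gcongr
          exact le_self_pow₀ h6 (by omega)
      _ = (6 * d ^ 2 * Υ t) ^ (p + 1) := (mul_pow _ _ _).symm
      _ ≤ _ := by gcongr
  have hGder : ∀ j, ∀ p < 2 * m + 2, ∀ t ∈ Set.Icc a b,
      HasDerivWithinAt (G j p) (G j (p + 1) t) (Set.Icc a b) t := by
    intro j p hp t ht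
    have h1 : HasDerivWithinAt (iteratedDerivWithin p (H j.1) S)
        (iteratedDerivWithin (p + 1) (H j.1) S t) S t := by
      rw [iteratedDerivWithin_succ]
      exact (hsm.1 j.1 p hp t (hsub ht)).hasDerivWithinAt
    exact ((LinearMap.toContinuousLinearMap
      (termGen (T j.1) (O.col j.1) j.2)).hasFDerivAt.comp_hasDerivWithinAt t h1).mono hsub
  have hGskew : ∀ j, ∀ p < 2 * m + 2, ∀ t ∈ Set.Icc a b,
      G j p t ∈ skewAdjoint (Matrix (Fin (2 ^ n)) (Fin (2 ^ n)) ℂ) := fun j p _ t ht =>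
    conj_mem_skewAdjoint (isHermitian_classPart j.2
      (isHermitian_iteratedDerivWithin (hH j.1) p t (hsub ht)))
  have hG0 : ∀ j t, G j 0 t = termGen (T j.1) (O.col j.1) j.2 (H j.1 t) := fun j t => by
    simp only [hG, iteratedDerivWithin_zero]
  have hηG : ∀ t ∈ Set.Icc a b, ∑ j, ‖G j 0 t - B j t‖ ≤ η := by
    intro t ht
    refine le_trans (Finset.sum_le_sum fun j _ => ?_) (hη t (hsub ht))
    have : G j 0 t - B j t = (-Complex.I) • ((T j.1 : Matrix (Fin (2 ^ n)) (Fin (2 ^ n)) ℂ)ᴴ *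
        (classPart (O.col j.1) j.2 (H j.1 t) -
          oneSparseTerm O Hmax j.1 j.2 (meshIndex t₀ Δt nt t)) *
          (T j.1 : Matrix (Fin (2 ^ n)) (Fin (2 ^ n)) ℂ)) := by
      rw [hG0, mul_sub, sub_mul, smul_sub]
      rfl
    rw [this, norm_sub_rev]
    exact norm_conj_le _
  have hsumG : ∀ t ∈ S, ∑ j, G j 0 t = (-Complex.I) • totalHamiltonian H T t := by
    intro t ht
    simp only [hG0]
    rw [Fintype.sum_prod_type, totalHamiltonian, Finset.smul_sum]
    refine Finset.sum_congr rfl fun μ _ => ?_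
    have h1 := sum_classPart (f := O.col μ) (hO.1 μ) (hH μ t ht)
      (fun x y hxy => hO.2.1 μ x y ⟨t, ht, hxy⟩)
    conv_rhs => rw [← h1]
    rw [Finset.mul_sum, Finset.sum_mul, Finset.smul_sum]
    rfl
  have hV : ∀ t ∈ Set.Icc a b, HasDerivWithinAt U ((∑ j, G j 0 t) * U t) (Set.Icc a b) t := by
    intro t ht
    rw [hsumG t (hsub ht), smul_mul_assoc]
    exact (hU.2 t (hsub ht)).mono hsub
  have hV₁ : ∀ t ∈ Set.Icc a b, ‖U t‖ ≤ 1 := fun t ht =>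
    hU.norm_le_one hΔt (fun s hs => isHermitian_totalHamiltonian fun μ => hH μ s hs) t (hsub ht)
  have := norm_sub_suzuki_le hnd hmem hab.le hΛ0 hΘ hΘ₁ (hΛh.trans_le hσ₁) hGder hGskew hGΛ
    (S := B) (fun j t _ => hBskew j t) hηG hV hV₁
  rwa [hΛh] at this

/-- The errors of the steps add up. -/
theorem norm_sub_integratorProduct_le {k r : ℕ} {t₀ Δt Hmax e₁ e₂ : ℝ}
    {T : Fin M → Matrix.unitaryGroup (Fin (2 ^ n)) ℂ} {O : HamOracle n d M nt nH}
    {U : ℝ → Matrix (Fin (2 ^ n)) (Fin (2 ^ n)) ℂ} {t : ℕ → ℝ} (hU : U (t 0) = 1)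
    (h₁ : ∀ p < r, ‖integrator O T Hmax t₀ Δt k (t (p + 1)) (t p)‖ ≤ 1)
    (h₂ : ∀ p < r, ‖U (t (p + 1)) - integrator O T Hmax t₀ Δt k (t (p + 1)) (t p) * U (t p)‖ ≤
      e₁ + (t (p + 1) - t p) * e₂) :
    ‖U (t r) - integratorProduct O T Hmax t₀ Δt k t r‖ ≤ r * e₁ + (t r - t 0) * e₂ := by
  induction r with
  | zero => simp [integratorProduct, hU]
  | succ r ih =>
    have ih' := ih (fun p hp => h₁ p (by omega)) fun p hp => h₂ p (by omega)
    have h3 := h₁ r (by omega)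
    have h4 := h₂ r (by omega)
    rw [integratorProduct_succ]
    set W := integrator O T Hmax t₀ Δt k (t (r + 1)) (t r)
    set Q := integratorProduct O T Hmax t₀ Δt k t r
    have h5 : U (t (r + 1)) - W * Q = (U (t (r + 1)) - W * U (t r)) + W * (U (t r) - Q) := by
      noncomm_ring
    have h6 : ‖W * (U (t r) - Q)‖ ≤ ‖U (t r) - Q‖ :=
      (norm_mul_le _ _).trans (mul_le_of_le_one_left (norm_nonneg _) h3)
    rw [h5]
    refine (norm_add_le _ _).trans ?_
    push_cast
    linarith

/-- The error of the product of the integrators, when `Υ h Y ≤ 1` on each step of length `h`. With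
`σ = (ε / r_g) ^ (1 / (2 k + 1))`, each of the at most `r_g` steps contributes
`(2 / 3 + 1 / 64) ε / r_g`, and the rounding errors contribute `0.265 ε` in total. -/
theorem norm_evolution_sub_integratorProduct_le {m rg r : ℕ} {t₀ Δt ε Hmax Dmax : ℝ} {Υ : ℝ → ℝ}
    (hd : 1 ≤ d) (hΔt : 0 < Δt) (hε₀ : 0 < ε) (hε₁ : ε ≤ 1)
    (hΥ₀ : ∀ t ∈ Set.Icc t₀ (t₀ + Δt), 0 ≤ Υ t)
    (hnt : ⌈Real.logb 2 (Dmax * (32 * ((m + 1 : ℝ) * (5 / 3) ^ m) * M * d ^ 2) * Δt ^ 2 / ε)⌉ ≤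
      (nt : ℤ))
    (hnH : 2 * ⌈Real.logb 2 (32 * ((m + 1 : ℝ) * (5 / 3) ^ m) * M * d ^ 2 * Hmax * Δt / ε)⌉ + 6 ≤
      (nH : ℤ))
    {H : Fin M → ℝ → Matrix (Fin (2 ^ n)) (Fin (2 ^ n)) ℂ}
    {T : Fin M → Matrix.unitaryGroup (Fin (2 ^ n)) ℂ} {O : HamOracle n d M nt nH}
    (hH : ∀ μ, ∀ s ∈ Set.Icc t₀ (t₀ + Δt), (H μ s).IsHermitian)
    (hsm : IsPointwiseSmoothOn H Υ (2 * m + 2) (Set.Icc t₀ (t₀ + Δt)))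
    (hHmax : ∀ μ, ∀ s ∈ Set.Icc t₀ (t₀ + Δt), ‖H μ s‖ ≤ Hmax)
    (hDmax : ∀ μ, ∀ s ∈ Set.Icc t₀ (t₀ + Δt),
      ‖derivWithin (H μ) (Set.Icc t₀ (t₀ + Δt)) s‖ ≤ Dmax)
    (hO : O.IsOracleFor Hmax t₀ Δt H)
    {U : ℝ → Matrix (Fin (2 ^ n)) (Fin (2 ^ n)) ℂ}
    (hU : IsEvolution (totalHamiltonian H T) t₀ Δt U)
    (hr : r ≤ rg) (hrg : 1 ≤ rg) {t : ℕ → ℝ} (ht₀ : t 0 = t₀) (htr : t r = t₀ + Δt)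
    (hlt : ∀ p < r, t p < t (p + 1)) (hmem : ∀ p ≤ r, t p ∈ Set.Icc t₀ (t₀ + Δt))
    (hstep : ∀ p < r, ∀ s ∈ Set.Icc (t p) (t (p + 1)),
      Υ s * (t (p + 1) - t p) * stepConst d (m + 1) ε rg ≤ 1) :
    ‖U (t₀ + Δt) - integratorProduct O T Hmax t₀ Δt (m + 1) t r‖ ≤ ε := by
  set Θ : ℝ := (m + 1 : ℝ) * (5 / 3) ^ m with hΘ
  have hΘ₁ : 1 ≤ Θ := by
    have h1 : (1 : ℝ) ≤ (5 / 3) ^ m := one_le_pow₀ (by norm_num)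
    have h2 : (0 : ℝ) ≤ m := Nat.cast_nonneg m
    rw [hΘ]
    nlinarith
  have hrg' : (1 : ℝ) ≤ rg := by exact_mod_cast hrg
  set σ : ℝ := (ε / rg) ^ (1 / (2 * ((m + 1 : ℕ) : ℝ) + 1)) with hσ
  have hσ₀ : 0 < σ := by positivity
  have hσ₁ : σ ≤ 1 := Real.rpow_le_one (by positivity)
    ((div_le_one (by positivity)).2 (hε₁.trans hrg')) (by positivity)
  have hσpow : σ ^ (2 * m + 3) = ε / rg := by
    rw [hσ, ← Real.rpow_natCast, ← Real.rpow_mul (by positivity)]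
    have : 1 / (2 * ((m + 1 : ℕ) : ℝ) + 1) * ((2 * m + 3 : ℕ) : ℝ) = 1 := by
      push_cast
      field_simp
      ring
    rw [this, Real.rpow_one]
  have hconst : stepConst d (m + 1) ε rg = 24 * d ^ 2 * Θ / σ := by
    rw [stepConst, ← hσ, hΘ, Nat.add_sub_cancel]
    push_cast
    ring
  have hdiff : ∀ μ, DifferentiableOn ℝ (H μ) (Set.Icc t₀ (t₀ + Δt)) := fun μ => by
    simpa using hsm.1 μ 0 (by omega)
  have hη : ∀ s ∈ Set.Icc t₀ (t₀ + Δt), ∑ j : Fin M × TermIndex d,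
      ‖oneSparseTerm O Hmax j.1 j.2 (meshIndex t₀ Δt nt s) -
        classPart (O.col j.1) j.2 (H j.1 s)‖ ≤ 0.265 * (ε / (Θ * Δt)) := by
    intro s hs
    refine (Finset.sum_le_sum fun j _ => norm_oneSparseTerm_meshIndex_sub_le hd hΔt hε₀
      (by linarith) hnt hnH hH hdiff hHmax hDmax hO j.1 j.2 hs).trans ?_
    rw [Finset.sum_const, Finset.card_univ, nsmul_eq_mul]
    simp only [Fintype.card_prod, Fintype.card_fin]
    rcases Nat.eq_zero_or_pos M with rfl | hM
    · simp
      positivity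
    · have hM' : (0 : ℝ) < M := by exact_mod_cast hM
      have hd' : (0 : ℝ) < d := by exact_mod_cast hd
      push_cast
      apply le_of_eq
      field_simp
  have hmain : ∀ p < r, _ := fun p hp => norm_sub_integrator_le (m := m) (Θ := Θ) (σ := σ) hd hΔt
    (suzukiWeight_le m) hΘ₁ hσ₀ hσ₁ hΥ₀ hH hsm hO hη hU (hlt p hp) (hmem p hp.le).1
    (hmem (p + 1) hp).2 (by rw [← hconst]; exact hstep p hp)
  have hfin := norm_sub_integratorProduct_le (k := m + 1) (r := r) (t := t)
    (e₁ := (2 / 3 + 1 / 64) * (ε / rg)) (e₂ := 0.265 * (ε / Δt)) (by rw [ht₀]; exact hU.1)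
    (fun p hp => (hmain p hp).1) (fun p hp => (hmain p hp).2.trans (le_of_eq (by
      rw [hσpow]
      field_simp)))
  rw [htr, ht₀, add_sub_cancel_left] at hfin
  refine hfin.trans ?_
  have h1 : (r : ℝ) * ((2 / 3 + 1 / 64) * (ε / rg)) ≤ (2 / 3 + 1 / 64) * ε := by
    have h2 : (r : ℝ) ≤ rg := by exact_mod_cast hr
    calc (r : ℝ) * ((2 / 3 + 1 / 64) * (ε / rg)) ≤ rg * ((2 / 3 + 1 / 64) * (ε / rg)) := by gcongr
      _ = _ := by field_simp
  have h2 : Δt * (0.265 * (ε / Δt)) = 0.265 * ε := by field_simp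
  rw [h2]
  linarith

end Error

/-! ### Circuits for one-sparse exponentials -/

section Circuits

variable {n d M nt nH a : ℕ} {O : HamOracle n d M nt nH}
  {T : Fin M → Matrix.unitaryGroup (Fin (2 ^ n)) ℂ}

theorem Circuit.op_nil : Circuit.op O T ([] : Circuit n d M nt nH a) = 1 := rfl

theorem Circuit.op_append (g g' : Circuit n d M nt nH a) :
    Circuit.op O T (g ++ g') = Circuit.op O T g' * Circuit.op O T g := by
  simp [Circuit.op]

theorem Circuit.op_cons (G : Gate n d M nt nH a) (g : Circuit n d M nt nH a) :
    Circuit.op O T (G :: g) = Circuit.op O T g * Gate.op O T G := by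
  simp [Circuit.op]

theorem Circuit.queries_append (g g' : Circuit n d M nt nH a) :
    Circuit.queries (g ++ g') = Circuit.queries g + Circuit.queries g' := by
  simp [Circuit.queries]

theorem Circuit.basisCalls_append (g g' : Circuit n d M nt nH a) :
    Circuit.basisCalls (g ++ g') = Circuit.basisCalls g + Circuit.basisCalls g' := by
  simp [Circuit.basisCalls]

theorem xorMatrix_mulVec (g : Fin (2 ^ n) → Fin (2 ^ n) → Bool) (v : CompBasis n a → ℂ) :
    xorMatrix g *ᵥ v = fun s => v (s.1, s.2.1, xor s.2.2.1 (g s.1 s.2.1), s.2.2.2) := by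
  funext s
  simp only [xorMatrix, Matrix.mulVec, dotProduct, Matrix.of_apply]
  rw [Finset.sum_eq_single (s.1, s.2.1, xor s.2.2.1 (g s.1 s.2.1), s.2.2.2)]
  · simp
  · rintro ⟨x, y, b, w⟩ - hs
    rw [if_neg, zero_mul]
    rintro rfl
    apply hs
    simp
  · simp

theorem xorMatrix_mul_self (g : Fin (2 ^ n) → Fin (2 ^ n) → Bool) :
    xorMatrix (a := a) g * xorMatrix g = 1 := by
  refine Matrix.toLin'.injective (LinearMap.ext fun v => ?_)
  rw [Matrix.toLin'_apply, Matrix.toLin'_apply, ← Matrix.mulVec_mulVec, xorMatrix_mulVec,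
    xorMatrix_mulVec, Matrix.one_mulVec]
  simp

/-- The gate which undoes a gate. -/
def Gate.inv : Gate n d M nt nH a → Gate n d M nt nH a
  | .free V => .free V⁻¹
  | .queryCol p i μ => .queryCol p i μ
  | .queryVal p μ q => .queryVal p μ q
  | .basisChange μ => .basisChangeAdj μ
  | .basisChangeAdj μ => .basisChange μ

theorem Gate.op_inv_mul (G : Gate n d M nt nH a) : Gate.op O T G.inv * Gate.op O T G = 1 := by
  cases G with
  | free V => exact Unitary.coe_star_mul_self V
  | queryCol p i μ => exact xorMatrix_mul_self _
  | queryVal p μ q => exact xorMatrix_mul_self _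
  | basisChange μ =>
    simp only [Gate.inv, Gate.op]
    rw [← Matrix.mul_kronecker_mul, mul_one]
    have : (T μ : Matrix (Fin (2 ^ n)) (Fin (2 ^ n)) ℂ)ᴴ * (T μ : Matrix _ _ ℂ) = 1 :=
      Unitary.coe_star_mul_self (T μ)
    rw [this, Matrix.one_kronecker_one]
  | basisChangeAdj μ =>
    simp only [Gate.inv, Gate.op]
    rw [← Matrix.mul_kronecker_mul, mul_one]
    have : (T μ : Matrix (Fin (2 ^ n)) (Fin (2 ^ n)) ℂ) * (T μ : Matrix _ _ ℂ)ᴴ = 1 :=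
      Unitary.coe_mul_star_self (T μ)
    rw [this, Matrix.one_kronecker_one]

theorem Gate.queryCost_inv (G : Gate n d M nt nH a) : G.inv.queryCost = G.queryCost := by
  cases G <;> rfl

theorem Gate.basisCost_inv (G : Gate n d M nt nH a) : G.inv.basisCost = G.basisCost := by
  cases G <;> rfl

/-- The circuit which undoes a circuit. -/
def Circuit.inv (g : Circuit n d M nt nH a) : Circuit n d M nt nH a := (g.map Gate.inv).reverse

theorem Circuit.op_inv_mul (g : Circuit n d M nt nH a) :
    Circuit.op O T (Circuit.inv g) * Circuit.op O T g = 1 := by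
  induction g with
  | nil => simp [Circuit.inv, Circuit.op_nil]
  | cons G g ih =>
    have h1 : Circuit.inv (G :: g) = Circuit.inv g ++ [G.inv] := by simp [Circuit.inv]
    rw [h1, Circuit.op_append, Circuit.op_cons, Circuit.op_cons, Circuit.op_nil, one_mul,
      mul_assoc, ← mul_assoc (Circuit.op O T (Circuit.inv g)), ih, one_mul, Gate.op_inv_mul]

theorem Circuit.queries_inv (g : Circuit n d M nt nH a) :
    Circuit.queries (Circuit.inv g) = Circuit.queries g := by
  simp [Circuit.queries, Circuit.inv, List.sum_reverse, Function.comp_def, Gate.queryCost_inv]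

theorem Circuit.basisCalls_inv (g : Circuit n d M nt nH a) :
    Circuit.basisCalls (Circuit.inv g) = Circuit.basisCalls g := by
  simp [Circuit.basisCalls, Circuit.inv, List.sum_reverse, Function.comp_def, Gate.basisCost_inv]

/-- The free gate which permutes the computational basis. -/
def permGate (e : Equiv.Perm (CompBasis n a)) : Gate n d M nt nH a :=
  .free ⟨Equiv.Perm.permMatrix ℂ e.symm, by
    rw [Matrix.mem_unitaryGroup_iff, Matrix.star_eq_conjTranspose, Matrix.conjTranspose_permMatrix,
      ← Matrix.permMatrix_mul]
    simp⟩

theorem op_permGate_mulVec (e : Equiv.Perm (CompBasis n a)) (v : CompBasis n a → ℂ) :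
    Gate.op O T (permGate e) *ᵥ v = v ∘ e.symm :=
  Matrix.permMatrix_mulVec e.symm

/-- The state `∑ x, ψ x |x⟩|0⟩|0⟩|W x⟩`. -/
def withRecord (W : Fin (2 ^ n) → Fin a → Bool) (ψ : Fin (2 ^ n) → ℂ) : CompBasis n a → ℂ :=
  fun s => if s.2 = (0, false, W s.1) then ψ s.1 else 0

theorem withAncillas_eq_withRecord (ψ : Fin (2 ^ n) → ℂ) :
    withAncillas a ψ = withRecord (fun _ _ => false) ψ := by
  funext ⟨x, y, b, w⟩
  simp only [withAncillas, withRecord, Prod.mk.injEq, Fin.ext_iff, Fin.val_zero]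

/-! ### Reading the oracles -/

/-- The bits which can be read from the oracles for one matrix and one time: the bits of column
numbers, and the bits of matrix elements. -/
abbrev Cell (n d nH : ℕ) : Type :=
  (Fin (2 ^ n) × Fin d × Fin n) ⊕ (Fin (2 ^ n) × Fin (2 ^ n) × Fin nH)

/-- The contents of a cell. -/
def cellValue (O : HamOracle n d M nt nH) (μ : Fin M) (q : Fin (2 ^ nt)) : Cell n d nH → Bool
  | .inl (x, i, p) => (O.col μ x i : ℕ).testBit p
  | .inr (x, y, p) => O.val μ q x y p

/-- The cell of the same kind in the row `x`. -/
def cellAt (x : Fin (2 ^ n)) : Cell n d nH → Cell n d nH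
  | .inl (_, i, p) => .inl (x, i, p)
  | .inr (_, y, p) => .inr (x, y, p)

/-- The row number of a cell. -/
def cellRow : Cell n d nH → Fin (2 ^ n)
  | .inl (x, _, _) => x
  | .inr (x, _, _) => x

/-- The contents of the column register with which a cell is read. -/
def cellCol : Cell n d nH → Fin (2 ^ n)
  | .inl _ => 0
  | .inr (_, y, _) => y

/-- The query which reads a cell. -/
def cellQuery (μ : Fin M) (q : Fin (2 ^ nt)) : Cell n d nH → Gate n d M nt nH a
  | .inl (_, i, p) => .queryCol p i μ
  | .inr (_, _, p) => .queryVal p μ q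

/-- The query for a cell acts on the row and column registers as a query of the bits of the cells of
the same kind in all rows, provided that the column register has the contents `cellCol z`. -/
theorem exists_op_cellQuery (O : HamOracle n d M nt nH)
    (T : Fin M → Matrix.unitaryGroup (Fin (2 ^ n)) ℂ) (μ : Fin M) (q : Fin (2 ^ nt))
    (z : Cell n d nH) : ∃ g, Gate.op O T (cellQuery (a := a) μ q z) = xorMatrix g ∧
      ∀ x, g x (cellCol z) = cellValue O μ q (cellAt x z) := by
  rcases z with ⟨x, i, p⟩ | ⟨x, y, p⟩
  · exact ⟨fun x _ => (O.col μ x i : ℕ).testBit p, rfl, fun x => rfl⟩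
  · exact ⟨fun x y => O.val μ q x y p, rfl, fun x => rfl⟩

/-- Addition of constants to the row register and to the column register. -/
def shiftPerm (k l : Fin (2 ^ n)) : Equiv.Perm (CompBasis n a) :=
  (Equiv.addRight k).prodCongr ((Equiv.addRight l).prodCongr (Equiv.refl _))

/-- Exchange of the target qubit with a work qubit which depends on the row register. -/
def swapPerm (f : Fin (2 ^ n) → Fin a) : Equiv.Perm (CompBasis n a) :=
  Function.Involutive.toPerm (fun s => (s.1, s.2.1, s.2.2.2 (f s.1),
    Function.update s.2.2.2 (f s.1) s.2.2.1)) fun s => by simp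

theorem shiftPerm_apply (k l x y : Fin (2 ^ n)) (o : Bool × (Fin a → Bool)) :
    shiftPerm k l (x, y, o) = (x + k, y + l, o) := rfl

theorem shiftPerm_symm_apply (k l x y : Fin (2 ^ n)) (o : Bool × (Fin a → Bool)) :
    (shiftPerm k l).symm (x + k, y + l, o) = (x, y, o) := by
  rw [← shiftPerm_apply, Equiv.symm_apply_apply]

theorem swapPerm_symm_apply (f : Fin (2 ^ n) → Fin a) (x y : Fin (2 ^ n)) (b : Bool)
    (w : Fin a → Bool) :
    (swapPerm f).symm (x, y, b, w) = (x, y, w (f x), Function.update w (f x) b) := rfl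

/-- The circuit which reads a bit into a work qubit: the row number is shifted by `cellRow z`, so
that all rows are read when `z` runs over all cells. The work qubit is chosen according to the row
which is actually read. -/
def readCell (e : Cell n d nH ≃ Fin a) (μ : Fin M) (q : Fin (2 ^ nt)) (z : Cell n d nH) :
    Circuit n d M nt nH a :=
  [permGate (shiftPerm (cellRow z) (cellCol z)), cellQuery μ q z,
    permGate (swapPerm fun x => e (cellAt x z)),
    permGate (shiftPerm (cellRow z) (cellCol z)).symm]

theorem op_readCell_mulVec (e : Cell n d nH ≃ Fin a) (μ : Fin M) (q : Fin (2 ^ nt))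
    (z : Cell n d nH) (W : Fin (2 ^ n) → Fin a → Bool) (ψ : Fin (2 ^ n) → ℂ)
    (hW : ∀ x, W x (e (cellAt (x + cellRow z) z)) = false) :
    Circuit.op O T (readCell e μ q z) *ᵥ withRecord W ψ =
      withRecord (fun x => Function.update (W x) (e (cellAt (x + cellRow z) z))
        (cellValue O μ q (cellAt (x + cellRow z) z))) ψ := by
  obtain ⟨g, hg, hgz⟩ := exists_op_cellQuery (a := a) O T μ q z
  simp only [readCell, Circuit.op_cons, Circuit.op_nil, one_mul, ← Matrix.mulVec_mulVec,
    op_permGate_mulVec, hg, xorMatrix_mulVec]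
  funext ⟨x, y, b, w⟩
  have hw : ∀ (j : Fin a) (w' : Fin a → Bool) (b' : Bool), w' j = false →
      ((xor (w j) b' = false ∧ Function.update w j b = w') ↔
        (b = false ∧ w = Function.update w' j b')) := by
    intro j w' b' hj
    constructor
    · rintro ⟨h1, rfl⟩
      rw [Function.update_self] at hj
      have h2 : w j = b' := by
        revert h1
        cases w j <;> cases b' <;> simp
      refine ⟨hj, ?_⟩
      rw [Function.update_idem, ← h2, Function.update_eq_self]
    · rintro ⟨rfl, rfl⟩
      have h1 := Function.update_eq_self j w'
      rw [hj] at h1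
      rw [Function.update_self, Function.update_idem, h1]
      simp
  have hx := hw _ (W x) (cellValue O μ q (cellAt (x + cellRow z) z)) (hW x)
  simp only [Function.comp_apply, Equiv.symm_symm, shiftPerm_apply, swapPerm_symm_apply,
    shiftPerm_symm_apply, withRecord, Prod.mk.injEq]
  by_cases hy : y = 0
  · subst hy
    simp only [zero_add, true_and, hgz, hx]
  · simp [hy]

/-- The circuit which reads all bits for one matrix and one time. -/
def readAll (e : Cell n d nH ≃ Fin a) (μ : Fin M) (q : Fin (2 ^ nt)) : Circuit n d M nt nH a :=
  (Finset.univ : Finset (Cell n d nH)).toList.flatMap (readCell e μ q)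

theorem cellAt_add_injective (x : Fin (2 ^ n)) :
    Function.Injective fun z : Cell n d nH => cellAt (x + cellRow z) z := by
  rintro (⟨x₁, i, p⟩ | ⟨x₁, i, p⟩) (⟨x₂, j, p'⟩ | ⟨x₂, j, p'⟩) h <;>
    simp_all [cellAt, cellRow]

theorem op_flatMap_readCell_mulVec (e : Cell n d nH ≃ Fin a) (μ : Fin M) (q : Fin (2 ^ nt))
    (ψ : Fin (2 ^ n) → ℂ) (l : List (Cell n d nH)) (hl : l.Nodup)
    (W : Fin (2 ^ n) → Fin a → Bool)
    (hW : ∀ x, ∀ z ∈ l, W x (e (cellAt (x + cellRow z) z)) = false) :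
    ∃ W', Circuit.op O T (l.flatMap (readCell e μ q)) *ᵥ withRecord W ψ = withRecord W' ψ ∧
      ∀ x z', W' x (e z') = if ∃ z ∈ l, cellAt (x + cellRow z) z = z' then cellValue O μ q z'
        else W x (e z') := by
  classical
  induction l generalizing W with
  | nil => exact ⟨W, by simp [Circuit.op_nil], by simp⟩
  | cons z l ih =>
    rw [List.nodup_cons] at hl
    have h1 := op_readCell_mulVec (O := O) (T := T) e μ q z W ψ fun x => hW x z (by simp)
    have hne : ∀ x, ∀ z' ∈ l, e (cellAt (x + cellRow z') z') ≠ e (cellAt (x + cellRow z) z) :=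
      fun x z' hz' h => hl.1 (cellAt_add_injective x (e.injective h) ▸ hz')
    obtain ⟨W', h2, h3⟩ := ih hl.2 (fun x => Function.update (W x) (e (cellAt (x + cellRow z) z))
        (cellValue O μ q (cellAt (x + cellRow z) z))) fun x z' hz' => by
      rw [Function.update_of_ne (hne x z' hz')]
      exact hW x z' (by simp [hz'])
    refine ⟨W', ?_, fun x z' => ?_⟩
    · rw [List.flatMap_cons, Circuit.op_append, ← Matrix.mulVec_mulVec, h1, h2]
    · rw [h3 x z']
      by_cases hz : cellAt (x + cellRow z) z = z'
      · subst hz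
        simp
      · have : ¬ e z' = e (cellAt (x + cellRow z) z) := fun h => hz (e.injective h).symm
        rw [Function.update_of_ne this]
        simp [hz]

/-- In each branch of the superposition the row register is shifted differently, but in each branch
all cells are read once, so that the final record does not depend on the row. -/
theorem op_readAll_mulVec (e : Cell n d nH ≃ Fin a) (μ : Fin M) (q : Fin (2 ^ nt))
    (ψ : Fin (2 ^ n) → ℂ) :
    Circuit.op O T (readAll e μ q) *ᵥ withAncillas a ψ =
      withRecord (fun _ => cellValue O μ q ∘ e.symm) ψ := by
  obtain ⟨W', h1, h2⟩ := op_flatMap_readCell_mulVec (O := O) (T := T) e μ q ψ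
    (Finset.univ : Finset (Cell n d nH)).toList (Finset.nodup_toList _) (fun _ _ => false)
    fun _ _ _ => rfl
  rw [withAncillas_eq_withRecord, readAll, h1]
  congr 1
  funext x j
  obtain ⟨z', rfl⟩ := e.surjective j
  obtain ⟨z, hz⟩ := (Finite.injective_iff_surjective.1 (cellAt_add_injective x)) z'
  rw [h2, if_pos ⟨z, by simp, hz⟩]
  simp

theorem queries_readAll (e : Cell n d nH ≃ Fin a) (μ : Fin M) (q : Fin (2 ^ nt)) :
    Circuit.queries (readAll e μ q) = Fintype.card (Cell n d nH) ∧
      Circuit.basisCalls (readAll e μ q) = 0 := by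
  have key : ∀ l : List (Cell n d nH),
      Circuit.queries (l.flatMap (readCell e μ q)) = l.length ∧
        Circuit.basisCalls (l.flatMap (readCell e μ q)) = 0 := by
    intro l
    induction l with
    | nil => exact ⟨rfl, rfl⟩
    | cons z l ih =>
      rw [List.flatMap_cons, Circuit.queries_append, Circuit.basisCalls_append, ih.1, ih.2,
        List.length_cons]
      rcases z with ⟨x, i, p⟩ | ⟨x, y, p⟩ <;>
        simp [Circuit.queries, Circuit.basisCalls, readCell, cellQuery, permGate, Gate.queryCost,
          Gate.basisCost, add_comm]
  have := key (Finset.univ : Finset (Cell n d nH)).toList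
  rwa [Finset.length_toList, Finset.card_univ] at this

/-- The one-sparse terms are determined by the bits which are read. -/
theorem oneSparseExp_congr {O' : HamOracle n d M nt nH} {μ : Fin M} {q : Fin (2 ^ nt)}
    (h : cellValue O' μ q = cellValue O μ q) (Hmax : ℝ) (c : TermIndex d) (δ : ℝ) :
    oneSparseExp O' Hmax μ c q δ = oneSparseExp O Hmax μ c q δ := by
  have h1 : O'.col μ = O.col μ := by
    funext x i
    refine Fin.ext (Nat.eq_of_testBit_eq fun p => ?_)
    by_cases hp : p < n
    · exact congrFun h (.inl (x, i, ⟨p, hp⟩))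
    · have hpow : 2 ^ n ≤ 2 ^ p := Nat.pow_le_pow_right (by norm_num) (not_lt.1 hp)
      rw [Nat.testBit_lt_two_pow ((O'.col μ x i).2.trans_le hpow),
        Nat.testBit_lt_two_pow ((O.col μ x i).2.trans_le hpow)]
  have h2 : O'.val μ q = O.val μ q := by
    funext x y p
    exact congrFun h (.inr (x, y, p))
  rw [oneSparseExp, oneSparseExp, oneSparseTerm, oneSparseTerm, h1, h2]

theorem oneSparseExp_mem_unitaryGroup (O : HamOracle n d M nt nH) (Hmax : ℝ) (μ : Fin M)
    (c : TermIndex d) (q : Fin (2 ^ nt)) (δ : ℝ) :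
    oneSparseExp O Hmax μ c q δ ∈ Matrix.unitaryGroup (Fin (2 ^ n)) ℂ := by
  let : NormedAlgebra ℚ (Matrix (Fin (2 ^ n)) (Fin (2 ^ n)) ℂ) :=
    NormedAlgebra.restrictScalars ℚ ℂ _
  refine NormedSpace.exp_mem_unitary_of_mem_skewAdjoint ?_
  have : star (oneSparseTerm O Hmax μ c q) = oneSparseTerm O Hmax μ c q :=
    isHermitian_oneSparseTerm c
  rw [skewAdjoint.mem_iff, star_smul, this]
  simp

open Classical in
/-- The one-sparse exponential for the oracle whose bits are recorded in the work qubits. -/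
def recordedExp (e : Cell n d nH ≃ Fin a) (Hmax : ℝ) (μ : Fin M) (c : TermIndex d)
    (q : Fin (2 ^ nt)) (δ : ℝ) (w : Fin a → Bool) : Matrix (Fin (2 ^ n)) (Fin (2 ^ n)) ℂ :=
  if h : ∃ O : HamOracle n d M nt nH, cellValue O μ q ∘ e.symm = w then
    oneSparseExp h.choose Hmax μ c q δ
  else 1

theorem recordedExp_eq (e : Cell n d nH ≃ Fin a) (Hmax : ℝ) (μ : Fin M) (c : TermIndex d)
    (q : Fin (2 ^ nt)) (δ : ℝ) :
    recordedExp e Hmax μ c q δ (cellValue O μ q ∘ e.symm) = oneSparseExp O Hmax μ c q δ := by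
  have h : ∃ O' : HamOracle n d M nt nH, cellValue O' μ q ∘ e.symm = cellValue O μ q ∘ e.symm :=
    ⟨O, rfl⟩
  rw [recordedExp, dif_pos h]
  exact oneSparseExp_congr (e.symm.surjective.injective_comp_right h.choose_spec) Hmax c δ

theorem recordedExp_mem_unitaryGroup (e : Cell n d nH ≃ Fin a) (Hmax : ℝ) (μ : Fin M)
    (c : TermIndex d) (q : Fin (2 ^ nt)) (δ : ℝ) (w : Fin a → Bool) :
    recordedExp e Hmax μ c q δ w ∈ Matrix.unitaryGroup (Fin (2 ^ n)) ℂ := by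
  rw [recordedExp]
  split_ifs
  · exact oneSparseExp_mem_unitaryGroup _ _ _ _ _ _
  · exact one_mem _

/-- The free gate which performs the exponential according to the record. -/
def recordedExpGate (e : Cell n d nH ≃ Fin a) (Hmax : ℝ) (μ : Fin M) (c : TermIndex d)
    (q : Fin (2 ^ nt)) (δ : ℝ) : Gate n d M nt nH a :=
  .free ⟨Matrix.blockDiagonal fun o : Fin (2 ^ n) × Bool × (Fin a → Bool) =>
    recordedExp e Hmax μ c q δ o.2.2, by
      rw [Matrix.mem_unitaryGroup_iff, Matrix.star_eq_conjTranspose,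
        Matrix.blockDiagonal_conjTranspose, ← Matrix.blockDiagonal_mul, ← Matrix.blockDiagonal_one]
      congr 1
      funext o
      exact Matrix.mem_unitaryGroup_iff.1 (recordedExp_mem_unitaryGroup e Hmax μ c q δ o.2.2)⟩

theorem blockDiagonal_mulVec_withRecord (w : Fin a → Bool) (ψ : Fin (2 ^ n) → ℂ)
    (E : Fin (2 ^ n) × Bool × (Fin a → Bool) → Matrix (Fin (2 ^ n)) (Fin (2 ^ n)) ℂ) :
    Matrix.blockDiagonal E *ᵥ withRecord (fun _ => w) ψ =
      withRecord (fun _ => w) (E (0, false, w) *ᵥ ψ) := by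
  funext ⟨x, o⟩
  simp only [Matrix.mulVec, dotProduct, Matrix.blockDiagonal_apply, withRecord]
  rw [Fintype.sum_prod_type]
  by_cases ho : o = (0, false, w)
  · subst ho
    simp
  · rw [if_neg ho]
    refine Finset.sum_eq_zero fun x' _ => Finset.sum_eq_zero fun o' _ => ?_
    by_cases h1 : o' = (0, false, w)
    · subst h1
      rw [if_neg ho, zero_mul]
    · rw [if_neg h1, mul_zero]

/-- The exponentials can be performed: all bits are read into work qubits, the exponential is
performed according to this record, and the record is erased. -/
theorem exists_implements_oneSparseExp (n d M nt nH : ℕ) (Hmax : ℝ) :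
    ∃ C a : ℕ, ∀ (μ : Fin M) (c : TermIndex d) (q : Fin (2 ^ nt)) (δ : ℝ),
      ∃ g : Circuit n d M nt nH a, Circuit.queries g ≤ C ∧ Circuit.basisCalls g = 0 ∧
        ∀ (O : HamOracle n d M nt nH) (T : Fin M → Matrix.unitaryGroup (Fin (2 ^ n)) ℂ), O.Valid →
          Circuit.Implements g O T (oneSparseExp O Hmax μ c q δ) := by
  set e := Fintype.equivFin (Cell n d nH)
  refine ⟨2 * Fintype.card (Cell n d nH), _, fun μ c q δ =>
    ⟨readAll e μ q ++ ([recordedExpGate e Hmax μ c q δ] ++ Circuit.inv (readAll e μ q)),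
      ?_, ?_, ?_⟩⟩
  · rw [Circuit.queries_append, Circuit.queries_append, Circuit.queries_inv,
      (queries_readAll e μ q).1]
    simp only [Circuit.queries, recordedExpGate, List.map_cons, List.map_nil, List.sum_cons,
      List.sum_nil, Gate.queryCost]
    omega
  · rw [Circuit.basisCalls_append, Circuit.basisCalls_append, Circuit.basisCalls_inv,
      (queries_readAll e μ q).2]
    rfl
  · intro O T _ ψ
    rw [Circuit.op_append, Circuit.op_append, ← Matrix.mulVec_mulVec, ← Matrix.mulVec_mulVec,
      op_readAll_mulVec, Circuit.op_cons, Circuit.op_nil, one_mul]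
    have h1 : Gate.op O T (recordedExpGate e Hmax μ c q δ) *ᵥ
        withRecord (fun _ => cellValue O μ q ∘ e.symm) ψ =
        withRecord (fun _ => cellValue O μ q ∘ e.symm) (oneSparseExp O Hmax μ c q δ *ᵥ ψ) := by
      rw [← recordedExp_eq e]
      exact blockDiagonal_mulVec_withRecord _ _ _
    rw [h1, ← op_readAll_mulVec (O := O) (T := T), Matrix.mulVec_mulVec, Circuit.op_inv_mul,
      Matrix.one_mulVec]

end Circuits

/-! ### Counting of queries and basis transformations -/

section Hadamard

variable {n d M nt nH a : ℕ} {O : HamOracle n d M nt nH}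
  {T : Fin M → Matrix.unitaryGroup (Fin (2 ^ n)) ℂ}

/-- The Hadamard matrix. -/
def hadamard : Matrix Bool Bool ℂ :=
  Matrix.of fun b b' => ((Real.sqrt 2)⁻¹ : ℂ) * if b && b' then -1 else 1

theorem hadamard_mem_unitary : hadamard ∈ unitary (Matrix Bool Bool ℂ) := by
  have h2 : ((Real.sqrt 2 : ℝ) : ℂ) * ((Real.sqrt 2 : ℝ) : ℂ) = 2 := by
    rw [← Complex.ofReal_mul, Real.mul_self_sqrt (by norm_num)]
    norm_num
  have h0 : ((Real.sqrt 2 : ℝ) : ℂ) ≠ 0 := by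
    rintro h
    rw [h] at h2
    norm_num at h2
  have hs : star hadamard = hadamard := by
    ext b b'
    rw [Matrix.star_apply]
    cases b <;> cases b' <;> simp [hadamard]
  have hm : hadamard * hadamard = 1 := by
    have e : ((Real.sqrt 2 : ℝ) : ℂ)⁻¹ * ((Real.sqrt 2 : ℝ) : ℂ)⁻¹ = 1 / 2 := by
      rw [← mul_inv, h2]
      norm_num
    ext b b'
    rw [Matrix.mul_apply]
    cases b <;> cases b' <;> (simp [hadamard, e]; try norm_num)
  rw [Unitary.mem_iff, hs, hm]
  exact ⟨rfl, rfl⟩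

/-- The Hadamard gate on the target qubit. -/
def hadamardGate : Gate n d M nt nH a :=
  .free ⟨1 ⊗ₖ (1 ⊗ₖ (hadamard ⊗ₖ 1)), Matrix.kronecker_mem_unitary (one_mem _)
    (Matrix.kronecker_mem_unitary (one_mem _)
      (Matrix.kronecker_mem_unitary hadamard_mem_unitary (one_mem _)))⟩

/-- The Hadamard gate brings the target qubit to the state `|0⟩ + |1⟩` up to normalization, on which
exclusive disjunction has no effect. -/
theorem op_hadamardGate_mulVec (ψ : Fin (2 ^ n) → ℂ) (s : CompBasis n a) (b : Bool) :
    (Gate.op O T hadamardGate *ᵥ withAncillas a ψ) (s.1, s.2.1, b, s.2.2.2) =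
      (Gate.op O T hadamardGate *ᵥ withAncillas a ψ) s := by
  simp only [Gate.op, hadamardGate, Matrix.mulVec, dotProduct]
  refine Finset.sum_congr rfl fun s' _ => ?_
  by_cases h : s'.2.2.1 = false
  · simp [Matrix.kroneckerMap_apply, hadamard, h]
  · simp [withAncillas, h]

/-- A query between two Hadamard gates on the target qubit, which has no effect. -/
def idleQuery (Q : Gate n d M nt nH a) : Circuit n d M nt nH a :=
  [hadamardGate, Q, hadamardGate.inv]

theorem queries_idleQuery (Q : Gate n d M nt nH a) :
    Circuit.queries (idleQuery Q) = Q.queryCost := by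
  change 0 + (Q.queryCost + (0 + 0)) = _
  omega

theorem basisCalls_idleQuery (Q : Gate n d M nt nH a) :
    Circuit.basisCalls (idleQuery Q) = Q.basisCost := by
  change 0 + (Q.basisCost + (0 + 0)) = _
  omega

theorem implements_idleQuery {Q : Gate n d M nt nH a} (hQ : Q.queryCost = 1) :
    Circuit.Implements (idleQuery Q) O T 1 := by
  obtain ⟨g, hg⟩ : ∃ g, Q.op O T = xorMatrix g := by
    cases Q with
    | queryCol p i μ => exact ⟨fun x _ => (O.col μ x i : ℕ).testBit p, rfl⟩
    | queryVal p μ q => exact ⟨fun x y => O.val μ q x y p, rfl⟩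
    | _ => simp [Gate.queryCost] at hQ
  intro ψ
  rw [idleQuery, Circuit.op_cons, Circuit.op_cons, Circuit.op_cons, Circuit.op_nil, one_mul, hg,
    ← Matrix.mulVec_mulVec, ← Matrix.mulVec_mulVec, xorMatrix_mulVec]
  simp only [op_hadamardGate_mulVec]
  rw [Matrix.mulVec_mulVec, Gate.op_inv_mul, Matrix.one_mulVec, Matrix.one_mulVec]

end Hadamard

section Realizable

variable {n d M nt nH a : ℕ}

/-- The operation `V`, which depends on the oracles and on the basis transformations, is performed
by a circuit with exactly `N` queries and exactly `B` basis transformations. -/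
def Realizable (a N B : ℕ) (V : HamOracle n d M nt nH →
    (Fin M → Matrix.unitaryGroup (Fin (2 ^ n)) ℂ) → Matrix (Fin (2 ^ n)) (Fin (2 ^ n)) ℂ) : Prop :=
  ∃ g : Circuit n d M nt nH a, Circuit.queries g = N ∧ Circuit.basisCalls g = B ∧
    ∀ O T, O.Valid → Circuit.Implements g O T (V O T)

theorem Circuit.Implements.append {g g' : Circuit n d M nt nH a} {O : HamOracle n d M nt nH}
    {T : Fin M → Matrix.unitaryGroup (Fin (2 ^ n)) ℂ} {V V' : Matrix (Fin (2 ^ n)) (Fin (2 ^ n)) ℂ}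
    (h : Circuit.Implements g O T V) (h' : Circuit.Implements g' O T V') :
    Circuit.Implements (g ++ g') O T (V' * V) := by
  intro ψ
  rw [Circuit.op_append, ← Matrix.mulVec_mulVec, h ψ, h' _, Matrix.mulVec_mulVec]

theorem realizable_one : Realizable a 0 0 fun (_ : HamOracle n d M nt nH) _ => 1 :=
  ⟨[], rfl, rfl, fun O T _ ψ => by rw [Circuit.op_nil, Matrix.one_mulVec, Matrix.one_mulVec]⟩

variable {N N' B B' : ℕ} {V V' : HamOracle n d M nt nH →
    (Fin M → Matrix.unitaryGroup (Fin (2 ^ n)) ℂ) → Matrix (Fin (2 ^ n)) (Fin (2 ^ n)) ℂ}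

theorem Realizable.mul (h : Realizable a N B V) (h' : Realizable a N' B' V') :
    Realizable a (N + N') (B + B') fun O T => V O T * V' O T := by
  obtain ⟨g, h1, h2, h3⟩ := h
  obtain ⟨g', h1', h2', h3'⟩ := h'
  refine ⟨g' ++ g, ?_, ?_, fun O T hO => (h3' O T hO).append (h3 O T hO)⟩
  · rw [Circuit.queries_append, h1, h1', add_comm]
  · rw [Circuit.basisCalls_append, h2, h2', add_comm]

theorem Realizable.list_prod {ι : Type*} {V : ι → HamOracle n d M nt nH →
    (Fin M → Matrix.unitaryGroup (Fin (2 ^ n)) ℂ) → Matrix (Fin (2 ^ n)) (Fin (2 ^ n)) ℂ}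
    (h : ∀ j, Realizable a N B (V j)) (l : List ι) :
    Realizable a (l.length * N) (l.length * B) fun O T => (l.map fun j => V j O T).prod := by
  induction l with
  | nil => simpa using realizable_one
  | cons j l ih =>
    have := (h j).mul ih
    simp only [List.length_cons, List.map_cons, List.prod_cons, add_mul, one_mul]
    rwa [add_comm (l.length * N), add_comm (l.length * B)]

theorem kronecker_one_mulVec_withAncillas (A : Matrix (Fin (2 ^ n)) (Fin (2 ^ n)) ℂ)
    (ψ : Fin (2 ^ n) → ℂ) : (A ⊗ₖ (1 : Matrix (Fin (2 ^ n) × Bool × (Fin a → Bool)) _ ℂ)) *ᵥ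
      withAncillas a ψ = withAncillas a (A *ᵥ ψ) := by
  have h : A ⊗ₖ (1 : Matrix (Fin (2 ^ n) × Bool × (Fin a → Bool)) _ ℂ) =
      Matrix.blockDiagonal fun _ => A := Matrix.kronecker_one A
  rw [h, withAncillas_eq_withRecord, withAncillas_eq_withRecord]
  exact blockDiagonal_mulVec_withRecord _ ψ fun _ => A

theorem realizable_basisChange (μ : Fin M) :
    Realizable a 0 1 fun (_ : HamOracle n d M nt nH) T =>
      (T μ : Matrix (Fin (2 ^ n)) (Fin (2 ^ n)) ℂ) :=
  ⟨[.basisChange μ], rfl, rfl, fun O T _ ψ => by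
    rw [Circuit.op_cons, Circuit.op_nil, one_mul]
    exact kronecker_one_mulVec_withAncillas _ ψ⟩

theorem realizable_basisChangeAdj (μ : Fin M) :
    Realizable a 0 1 fun (_ : HamOracle n d M nt nH) T =>
      (T μ : Matrix (Fin (2 ^ n)) (Fin (2 ^ n)) ℂ)ᴴ :=
  ⟨[.basisChangeAdj μ], rfl, rfl, fun O T _ ψ => by
    rw [Circuit.op_cons, Circuit.op_nil, one_mul]
    exact kronecker_one_mulVec_withAncillas _ ψ⟩

/-- Idle queries bring the number of queries of each exponential to exactly `C`. There are queries
unless `C = 0`. -/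
theorem exists_realizable_oneSparseExp (n d M nt nH : ℕ) (Hmax : ℝ) :
    ∃ a : ℕ, ∀ (μ : Fin M) (c : TermIndex d) (q : Fin (2 ^ nt)) (δ : ℝ),
      Realizable a (oneSparseCost n d M nt nH Hmax) 0
        fun (O : HamOracle n d M nt nH) _ => oneSparseExp O Hmax μ c q δ := by
  have hmem := Nat.sInf_mem (exists_implements_oneSparseExp n d M nt nH Hmax)
  change ∃ a : ℕ, ∀ (μ : Fin M) (c : TermIndex d) (q : Fin (2 ^ nt)) (δ : ℝ),
    ∃ g : Circuit n d M nt nH a, Circuit.queries g ≤ oneSparseCost n d M nt nH Hmax ∧ _ at hmem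
  obtain ⟨a, ha⟩ := hmem
  refine ⟨a, fun μ c q δ => ?_⟩
  obtain ⟨g, h1, h2, h3⟩ := ha μ c q δ
  by_cases hQ : ∃ Q : Gate n d M nt nH a, Q.queryCost = 1
  · obtain ⟨Q, hQ⟩ := hQ
    have hQB : Q.basisCost = 0 := by
      cases Q <;> simp_all [Gate.queryCost, Gate.basisCost]
    have hidle : Realizable a 1 0 fun (_ : HamOracle n d M nt nH)
        (_ : Fin M → Matrix.unitaryGroup (Fin (2 ^ n)) ℂ) => 1 :=
      ⟨idleQuery Q, by rw [queries_idleQuery, hQ], by rw [basisCalls_idleQuery, hQB],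
        fun O T _ => implements_idleQuery hQ⟩
    have hg : Realizable a (Circuit.queries g) 0 fun (O : HamOracle n d M nt nH) _ =>
        oneSparseExp O Hmax μ c q δ :=
      ⟨g, rfl, h2, h3⟩
    have := hg.mul (Realizable.list_prod (fun _ : ℕ => hidle)
      (List.range (oneSparseCost n d M nt nH Hmax - Circuit.queries g)))
    simpa [h1] using this
  · push Not at hQ
    have h0 : ∀ g' : Circuit n d M nt nH a, Circuit.queries g' = 0 := by
      intro g'
      refine List.sum_eq_zero fun x hx => ?_
      obtain ⟨Q, -, rfl⟩ := List.mem_map.1 hx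
      have := hQ Q
      cases Q <;> simp_all [Gate.queryCost]
    have hC : oneSparseCost n d M nt nH Hmax = 0 := by
      refine Nat.le_zero.1 (Nat.sInf_le ⟨a, fun μ c q δ => ?_⟩)
      obtain ⟨g', -, h2', h3'⟩ := ha μ c q δ
      exact ⟨g', (h0 g').le, h2', h3'⟩
    exact ⟨g, by rw [hC, h0], h2, h3⟩

variable {C : ℕ} {Hmax t₀ Δt : ℝ}

theorem length_termList (d : ℕ) : (termList d).length = 6 * d ^ 2 := by
  simp [termList, List.length_product]
  ring

/-- The first integrator consists of `12 M d²` exponentials; each of the `2 M` groups of `6 d²` of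
them is conjugated by a basis transformation. -/
theorem realizable_integratorOne (h : ∀ (μ : Fin M) (c : TermIndex d) (q : Fin (2 ^ nt)) (δ : ℝ),
    Realizable a C 0 fun (O : HamOracle n d M nt nH) _ => oneSparseExp O Hmax μ c q δ) (b b' : ℝ) :
    Realizable a (12 * M * d ^ 2 * C) (4 * M) fun (O : HamOracle n d M nt nH) T =>
      integratorOne O T Hmax t₀ Δt b b' := by
  set q := meshIndex t₀ Δt nt ((b' + b) / 2)
  set δ := (b - b') / 2
  have hterm : ∀ (l : List (TermIndex d)), l.length = 6 * d ^ 2 → ∀ μ : Fin M,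
      Realizable a (6 * d ^ 2 * C) 2 fun (O : HamOracle n d M nt nH) T =>
        (T μ : Matrix (Fin (2 ^ n)) (Fin (2 ^ n)) ℂ)ᴴ *
          (l.map fun c => oneSparseExp O Hmax μ c q δ).prod *
            (T μ : Matrix (Fin (2 ^ n)) (Fin (2 ^ n)) ℂ) := by
    intro l hl μ
    have := ((realizable_basisChangeAdj μ).mul (Realizable.list_prod (fun c => h μ c q δ) l)).mul
      (realizable_basisChange μ)
    simpa [hl] using this
  have key := (Realizable.list_prod (hterm (termList d) (length_termList d)) (List.finRange M)).mul
    (Realizable.list_prod (hterm (termList d).reverse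
      (by rw [List.length_reverse, length_termList])) (List.finRange M).reverse)
  rw [List.length_reverse, List.length_finRange] at key
  rw [show 12 * M * d ^ 2 * C = M * (6 * d ^ 2 * C) + M * (6 * d ^ 2 * C) by ring,
    show 4 * M = M * 2 + M * 2 by ring]
  exact key

/-- Each step of Suzuki's recursion multiplies the number of factors by five. -/
theorem realizable_suzuki (h : ∀ b b' : ℝ, Realizable (n := n) (d := d) (nt := nt) (nH := nH)
    a N B fun (O : HamOracle n d M nt nH) T => integratorOne O T Hmax t₀ Δt b b')
    (m : ℕ) (b b' : ℝ) :
    Realizable a (5 ^ m * N) (5 ^ m * B) fun (O : HamOracle n d M nt nH) T =>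
      suzuki (integratorOne O T Hmax t₀ Δt) m b b' := by
  induction m generalizing b b' with
  | zero => simpa [suzuki] using h b b'
  | succ m ih =>
    rw [show 5 ^ (m + 1) * N = 5 ^ m * N + 5 ^ m * N + 5 ^ m * N + 5 ^ m * N + 5 ^ m * N by ring,
      show 5 ^ (m + 1) * B = 5 ^ m * B + 5 ^ m * B + 5 ^ m * B + 5 ^ m * B + 5 ^ m * B by ring]
    exact ((((ih _ _).mul (ih _ _)).mul (ih _ _)).mul (ih _ _)).mul (ih _ _)

theorem realizable_integratorProduct (h : ∀ (μ : Fin M) (c : TermIndex d) (q : Fin (2 ^ nt))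
    (δ : ℝ), Realizable a C 0 fun (O : HamOracle n d M nt nH) _ => oneSparseExp O Hmax μ c q δ)
    (k : ℕ) (t : ℕ → ℝ) (r : ℕ) :
    Realizable a (r * (5 ^ (k - 1) * (12 * M * d ^ 2 * C)))
      (r * (5 ^ (k - 1) * (4 * M))) fun (O : HamOracle n d M nt nH) T =>
        integratorProduct O T Hmax t₀ Δt k t r := by
  have := Realizable.list_prod (fun p : ℕ => realizable_suzuki (t₀ := t₀) (Δt := Δt)
    (realizable_integratorOne h) (k - 1) (t (p + 1)) (t p)) (List.range r).reverse
  rwa [List.length_reverse, List.length_range] at this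

end Realizable

end QSim

end

theorem mainTheorem2 (n d M k nt nH : ℕ) (hd : 1 ≤ d) (hk : 1 ≤ k)
    (t₀ Δt ε K Hmax Dmax : ℝ) (hΔt : 0 < Δt) (hε₀ : 0 < ε) (hε₁ : ε ≤ 1)
    (Υ : ℝ → ℝ) (hΥ₀ : ∀ t ∈ Set.Icc t₀ (t₀ + Δt), 0 ≤ Υ t)
    (hΥ₁ : DifferentiableOn ℝ Υ (Set.Icc t₀ (t₀ + Δt)))
    (hΥ₂ : ∀ t ∈ Set.Icc t₀ (t₀ + Δt),
      |derivWithin Υ (Set.Icc t₀ (t₀ + Δt)) t| ≤ K ^ 2 * Υ t ^ 2)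
    (hnt : ⌈Real.logb 2 (Dmax * (32 * k * M * d ^ 2) * (5 / 3 : ℝ) ^ (k - 1) * Δt ^ 2 / ε)⌉ ≤ (nt : ℤ))
    (hnH : 2 * ⌈Real.logb 2 (32 * k * M * d ^ 2 * (5 / 3 : ℝ) ^ (k - 1) * Hmax * Δt / ε)⌉ + 6
      ≤ (nH : ℤ)) :
    let C : ℕ := QSim.oneSparseCost n d M nt nH Hmax
    let rg : ℕ := QSim.stepBound d k K ε t₀ Δt Υ
    let t : ℕ → ℝ := QSim.adaptiveTime Υ (QSim.stepConst d k ε rg) K t₀ Δt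
    ∃ r : ℕ, 1 ≤ r ∧ r ≤ rg ∧ (∀ p < r, t p < t (p + 1)) ∧ t r = t₀ + Δt ∧
      ∃ (a : ℕ) (g : QSim.Circuit n d M nt nH a),
        (QSim.Circuit.queries g ≤
          12 * C * M * d ^ 2 * 5 ^ (k - 1) * QSim.stepBound d k K (ε / 4) t₀ Δt Υ) ∧
        (QSim.Circuit.basisCalls g * (3 * C * d ^ 2) ≤ QSim.Circuit.queries g) ∧
        (QSim.Circuit.basisCalls g * (3 * d ^ 2) ≤
          12 * M * d ^ 2 * 5 ^ (k - 1) * QSim.stepBound d k K (ε / 4) t₀ Δt Υ) ∧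
        ∀ (H : Fin M → ℝ → Matrix (Fin (2 ^ n)) (Fin (2 ^ n)) ℂ)
          (T : Fin M → Matrix.unitaryGroup (Fin (2 ^ n)) ℂ)
          (O : QSim.HamOracle n d M nt nH),
          (∀ μ, ∀ s ∈ Set.Icc t₀ (t₀ + Δt), (H μ s).IsHermitian) →
          QSim.IsPointwiseSmoothOn H Υ (2 * k) (Set.Icc t₀ (t₀ + Δt)) →
          QSim.IsSparseOn H d (Set.Icc t₀ (t₀ + Δt)) →
          (∀ μ, ∀ s ∈ Set.Icc t₀ (t₀ + Δt), ‖H μ s‖ ≤ Hmax) →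
          (∀ μ, ∀ s ∈ Set.Icc t₀ (t₀ + Δt),
            ‖derivWithin (H μ) (Set.Icc t₀ (t₀ + Δt)) s‖ ≤ Dmax) →
          O.IsOracleFor Hmax t₀ Δt H →
          QSim.Circuit.Implements g O T (QSim.integratorProduct O T Hmax t₀ Δt k t r) ∧
          ∀ U : ℝ → Matrix (Fin (2 ^ n)) (Fin (2 ^ n)) ℂ,
            QSim.IsEvolution (QSim.totalHamiltonian H T) t₀ Δt U →
            ‖U (t₀ + Δt) - QSim.integratorProduct O T Hmax t₀ Δt k t r‖ ≤ ε := by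
  intro C rg t
  obtain ⟨m, rfl⟩ : ∃ m, k = m + 1 := ⟨k - 1, by omega⟩
  have hrg : 1 ≤ rg := QSim.one_le_stepBound hΔt hε₀ hΥ₀
  have hrgL : rg ≤ QSim.stepBound d (m + 1) K (ε / 4) t₀ Δt Υ :=
    QSim.stepBound_anti hΔt (by positivity) (by linarith) hΥ₀
  have hd' : (1 : ℝ) ≤ d := by exact_mod_cast hd
  have hY : 0 < QSim.stepConst d (m + 1) ε rg := by
    have : (0 : ℝ) < rg := by exact_mod_cast hrg
    rw [QSim.stepConst]
    positivity
  obtain ⟨r, hr₁, hr, hlt, htr, hmem, hstep⟩ := QSim.exists_adaptiveTime_eq (N := rg) hΔt hY hΥ₀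
    hΥ₁ hΥ₂ (QSim.integral_mul_lt_stepBound (by omega) hΔt hε₀ hΥ₀)
  obtain ⟨a, ha⟩ := QSim.exists_realizable_oneSparseExp n d M nt nH Hmax
  obtain ⟨g, hq, hb, himp⟩ := QSim.realizable_integratorProduct (t₀ := t₀) (Δt := Δt) ha (m + 1) t r
  rw [Nat.add_sub_cancel] at hq hb
  refine ⟨r, hr₁, hr, hlt, htr, a, g, ?_, ?_, ?_, ?_⟩
  · rw [hq, Nat.add_sub_cancel]
    calc r * (5 ^ m * (12 * M * d ^ 2 * C)) = 12 * C * M * d ^ 2 * 5 ^ m * r := by ring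
      _ ≤ _ := Nat.mul_le_mul_left _ (hr.trans hrgL)
  · rw [hq, hb]
    exact le_of_eq (by ring)
  · rw [hb, Nat.add_sub_cancel]
    calc r * (5 ^ m * (4 * M)) * (3 * d ^ 2) = 12 * M * d ^ 2 * 5 ^ m * r := by ring
      _ ≤ _ := Nat.mul_le_mul_left _ (hr.trans hrgL)
  · intro H T O hH hsm _ hHmax hDmax hO
    refine ⟨himp O T hO.1, fun U hU => ?_⟩
    refine QSim.norm_evolution_sub_integratorProduct_le (rg := rg) hd hΔt hε₀ hε₁ hΥ₀ ?_ ?_ hH hsm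
      hHmax hDmax hO hU hr hrg rfl htr hlt hmem hstep
    · convert hnt using 4
      rw [Nat.add_sub_cancel]
      push_cast
      ring
    · convert hnH using 6
      rw [Nat.add_sub_cancel]
      push_cast
      ring
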